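/- Let $\Bbbk$ be a field, $G$ an abelian group, and let $\mathcal{YD}={}^{\Bbbk G}_{\Bbbk G}\mathcal{YD}$ be the category of Yetter–Drinfeld modules over $\Bbbk G$: its objects are $G$-graded vector spaces $V=\bigoplus_{h\in G}V_h$ with a linear $G$-action preserving each $V_h$, with the usual tensor product (diagonal action, total degree), unit $\Bbbk$ (trivial action, degree $1$), and braiding $c_{V,W}(v\otimes w)=(g\cdot w)\otimes v$ for $v\in V_g$, $w\in W$. Let $(A,\mu,\eta,\Delta,\varepsilon)$ be a bimonoid in the braided monoidal category $\mathcal{YD}$, and regard $\Bbbk$ as an $A$-bimodule via $\varepsilon$. Suppose that there is a complex $P_\bullet\to A$ of $A$-bimodules in $\mathcal{YD}$ which is a projective resolution of $A$ as an $A$-bimodule, and such that for every $n\ge 0$ the $A$-bimodule $P_n$ is isomorphic, as a $G$-graded $A$-bimodule, to $A\otimes V_n\otimes A$ for some finite-dimensional $G$-graded vector space $V_n$. Let $H^\bullet(A,\Bbbk)=\mathrm{Ext}^\bullet_{A\otimes A^{\mathrm{op}}}(A,\Bbbk)$ be the Hochschild cohomology with trivial coefficients, computed as the cohomology of $\mathrm{Hom}_{AA}(P_\bullet,\Bbbk)$.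 Its cup product is $[f]\cup[f']=[m_\Bbbk\circ(f\otimes_A f')\circ\omega]$, where $\omega\colon P_\bullet\to P_\bullet\otimes_A P_\bullet$ is any chain map of $A$-bimodules lifting the canonical isomorphism $A\cong A\otimes_A A$ (such an $\omega$ exists), and the opposite cup product is $x\smallsmile y=y\cup x$. Then $(H^\bullet(A,\Bbbk),\smallsmile)$, with unit $1=[\varepsilon\circ(P_0\to A)]$, is a graded braided commutative algebra in $\mathcal{YD}$, where the Yetter–Drinfeld structure is the one induced by $\hom_{AA}(P_n,\Bbbk)$. That is: 1. For each $n$, $H^n(A,\Bbbk)$ is an object of $\mathcal{YD}$: $H^n(A,\Bbbk)=\bigoplus_{h\in G}H^n(A,\Bbbk)_h$, where $H^n(A,\Bbbk)_h$ is the set of classes of cocycles $f\colon P_n\to\Bbbk$ that vanish on $(P_n)_s$ for all $s\neq h^{-1}$, and $G$ acts by $g\cdot[f]=[x\mapsto f(g^{-1}\cdot x)]$. 2. $\smallsmile\colon H^p(A,\Bbbk)\otimes H^q(A,\Bbbk)\to H^{p+q}(A,\Bbbk)$ is well defined, independent of $\omega$, associative and unital, and $\smallsmile$ and the unit are morphisms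 in $\mathcal{YD}$ (that is, $G$-equivariant and compatible with the $G$-gradings). 3. $\smallsmile\circ c^{gr}=\smallsmile$, where $c^{gr}=(-1)^{pq}c$ on $H^p\otimes H^q$; that is, $x\smallsmile y=(-1)^{pq}\,(a\cdot y)\smallsmile x$ for $x\in H^p(A,\Bbbk)_a$ and $y\in H^q(A,\Bbbk)$. -/

import Mathlib

open CategoryTheory TensorProduct MulOpposite
open scoped ModuleCat

universe u v w w'

set_option linter.unusedSectionVars false

noncomputable section

/-! ## Yetter-Drinfeld modules over a group algebra -/

/-- A (left-left) Yetter-Drinfeld module structure over the group algebra `k[G]` on a vector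
space `V`: a linear `G`-action and a decomposition `V = ⨁ h, V_h` (the `k[G]`-coaction) with
`g • V_h ⊆ V_{g h g⁻¹}`. -/
structure YetterDrinfeld (k : Type*) (G : Type*) (V : Type*) [Field k] [Group G] [DecidableEq G]
    [AddCommGroup V] [Module k V] where
  act : Representation k G V
  gr : G → Submodule k V
  isInternal : DirectSum.IsInternal gr
  act_mem : ∀ (g h : G) (v : V), v ∈ gr h → act g v ∈ gr (g * h * g⁻¹)

/-- The grading of a tensor product: `(V ⊗ W)_g = ∑_{s t = g} V_s ⊗ W_t`. -/
def tensorGrading {k : Type*} {G : Type*} {V : Type*} {W : Type*} [Field k] [Group G]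
    [AddCommGroup V] [Module k V] [AddCommGroup W] [Module k W]
    (grV : G → Submodule k V) (grW : G → Submodule k W) (g : G) : Submodule k (V ⊗[k] W) :=
  Submodule.span k {x | ∃ s t : G, s * t = g ∧ ∃ v ∈ grV s, ∃ y ∈ grW t, x = v ⊗ₜ[k] y}

section Braiding

variable {k : Type*} {G : Type*} [Field k] [Group G] [DecidableEq G]
  {V : Type*} [AddCommGroup V] [Module k V] {W : Type*} [AddCommGroup W] [Module k W]

/-- The braiding `c_{V,W}(v ⊗ w) = (g • w) ⊗ v` for `v ∈ V_g`, `w ∈ W`. -/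
def YetterDrinfeld.braiding (X : YetterDrinfeld k G V) (Y : YetterDrinfeld k G W) :
    V ⊗[k] W →ₗ[k] W ⊗[k] V :=
  TensorProduct.lift
    ((DirectSum.toModule k G (W →ₗ[k] W ⊗[k] V) fun g =>
        ((TensorProduct.mk k W V).comp (Y.act g)).flip.comp (X.gr g).subtype).comp
      (LinearEquiv.ofBijective (DirectSum.coeLinearMap X.gr) X.isInternal).symm.toLinearMap)

theorem YetterDrinfeld.braiding_tmul (X : YetterDrinfeld k G V) (Y : YetterDrinfeld k G W)
    (g : G) (v : V) (hv : v ∈ X.gr g) (y : W) :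
    X.braiding Y (v ⊗ₜ[k] y) = Y.act g y ⊗ₜ[k] v := by
  have h : (LinearEquiv.ofBijective (DirectSum.coeLinearMap X.gr) X.isInternal).symm v =
      DirectSum.lof k G (fun g => X.gr g) g ⟨v, hv⟩ := by
    rw [LinearEquiv.symm_apply_eq]
    exact (DirectSum.coeLinearMap_lof X.gr g ⟨v, hv⟩).symm
  simp [YetterDrinfeld.braiding, h]

/-- The map `id ⊗ c ⊗ id : (M ⊗ V) ⊗ (W ⊗ N) → (M ⊗ W) ⊗ (V ⊗ N)` attached to
`c : V ⊗ W → W ⊗ V`. -/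
def middleMap {M : Type*} [AddCommGroup M] [Module k M] {N : Type*} [AddCommGroup N] [Module k N]
    (c : V ⊗[k] W →ₗ[k] W ⊗[k] V) :
    (M ⊗[k] V) ⊗[k] (W ⊗[k] N) →ₗ[k] (M ⊗[k] W) ⊗[k] (V ⊗[k] N) :=
  (TensorProduct.assoc k M W (V ⊗[k] N)).symm.toLinearMap ∘ₗ
    LinearMap.lTensor M
      ((TensorProduct.assoc k W V N).toLinearMap ∘ₗ
        LinearMap.rTensor N c ∘ₗ (TensorProduct.assoc k V W N).symm.toLinearMap) ∘ₗ
    (TensorProduct.assoc k M V (W ⊗[k] N)).toLinearMap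

end Braiding

/-! ## Bimonoids in the braided category of Yetter-Drinfeld modules -/

/-- A bimonoid (braided bialgebra) structure in the category of Yetter-Drinfeld modules over
`k[G]`, on a vector space `A` which is an algebra and a coalgebra: the structure maps
`μ, η, Δ, ε` are morphisms of Yetter-Drinfeld modules, and `Δ, ε` are multiplicative and unital,
where `A ⊗ A` has the product `(μ ⊗ μ) ∘ (id ⊗ c ⊗ id)`. -/
structure YDBimonoid (k : Type*) (G : Type*) (A : Type*) [Field k] [Group G] [DecidableEq G]
    [Ring A] [Algebra k A] [Coalgebra k A] extends YetterDrinfeld k G A where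
  one_mem : (1 : A) ∈ gr 1
  mul_mem : ∀ (s t : G) (a b : A), a ∈ gr s → b ∈ gr t → a * b ∈ gr (s * t)
  act_one : ∀ g : G, act g 1 = 1
  act_mul : ∀ (g : G) (a b : A), act g (a * b) = act g a * act g b
  counit_eq_zero : ∀ (s : G) (a : A), s ≠ 1 → a ∈ gr s → Coalgebra.counit (R := k) a = 0
  counit_act : ∀ (g : G) (a : A), Coalgebra.counit (R := k) (act g a) = Coalgebra.counit (R := k) a
  comul_mem : ∀ (s : G) (a : A), a ∈ gr s → Coalgebra.comul (R := k) a ∈ tensorGrading gr gr s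
  comul_act : ∀ (g : G) (a : A), Coalgebra.comul (R := k) (act g a) =
    TensorProduct.map (act g) (act g) (Coalgebra.comul (R := k) a)
  counit_one : Coalgebra.counit (R := k) (1 : A) = 1
  counit_mul : ∀ a b : A, Coalgebra.counit (R := k) (a * b) =
    Coalgebra.counit (R := k) a * Coalgebra.counit (R := k) b
  comul_one : Coalgebra.comul (R := k) (1 : A) = 1 ⊗ₜ[k] 1
  comul_mul : ∀ a b : A, Coalgebra.comul (R := k) (a * b) =
    TensorProduct.map (LinearMap.mul' k A) (LinearMap.mul' k A)
      (middleMap (toYetterDrinfeld.braiding toYetterDrinfeld)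
        (Coalgebra.comul (R := k) a ⊗ₜ[k] Coalgebra.comul (R := k) b))

/-- The counit, as an augmentation of the algebra `A`. -/
def YDBimonoid.aug {k : Type*} {G : Type*} {A : Type*} [Field k] [Group G] [DecidableEq G]
    [Ring A] [Algebra k A] [Coalgebra k A] (B : YDBimonoid k G A) : A →ₐ[k] k :=
  AlgHom.ofLinearMap Coalgebra.counit B.counit_one B.counit_mul

/-! ## Bimodules and Hochschild cohomology

An `A`-bimodule (with central action of `k`) is a module over the enveloping algebra
`A ⊗[k] Aᵐᵒᵖ`; `a · m · b` is `(a ⊗ₜ op b) • m`. -/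

section Bimodules

variable {k : Type u} [Field k] {A : Type u} [Ring A] [Algebra k A]

/-- The `A`-bimodule `R` induced by an algebra map `ρ : A → R`, `a · r · b = ρ(a) r ρ(b)`
(a synonym of `R`). -/
def AlgBimodule {R : Type u} [Ring R] [Algebra k R] (_ρ : A →ₐ[k] R) : Type u := R

instance {R : Type u} [Ring R] [Algebra k R] (ρ : A →ₐ[k] R) : AddCommGroup (AlgBimodule ρ) :=
  inferInstanceAs (AddCommGroup R)

instance {R : Type u} [Ring R] [Algebra k R] (ρ : A →ₐ[k] R) :
    Module (A ⊗[k] Aᵐᵒᵖ) (AlgBimodule ρ) :=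
  Module.compHom R
    ((AlgHom.mulLeftRight k R).comp (Algebra.TensorProduct.map ρ (AlgHom.op ρ))).toRingHom

/-- The underlying additive identification of the bimodule `R` with `R`. -/
def AlgBimodule.toAlg {R : Type u} [Ring R] [Algebra k R] (ρ : A →ₐ[k] R) :
    AlgBimodule ρ ≃+ R := AddEquiv.refl R

theorem AlgBimodule.toAlg_smul {R : Type u} [Ring R] [Algebra k R] (ρ : A →ₐ[k] R) (a b : A)
    (r : AlgBimodule ρ) :
    toAlg ρ ((a ⊗ₜ[k] op b : A ⊗[k] Aᵐᵒᵖ) • r) = ρ a * toAlg ρ r * ρ b := by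
  change AlgHom.mulLeftRight k R (Algebra.TensorProduct.map ρ (AlgHom.op ρ) (a ⊗ₜ[k] op b))
    (toAlg ρ r) = _
  simp

/-- The `A`-bimodule `R`, as an object of the category of bimodules. -/
abbrev algBimod {R : Type u} [Ring R] [Algebra k R] (ρ : A →ₐ[k] R) :
    ModuleCat.{u} (A ⊗[k] Aᵐᵒᵖ) :=
  ModuleCat.of (A ⊗[k] Aᵐᵒᵖ) (AlgBimodule ρ)

/-- The regular bimodule `A`. -/
abbrev regBimod (k A : Type u) [Field k] [Ring A] [Algebra k A] :
    ModuleCat.{u} (A ⊗[k] Aᵐᵒᵖ) :=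
  algBimod (AlgHom.id k A)

/-- The Hochschild cohomology `H^n(A, R) = Ext^n_{A ⊗ Aᵒᵖ}(A, R)`, for the `A`-bimodule structure
on `R` given by `ρ : A → R`. -/
abbrev HochschildCohomology {R : Type u} [Ring R] [Algebra k R] (ρ : A →ₐ[k] R) (n : ℕ) : Type u :=
  Abelian.Ext (regBimod k A) (algBimod ρ) n

/-- A morphism of bimodules `M → R`, as a `k`-linear map. -/
def homToLinear {R : Type u} [Ring R] [Algebra k R] (ρ : A →ₐ[k] R)
    {M : ModuleCat.{u} (A ⊗[k] Aᵐᵒᵖ)} (f : M ⟶ algBimod ρ) : M →ₗ[k] R where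
  toFun x := AlgBimodule.toAlg ρ (f.hom x)
  map_add' x y := by rw [map_add, map_add]
  map_smul' c x := by
    have h : c • x = (algebraMap k A c ⊗ₜ[k] op (1 : A) : A ⊗[k] Aᵐᵒᵖ) • x := rfl
    rw [h, map_smul, AlgBimodule.toAlg_smul]
    simp [Algebra.smul_def]

theorem homToLinear_smul {R : Type u} [Ring R] [Algebra k R] (ρ : A →ₐ[k] R)
    {M : ModuleCat.{u} (A ⊗[k] Aᵐᵒᵖ)} (f : M ⟶ algBimod ρ) (a b : A) (x : M) :
    homToLinear ρ f ((a ⊗ₜ[k] op b : A ⊗[k] Aᵐᵒᵖ) • x) = ρ a * homToLinear ρ f x * ρ b :=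
  (congrArg (AlgBimodule.toAlg ρ) (f.hom.map_smul _ x)).trans (AlgBimodule.toAlg_smul ρ a b _)

/-! ### The tensor product over `A` -/

section TensorOver

variable (k A)
variable (M : Type u) [AddCommGroup M] [Module k M] [Module (A ⊗[k] Aᵐᵒᵖ) M]
  [IsScalarTower k (A ⊗[k] Aᵐᵒᵖ) M]
variable (N : Type u) [AddCommGroup N] [Module k N] [Module (A ⊗[k] Aᵐᵒᵖ) N]
  [IsScalarTower k (A ⊗[k] Aᵐᵒᵖ) N]

/-- The relations `m · a ⊗ n = m ⊗ a · n`. -/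
def tensorOverRel : Submodule k (M ⊗[k] N) :=
  Submodule.span k {x | ∃ (m : M) (a : A) (n : N),
    x = ((1 ⊗ₜ[k] op a : A ⊗[k] Aᵐᵒᵖ) • m) ⊗ₜ[k] n -
      m ⊗ₜ[k] ((a ⊗ₜ[k] 1 : A ⊗[k] Aᵐᵒᵖ) • n)}

/-- The tensor product `M ⊗_A N` of two `A`-bimodules. -/
def TensorOver : Type u := (M ⊗[k] N) ⧸ tensorOverRel k A M N

instance : AddCommGroup (TensorOver k A M N) :=
  inferInstanceAs (AddCommGroup ((M ⊗[k] N) ⧸ tensorOverRel k A M N))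

instance : Module k (TensorOver k A M N) :=
  inferInstanceAs (Module k ((M ⊗[k] N) ⧸ tensorOverRel k A M N))

variable {M N}

/-- The class of `m ⊗ n` in `M ⊗_A N`. -/
def TensorOver.tmul (m : M) (n : N) : TensorOver k A M N :=
  (tensorOverRel k A M N).mkQ (m ⊗ₜ[k] n)

variable {k A}

theorem TensorOver.tmul_balanced (m : M) (a : A) (n : N) :
    TensorOver.tmul k A ((1 ⊗ₜ[k] op a : A ⊗[k] Aᵐᵒᵖ) • m) n =
      TensorOver.tmul k A m ((a ⊗ₜ[k] 1 : A ⊗[k] Aᵐᵒᵖ) • n) :=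
  (Submodule.Quotient.eq _).2 (Submodule.subset_span ⟨m, a, n, rfl⟩)

@[elab_as_elim]
theorem TensorOver.induction {p : TensorOver k A M N → Prop} (x : TensorOver k A M N)
    (h0 : p 0) (ht : ∀ m n, p (TensorOver.tmul k A m n)) (ha : ∀ x y, p x → p y → p (x + y)) :
    p x := by
  obtain ⟨y, rfl⟩ := (tensorOverRel k A M N).mkQ_surjective x
  induction y with
  | zero => rw [map_zero]; exact h0
  | tmul m n => exact ht m n
  | add y z hy hz => rw [map_add]; exact ha _ _ hy hz

/-- The map out of `M ⊗_A N` given by a balanced bilinear map. -/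
def TensorOver.lift {Q : Type*} [AddCommGroup Q] [Module k Q] (φ : M ⊗[k] N →ₗ[k] Q)
    (h : ∀ (m : M) (a : A) (n : N), φ (((1 ⊗ₜ[k] op a : A ⊗[k] Aᵐᵒᵖ) • m) ⊗ₜ[k] n) =
      φ (m ⊗ₜ[k] ((a ⊗ₜ[k] 1 : A ⊗[k] Aᵐᵒᵖ) • n))) : TensorOver k A M N →ₗ[k] Q :=
  (tensorOverRel k A M N).liftQ φ (by
    refine Submodule.span_le.2 ?_
    rintro _ ⟨m, a, n, rfl⟩
    simp [h])

theorem TensorOver.lift_tmul {Q : Type*} [AddCommGroup Q] [Module k Q] (φ : M ⊗[k] N →ₗ[k] Q)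
    (h) (m : M) (n : N) : TensorOver.lift (A := A) φ h (TensorOver.tmul k A m n) = φ (m ⊗ₜ n) :=
  Submodule.liftQ_apply _ _ _

/-- The `k`-linear endomorphism `x ↦ e • x` of a bimodule. -/
def envSMul (e : A ⊗[k] Aᵐᵒᵖ) : M →ₗ[k] M := Algebra.lsmul k k M e

@[simp]
theorem envSMul_apply (e : A ⊗[k] Aᵐᵒᵖ) (m : M) : envSMul e m = e • m := rfl

theorem env_left_right_comm (a b : A) (m : M) :
    (1 ⊗ₜ[k] op b : A ⊗[k] Aᵐᵒᵖ) • (a ⊗ₜ[k] 1 : A ⊗[k] Aᵐᵒᵖ) • m =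
      (a ⊗ₜ[k] 1 : A ⊗[k] Aᵐᵒᵖ) • (1 ⊗ₜ[k] op b : A ⊗[k] Aᵐᵒᵖ) • m := by
  simp [smul_smul]

/-- Left action of `a` on `M ⊗_A N`, through `M`. -/
def TensorOver.leftAct (a : A) : TensorOver k A M N →ₗ[k] TensorOver k A M N :=
  TensorOver.lift (M := M) (N := N) ((tensorOverRel k A M N).mkQ ∘ₗ
      LinearMap.rTensor N (envSMul (a ⊗ₜ[k] 1 : A ⊗[k] Aᵐᵒᵖ))) (by
    intro m b n
    have := TensorOver.tmul_balanced (k := k) ((a ⊗ₜ[k] 1 : A ⊗[k] Aᵐᵒᵖ) • m) b n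
    rw [env_left_right_comm] at this
    exact this)

/-- Right action of `b` on `M ⊗_A N`, through `N`. -/
def TensorOver.rightAct (b : A) : TensorOver k A M N →ₗ[k] TensorOver k A M N :=
  TensorOver.lift (M := M) (N := N) ((tensorOverRel k A M N).mkQ ∘ₗ
      LinearMap.lTensor M (envSMul (1 ⊗ₜ[k] op b : A ⊗[k] Aᵐᵒᵖ))) (by
    intro m a n
    have := TensorOver.tmul_balanced (k := k) m a ((1 ⊗ₜ[k] op b : A ⊗[k] Aᵐᵒᵖ) • n)
    rw [← env_left_right_comm] at this
    exact this)

@[simp]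
theorem TensorOver.leftAct_tmul (a : A) (m : M) (n : N) :
    TensorOver.leftAct a (TensorOver.tmul k A m n) =
      TensorOver.tmul k A ((a ⊗ₜ[k] 1 : A ⊗[k] Aᵐᵒᵖ) • m) n :=
  TensorOver.lift_tmul _ _ m n

@[simp]
theorem TensorOver.rightAct_tmul (b : A) (m : M) (n : N) :
    TensorOver.rightAct b (TensorOver.tmul k A m n) =
      TensorOver.tmul k A m ((1 ⊗ₜ[k] op b : A ⊗[k] Aᵐᵒᵖ) • n) :=
  TensorOver.lift_tmul _ _ m n

theorem TensorOver.hom_ext {Q : Type*} [AddCommGroup Q] [Module k Q]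
    {φ ψ : TensorOver k A M N →ₗ[k] Q}
    (h : ∀ m n, φ (TensorOver.tmul k A m n) = ψ (TensorOver.tmul k A m n)) : φ = ψ := by
  ext x
  induction x using TensorOver.induction with
  | h0 => simp
  | ht m n => exact h m n
  | ha x y hx hy => simp [hx, hy]

theorem TensorOver.tmul_add (m : M) (n n' : N) : TensorOver.tmul k A m (n + n') =
    TensorOver.tmul k A m n + TensorOver.tmul k A m n' := by
  rw [TensorOver.tmul, TensorProduct.tmul_add, map_add]
  rfl

theorem TensorOver.add_tmul (m m' : M) (n : N) : TensorOver.tmul k A (m + m') n =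
    TensorOver.tmul k A m n + TensorOver.tmul k A m' n := by
  rw [TensorOver.tmul, TensorProduct.add_tmul, map_add]
  rfl

theorem TensorOver.tmul_smul (c : k) (m : M) (n : N) : TensorOver.tmul k A m (c • n) =
    c • TensorOver.tmul k A m n := by
  rw [TensorOver.tmul, TensorProduct.tmul_smul, map_smul]
  rfl

theorem TensorOver.smul_tmul (c : k) (m : M) (n : N) : TensorOver.tmul k A (c • m) n =
    c • TensorOver.tmul k A m n := by
  rw [TensorOver.tmul, ← TensorProduct.smul_tmul', map_smul]
  rfl

variable (k A M N) in
/-- The outer bimodule structure of `M ⊗_A N`, as an algebra map. -/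
def TensorOver.actionHom : A ⊗[k] Aᵐᵒᵖ →ₐ[k] Module.End k (TensorOver k A M N) :=
  Algebra.TensorProduct.lift
    (AlgHom.ofLinearMap (R := k) (A := A) (B := Module.End k (TensorOver k A M N))
      { toFun := TensorOver.leftAct
        map_add' := fun a b => TensorOver.hom_ext fun m n => by
          simp [TensorProduct.add_tmul, add_smul, TensorOver.add_tmul]
        map_smul' := fun c a => TensorOver.hom_ext fun m n => by
          simp [← TensorProduct.smul_tmul', TensorOver.smul_tmul] }
      (TensorOver.hom_ext fun m n => by
        simp [← Algebra.TensorProduct.one_def])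
      (fun a b => TensorOver.hom_ext fun m n => by
        simp [smul_smul]))
    (AlgHom.ofLinearMap (R := k) (A := Aᵐᵒᵖ) (B := Module.End k (TensorOver k A M N))
      { toFun := fun b => TensorOver.rightAct b.unop
        map_add' := fun a b => TensorOver.hom_ext fun m n => by
          simp [TensorProduct.tmul_add, add_smul, TensorOver.tmul_add]
        map_smul' := fun c a => TensorOver.hom_ext fun m n => by
          simp [TensorOver.tmul_smul] }
      (TensorOver.hom_ext fun m n => by
        simp [← Algebra.TensorProduct.one_def])
      (fun a b => TensorOver.hom_ext fun m n => by
        simp [smul_smul]))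
    (fun a b => show Commute _ _ from TensorOver.hom_ext fun m n => by simp)

instance : Module (A ⊗[k] Aᵐᵒᵖ) (TensorOver k A M N) :=
  Module.compHom _ (TensorOver.actionHom k A M N).toRingHom

theorem TensorOver.env_smul_tmul (a b : A) (m : M) (n : N) :
    (a ⊗ₜ[k] op b : A ⊗[k] Aᵐᵒᵖ) • TensorOver.tmul k A m n =
      TensorOver.tmul k A ((a ⊗ₜ[k] 1 : A ⊗[k] Aᵐᵒᵖ) • m)
        ((1 ⊗ₜ[k] op b : A ⊗[k] Aᵐᵒᵖ) • n) := by
  change TensorOver.actionHom k A M N (a ⊗ₜ[k] op b) (TensorOver.tmul k A m n) = _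
  rw [TensorOver.actionHom, Algebra.TensorProduct.lift_tmul]
  change TensorOver.leftAct a (TensorOver.rightAct b (TensorOver.tmul k A m n)) = _
  rw [TensorOver.rightAct_tmul, TensorOver.leftAct_tmul]

/-- The map `φ ⊗_A ψ : M ⊗_A N → M' ⊗_A N'` induced by bimodule maps. -/
def TensorOver.map {M' : Type u} [AddCommGroup M'] [Module k M'] [Module (A ⊗[k] Aᵐᵒᵖ) M']
    [IsScalarTower k (A ⊗[k] Aᵐᵒᵖ) M'] {N' : Type u} [AddCommGroup N'] [Module k N']
    [Module (A ⊗[k] Aᵐᵒᵖ) N'] [IsScalarTower k (A ⊗[k] Aᵐᵒᵖ) N']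
    (φ : M →ₗ[A ⊗[k] Aᵐᵒᵖ] M') (ψ : N →ₗ[A ⊗[k] Aᵐᵒᵖ] N') :
    TensorOver k A M N →ₗ[k] TensorOver k A M' N' :=
  TensorOver.lift (M := M) (N := N) ((tensorOverRel k A M' N').mkQ ∘ₗ
      TensorProduct.map (φ.restrictScalars k) (ψ.restrictScalars k)) (by
    intro m a n
    have := TensorOver.tmul_balanced (k := k) (φ m) a (ψ n)
    rw [← map_smul, ← map_smul] at this
    exact this)

theorem TensorOver.map_tmul {M' : Type u} [AddCommGroup M'] [Module k M']
    [Module (A ⊗[k] Aᵐᵒᵖ) M'] [IsScalarTower k (A ⊗[k] Aᵐᵒᵖ) M'] {N' : Type u} [AddCommGroup N']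
    [Module k N'] [Module (A ⊗[k] Aᵐᵒᵖ) N'] [IsScalarTower k (A ⊗[k] Aᵐᵒᵖ) N']
    (φ : M →ₗ[A ⊗[k] Aᵐᵒᵖ] M') (ψ : N →ₗ[A ⊗[k] Aᵐᵒᵖ] N') (m : M) (n : N) :
    TensorOver.map φ ψ (TensorOver.tmul k A m n) = TensorOver.tmul k A (φ m) (ψ n) :=
  TensorOver.lift_tmul _ _ m n

end TensorOver

/-- For bimodule maps `φ : M → R` and `ψ : N → R`, the bimodule map
`M ⊗_A N → R ⊗_A R → R`, `m ⊗ n ↦ φ(m) ψ(n)`. -/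
def tensorMul {R : Type u} [Ring R] [Algebra k R] (ρ : A →ₐ[k] R)
    {M N : ModuleCat.{u} (A ⊗[k] Aᵐᵒᵖ)} (φ : M ⟶ algBimod ρ) (ψ : N ⟶ algBimod ρ) :
    TensorOver k A M N →ₗ[k] R :=
  TensorOver.lift (LinearMap.mul' k R ∘ₗ
      TensorProduct.map (homToLinear ρ φ) (homToLinear ρ ψ)) (by
    intro m a n
    have h1 : homToLinear ρ φ ((1 ⊗ₜ[k] op a : A ⊗[k] Aᵐᵒᵖ) • m) = homToLinear ρ φ m * ρ a := by
      rw [homToLinear_smul, map_one, one_mul]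
    have h2 : homToLinear ρ ψ ((a ⊗ₜ[k] 1 : A ⊗[k] Aᵐᵒᵖ) • n) = ρ a * homToLinear ρ ψ n := by
      refine (homToLinear_smul ρ ψ a 1 n).trans ?_
      rw [map_one, mul_one]
    simp [h1, h2, mul_assoc])

theorem tensorMul_tmul {R : Type u} [Ring R] [Algebra k R] (ρ : A →ₐ[k] R)
    {M N : ModuleCat.{u} (A ⊗[k] Aᵐᵒᵖ)} (φ : M ⟶ algBimod ρ) (ψ : N ⟶ algBimod ρ)
    (m : M) (n : N) :
    tensorMul ρ φ ψ (TensorOver.tmul k A m n) = homToLinear ρ φ m * homToLinear ρ ψ n :=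
  TensorOver.lift_tmul _ _ m n

theorem tensorMul_smul {R : Type u} [Ring R] [Algebra k R] (ρ : A →ₐ[k] R)
    {M N : ModuleCat.{u} (A ⊗[k] Aᵐᵒᵖ)} (φ : M ⟶ algBimod ρ) (ψ : N ⟶ algBimod ρ)
    (a b : A) (x : TensorOver k A M N) :
    tensorMul ρ φ ψ ((a ⊗ₜ[k] op b : A ⊗[k] Aᵐᵒᵖ) • x) = ρ a * tensorMul ρ φ ψ x * ρ b := by
  induction x using TensorOver.induction with
  | h0 => simp
  | ht m n =>
    rw [TensorOver.env_smul_tmul, tensorMul_tmul, tensorMul_tmul]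
    have h1 : homToLinear ρ φ ((a ⊗ₜ[k] 1 : A ⊗[k] Aᵐᵒᵖ) • m) = ρ a * homToLinear ρ φ m := by
      refine (homToLinear_smul ρ φ a 1 m).trans ?_
      rw [map_one, mul_one]
    have h2 : homToLinear ρ ψ ((1 ⊗ₜ[k] op b : A ⊗[k] Aᵐᵒᵖ) • n) = homToLinear ρ ψ n * ρ b := by
      rw [homToLinear_smul, map_one, one_mul]
    rw [h1, h2]
    simp only [mul_assoc]
  | ha x y hx hy => rw [smul_add, map_add, map_add, hx, hy, mul_add, add_mul]

/-- `tensorMul` as a bimodule map. -/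
def tensorMulHom {R : Type u} [Ring R] [Algebra k R] (ρ : A →ₐ[k] R)
    {M N : ModuleCat.{u} (A ⊗[k] Aᵐᵒᵖ)} (φ : M ⟶ algBimod ρ) (ψ : N ⟶ algBimod ρ) :
    TensorOver k A M N →ₗ[A ⊗[k] Aᵐᵒᵖ] algBimod ρ where
  toFun x := (AlgBimodule.toAlg ρ).symm (tensorMul ρ φ ψ x)
  map_add' x y := by rw [map_add, map_add]
  map_smul' e x := by
    apply (AlgBimodule.toAlg ρ).injective
    induction e with
    | zero =>
      have h1 : (0 : A ⊗[k] Aᵐᵒᵖ) • x = 0 := zero_smul (A ⊗[k] Aᵐᵒᵖ) x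
      have h2 : (0 : A ⊗[k] Aᵐᵒᵖ) • (AlgBimodule.toAlg ρ).symm (tensorMul ρ φ ψ x) = 0 :=
        zero_smul (A ⊗[k] Aᵐᵒᵖ) ((AlgBimodule.toAlg ρ).symm (tensorMul ρ φ ψ x))
      exact (congrArg (tensorMul ρ φ ψ) h1).trans ((map_zero _).trans
        (congrArg (AlgBimodule.toAlg ρ) h2).symm)
    | tmul a b =>
      refine (tensorMul_smul ρ φ ψ a b.unop x).trans ?_
      exact (AlgBimodule.toAlg_smul ρ a b.unop ((AlgBimodule.toAlg ρ).symm _)).symm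
    | add e e' h h' =>
      simp only [add_smul, map_add, RingHom.id_apply] at h h' ⊢
      rw [h, h']

/-! ### The cup product -/

/-- A diagonal `ω : P → P ⊗_A P` for a projective resolution `P` of `A`: a chain map of
`A`-bimodules into the total complex (differential `d ⊗ 1 + (-1)^p 1 ⊗ d` on `P_p ⊗_A P_q`)
which lifts the canonical isomorphism `A ≅ A ⊗_A A`. Here `map p q n` is the component
`P_n → P_p ⊗_A P_q`. -/
structure Diagonal (P : ProjectiveResolution (regBimod k A)) where
  map : ∀ p q n : ℕ, p + q = n →
    (P.complex.X n →ₗ[A ⊗[k] Aᵐᵒᵖ] TensorOver k A (P.complex.X p) (P.complex.X q))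
  comm : ∀ (p q n : ℕ) (h : p + q = n) (x : P.complex.X (n + 1)),
    map p q n h ((P.complex.d (n + 1) n).hom x) =
      TensorOver.map (P.complex.d (p + 1) p).hom LinearMap.id
          (map (p + 1) q (n + 1) (by omega) x) +
        (-1 : k) ^ p • TensorOver.map LinearMap.id (P.complex.d (q + 1) q).hom
          (map p (q + 1) (n + 1) (by omega) x)
  aug : ∀ x : P.complex.X 0,
    tensorMul (AlgHom.id k A) (P.π.f 0) (P.π.f 0) (map 0 0 0 rfl x) =
      homToLinear (AlgHom.id k A) (P.π.f 0) x

/-- The cup product of cochains `(f ∪ g) = m_R ∘ (f ⊗_A g) ∘ ω`. -/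
def Diagonal.cup {P : ProjectiveResolution (regBimod k A)} (ω : Diagonal P)
    {R : Type u} [Ring R] [Algebra k R] (ρ : A →ₐ[k] R) {p q : ℕ} (n : ℕ) (h : p + q = n)
    (f : P.complex.X p ⟶ algBimod ρ) (g : P.complex.X q ⟶ algBimod ρ) :
    P.complex.X n ⟶ algBimod ρ :=
  ModuleCat.ofHom ((tensorMulHom ρ f g).comp (ω.map p q n h))

/-- The map `ρ : A → R` as a morphism of bimodules. -/
def algBimodUnit {R : Type u} [Ring R] [Algebra k R] (ρ : A →ₐ[k] R) :
    regBimod k A ⟶ algBimod ρ :=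
  ModuleCat.ofHom
    { toFun := fun x => (AlgBimodule.toAlg ρ).symm (ρ (AlgBimodule.toAlg (AlgHom.id k A) x))
      map_add' := fun x y => by simp only [map_add]
      map_smul' := fun e x => by
        apply (AlgBimodule.toAlg ρ).injective
        induction e with
        | zero =>
          have h1 : (0 : A ⊗[k] Aᵐᵒᵖ) • x = 0 := zero_smul (A ⊗[k] Aᵐᵒᵖ) x
          have h2 : (0 : A ⊗[k] Aᵐᵒᵖ) •
              (AlgBimodule.toAlg ρ).symm (ρ (AlgBimodule.toAlg (AlgHom.id k A) x)) = 0 :=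
            zero_smul (A ⊗[k] Aᵐᵒᵖ)
              ((AlgBimodule.toAlg ρ).symm (ρ (AlgBimodule.toAlg (AlgHom.id k A) x)))
          exact (congrArg (fun y => ρ (AlgBimodule.toAlg (AlgHom.id k A) y)) h1).trans
            ((map_zero ρ).trans (congrArg (AlgBimodule.toAlg ρ) h2).symm)
        | tmul a b =>
          have h1 := AlgBimodule.toAlg_smul (AlgHom.id k A) a b.unop x
          have h2 := AlgBimodule.toAlg_smul ρ a b.unop
            ((AlgBimodule.toAlg ρ).symm (ρ (AlgBimodule.toAlg (AlgHom.id k A) x)))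
          rw [op_unop] at h1 h2
          rw [h1, RingHom.id_apply, h2]
          simp
        | add e e' h h' =>
          simp only [add_smul, map_add, RingHom.id_apply] at h h' ⊢
          rw [h, h'] }

end Bimodules

/-! ## Bimodules and resolutions in the category of Yetter-Drinfeld modules -/

section YDBimodules

variable {k : Type u} [Field k] {G : Type v} [Group G] [DecidableEq G]
  {A : Type u} [Ring A] [Algebra k A] [Coalgebra k A]

/-- An `A`-bimodule in the category of Yetter-Drinfeld modules: both actions are morphisms of
Yetter-Drinfeld modules. -/
structure YDBimodule (B : YDBimonoid k G A) (M : Type u) [AddCommGroup M] [Module k M]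
    [Module (A ⊗[k] Aᵐᵒᵖ) M] [IsScalarTower k (A ⊗[k] Aᵐᵒᵖ) M] extends YetterDrinfeld k G M where
  left_mem : ∀ (s t : G) (a : A) (m : M), a ∈ B.gr s → m ∈ gr t →
    (a ⊗ₜ[k] 1 : A ⊗[k] Aᵐᵒᵖ) • m ∈ gr (s * t)
  right_mem : ∀ (s t : G) (m : M) (a : A), m ∈ gr s → a ∈ B.gr t →
    (1 ⊗ₜ[k] op a : A ⊗[k] Aᵐᵒᵖ) • m ∈ gr (s * t)
  act_left : ∀ (g : G) (a : A) (m : M), act g ((a ⊗ₜ[k] 1 : A ⊗[k] Aᵐᵒᵖ) • m) =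
    (B.act g a ⊗ₜ[k] 1 : A ⊗[k] Aᵐᵒᵖ) • act g m
  act_right : ∀ (g : G) (m : M) (a : A), act g ((1 ⊗ₜ[k] op a : A ⊗[k] Aᵐᵒᵖ) • m) =
    (1 ⊗ₜ[k] op (B.act g a) : A ⊗[k] Aᵐᵒᵖ) • act g m

/-- `M` is isomorphic, as a `G`-graded `A`-bimodule, to `A ⊗ V ⊗ A` for some finite-dimensional
`G`-graded vector space `V`. -/
def YDBimodule.IsFiniteGradedFree {B : YDBimonoid k G A} {M : Type u} [AddCommGroup M] [Module k M]
    [Module (A ⊗[k] Aᵐᵒᵖ) M] [IsScalarTower k (A ⊗[k] Aᵐᵒᵖ) M] (X : YDBimodule B M) : Prop :=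
  ∃ (V : Type u) (_ : AddCommGroup V) (_ : Module k V) (grV : G → Submodule k V)
    (e : M ≃ₗ[k] (A ⊗[k] V) ⊗[k] A),
    FiniteDimensional k V ∧ DirectSum.IsInternal grV ∧
    (∀ (a b : A) (m : M), e ((a ⊗ₜ[k] op b : A ⊗[k] Aᵐᵒᵖ) • m) =
      TensorProduct.map (LinearMap.rTensor V (LinearMap.mulLeft k a)) (LinearMap.mulRight k b)
        (e m)) ∧
    ∀ g : G, (X.gr g).map e.toLinearMap = tensorGrading (tensorGrading B.gr grV) B.gr g

/-- The structure of a complex `P → A` of `A`-bimodules in the category of Yetter-Drinfeld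
modules, on a projective resolution `P → A` of `A` as an `A`-bimodule. -/
structure YDResolution (B : YDBimonoid k G A) (P : ProjectiveResolution (regBimod k A)) where
  yd : ∀ n, YDBimodule B (P.complex.X n)
  d_mem : ∀ (n : ℕ) (s : G) (x : P.complex.X (n + 1)), x ∈ (yd (n + 1)).gr s →
    (P.complex.d (n + 1) n).hom x ∈ (yd n).gr s
  d_act : ∀ (n : ℕ) (g : G) (x : P.complex.X (n + 1)),
    (P.complex.d (n + 1) n).hom ((yd (n + 1)).act g x) =
      (yd n).act g ((P.complex.d (n + 1) n).hom x)
  aug_mem : ∀ (s : G) (x : P.complex.X 0), x ∈ (yd 0).gr s →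
    homToLinear (AlgHom.id k A) (P.π.f 0) x ∈ B.gr s
  aug_act : ∀ (g : G) (x : P.complex.X 0),
    homToLinear (AlgHom.id k A) (P.π.f 0) ((yd 0).act g x) =
      B.act g (homToLinear (AlgHom.id k A) (P.π.f 0) x)

/-- `f` lies in the component `hom_{AA}(M, k)_h`: it maps `M_s` to `k_{h s}`, where `k` is
concentrated in degree `1`. -/
def YDBimodule.IsHomogeneous {B : YDBimonoid k G A} {M : ModuleCat.{u} (A ⊗[k] Aᵐᵒᵖ)}
    (X : YDBimodule B M) (h : G) (f : M ⟶ algBimod B.aug) : Prop :=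
  ∀ s : G, h * s ≠ 1 → ∀ x ∈ X.gr s, homToLinear B.aug f x = 0

end YDBimodules

/-! ## Graded braided commutative algebras -/

/-- A graded braided commutative algebra in Yetter-Drinfeld modules over `k[G]`: a
(nonnegatively) graded object `H` with an associative unital product
`⌣ : H^p ⊗ H^q → H^{p+q}`, all structure maps being morphisms of Yetter-Drinfeld modules,
such that `⌣ ∘ c^{gr} = ⌣`, where `c^{gr} = (-1)^{pq} c` on `H^p ⊗ H^q`. -/
structure GradedBraidedCommAlgebra (k : Type*) (G : Type*) [Field k] [Group G] [DecidableEq G]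
    (H : ℕ → Type*) [∀ n, AddCommGroup (H n)] [∀ n, Module k (H n)] where
  yd : ∀ n, YetterDrinfeld k G (H n)
  one : H 0
  mul : ∀ p q n : ℕ, p + q = n → (H p →ₗ[k] H q →ₗ[k] H n)
  one_mem : one ∈ (yd 0).gr 1
  act_one : ∀ g : G, (yd 0).act g one = one
  mul_mem : ∀ (p q n : ℕ) (h : p + q = n) (s t : G) (x : H p) (y : H q),
    x ∈ (yd p).gr s → y ∈ (yd q).gr t → mul p q n h x y ∈ (yd n).gr (s * t)
  act_mul : ∀ (p q n : ℕ) (h : p + q = n) (g : G) (x : H p) (y : H q),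
    (yd n).act g (mul p q n h x y) = mul p q n h ((yd p).act g x) ((yd q).act g y)
  one_mul : ∀ (n : ℕ) (x : H n), mul 0 n n (zero_add n) one x = x
  mul_one : ∀ (n : ℕ) (x : H n), mul n 0 n (add_zero n) x one = x
  mul_assoc : ∀ (p q r s t n : ℕ) (h₁ : p + q = s) (h₂ : s + r = n) (h₃ : q + r = t)
    (h₄ : p + t = n) (x : H p) (y : H q) (z : H r),
    mul s r n h₂ (mul p q s h₁ x y) z = mul p t n h₄ x (mul q r t h₃ y z)
  braided_comm : ∀ (p q n : ℕ) (h : p + q = n) (h' : q + p = n) (x : H p) (y : H q),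
    (-1 : k) ^ (p * q) •
        TensorProduct.lift (mul q p n h') ((yd p).braiding (yd q) (x ⊗ₜ[k] y)) =
      mul p q n h x y

end

/-!
# Braided commutativity of Hochschild cohomology with trivial coefficients

A bimodule map from a bimodule `M` to `k` is the same as an `A`-linear form on the left module
`M ⊗_A k`, the quotient of `M` by the relations `m · a = ε(a) m`. The resolution `P → A` is
contractible as a complex of right modules, because each `P_n ≅ A ⊗ V_n ⊗ A` is free on the right
(`exists_rightContraction`). Hence `Q = P ⊗_A k` is a resolution of the trivial module by finitely
generated projective left modules, again in the category of Yetter-Drinfeld modules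
(`YDResolution.leftResolution`), and the Hochschild cohomology is the cohomology of `Hom_A(Q, k)`
(`hochschildModel`).

On the latter there is the Yoneda product: a cocycle `f : Q_p → k` lifts to a chain map
`φ : Q_{p + •} → Q_•`, unique up to homotopy, and `[f] ⌣ [g] = [g ∘ φ]`. It is well defined,
associative, unital and equivariant for formal reasons. Lifts of homogeneous cocycles can be chosen
homogeneous, so that the product respects the gradings, and a cocycle has only finitely many
homogeneous components, since `Q_n` is finitely generated. For a diagonal `ω : P → P ⊗_A P` and a
cocycle `f` of `Hom(P, k)`, the map `1 ⊗ f` applied to `ω` is a lift of `f ∘ (π ⊗ 1) ∘ ω`, which is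
cohomologous to `f`, because `(π ⊗ 1) ∘ ω` lifts the identity of `A`. So the Yoneda product is the
opposite cup product (`hochschildModel_mul`). Diagonals exist because the contraction makes
`P ⊗_A P` acyclic (`nonempty_diagonal_of_contraction`).

Braided commutativity comes from the comultiplication. With the diagonal action, defined through
`Δ` and the braiding, `Q ⊗ Q` is a complex of `A`-modules that resolves `k`, so that there is a
chain map `Q → Q ⊗ Q` over the identity of `k` (`YDLeftResolution.exists_diagonal`). For a cocycle
`u` of degree `p`, there are two `A`-linear ways of evaluating `u` on one factor of `Q ⊗ Q`: the map
`m ⊗ n ↦ u(n) m`, and, up to the sign `(-1)^{pj}`, the map `m ⊗ n ↦ u(s⁻¹ • m) n` for `n ∈ Q_j` of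
degree `s ∈ G`, where the twist by `s` makes up for the braiding in the diagonal action. Both
induce lifts of cocycles cohomologous to `u` (`YDLeftResolution.exists_isLift_right` and
`YDLeftResolution.exists_isLift_left`). If `v` is a cocycle of degree `q`, homogeneous of degree
`b ∈ G`, then evaluating `u` in the second way followed by `v` is, up to the sign `(-1)^{pq}`, the
same as evaluating `v` in the first way followed by `b⁻¹ • u`. This is the relation
`x ⌣ y = (-1)^{pq} y ⌣ (b⁻¹ • x)`.
-/

noncomputable section

/-! ### Comparison of complexes of modules -/

section Comparison

variable {R : Type*} [Ring R]

theorem Module.Projective.exists_lift_of_mem_range {P M N : Type*} [AddCommGroup P] [Module R P]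
    [Module.Projective R P] [AddCommGroup M] [Module R M] [AddCommGroup N] [Module R N]
    (f : M →ₗ[R] N) (g : P →ₗ[R] N) (h : ∀ x, ∃ y, f y = g x) :
    ∃ φ : P →ₗ[R] M, ∀ x, f (φ x) = g x := by
  obtain ⟨φ, hφ⟩ := Module.projective_lifting_property f.rangeRestrict
    (g.codRestrict (LinearMap.range f) fun x => h x) f.surjective_rangeRestrict
  exact ⟨φ, fun x => congrArg Subtype.val (LinearMap.congr_fun hφ x)⟩

variable {P : ℕ → Type*} [∀ n, AddCommGroup (P n)] [∀ n, Module R (P n)]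
  [∀ n, Module.Projective R (P n)] {T : ℕ → Type*} [∀ n, AddCommGroup (T n)] [∀ n, Module R (T n)]

/-- A map in degree `0` from a complex of projectives to an acyclic complex extends to a chain map.
The submodules `W n` restrict the values of the extension; a cycle of `T (n + 1)` is only required
to bound an element of `W (n + 1)` if it lies in `W n`. -/
theorem exists_chainMap (dP : ∀ n, P (n + 1) →ₗ[R] P n) (hP : ∀ n x, dP n (dP (n + 1) x) = 0)
    (dT : ∀ n, T (n + 1) →ₗ[R] T n) (W : ∀ n, Submodule R (T (n + 1)))
    (hW : ∀ n, ∀ x ∈ W n, dT n x = 0 → ∃ y ∈ W (n + 1), dT (n + 1) y = x)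
    (φ₀ : P 0 →ₗ[R] T 0) (h₀ : ∀ x, ∃ y ∈ W 0, dT 0 y = φ₀ (dP 0 x)) :
    ∃ φ : ∀ n, P n →ₗ[R] T n, φ 0 = φ₀ ∧ ∀ n x, dT n (φ (n + 1) x) = φ n (dP n x) := by
  let S (n : ℕ) := {φ : P n →ₗ[R] T n // ∀ x, ∃ y ∈ W n, dT n y = φ (dP n x)}
  have step (n : ℕ) (φ : S n) : ∃ ψ : S (n + 1), ∀ x, dT n (ψ.1 x) = φ.1 (dP n x) := by
    obtain ⟨ψ, hψ⟩ := Module.Projective.exists_lift_of_mem_range (dT n ∘ₗ (W n).subtype)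
      (φ.1 ∘ₗ dP n) fun x => by
        obtain ⟨y, hy, h⟩ := φ.2 x
        exact ⟨⟨y, hy⟩, h⟩
    refine ⟨⟨(W n).subtype ∘ₗ ψ, fun x => hW n _ (ψ (dP (n + 1) x)).2 ?_⟩, hψ⟩
    refine (hψ _).trans ?_
    rw [LinearMap.comp_apply, hP, map_zero]
  choose next hnext using step
  let Φ (n : ℕ) : S n := Nat.rec ⟨φ₀, h₀⟩ next n
  exact ⟨fun n => (Φ n).1, rfl, fun n x => hnext n (Φ n) x⟩

/-- A chain map from a complex of projectives to an acyclic complex which is a boundary in degree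
`0` is null-homotopic. -/
theorem exists_nullHomotopy (dP : ∀ n, P (n + 1) →ₗ[R] P n) (hP : ∀ n x, dP n (dP (n + 1) x) = 0)
    (dT : ∀ n, T (n + 1) →ₗ[R] T n) (hex : ∀ n x, dT n x = 0 → ∃ y, dT (n + 1) y = x)
    (φ : ∀ n, P n →ₗ[R] T n) (hφ : ∀ n x, dT n (φ (n + 1) x) = φ n (dP n x))
    (h₀ : ∀ x, ∃ y, dT 0 y = φ 0 x) :
    ∃ h : ∀ n, P n →ₗ[R] T (n + 1), (∀ x, dT 0 (h 0 x) = φ 0 x) ∧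
      ∀ n x, dT (n + 1) (h (n + 1) x) = φ (n + 1) x - h n (dP n x) := by
  let S (n : ℕ) := {h : P n →ₗ[R] T (n + 1) // ∀ x, dT n (h (dP n x)) = φ n (dP n x)}
  have step (n : ℕ) (h : S n) : ∃ h' : S (n + 1),
      ∀ x, dT (n + 1) (h'.1 x) = φ (n + 1) x - h.1 (dP n x) := by
    obtain ⟨ψ, hψ⟩ := Module.Projective.exists_lift_of_mem_range (dT (n + 1))
      (φ (n + 1) - h.1 ∘ₗ dP n) fun x => hex n _ (by
        rw [LinearMap.sub_apply, LinearMap.comp_apply, map_sub, hφ, h.2, sub_self])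
    refine ⟨⟨ψ, fun x => ?_⟩, hψ⟩
    rw [hψ, LinearMap.sub_apply, LinearMap.comp_apply, hP, map_zero, sub_zero]
  choose next hnext using step
  obtain ⟨ψ, hψ⟩ := Module.Projective.exists_lift_of_mem_range (dT 0) (φ 0) h₀
  let H (n : ℕ) : S n := Nat.rec ⟨ψ, fun x => hψ _⟩ next n
  exact ⟨fun n => (H n).1, hψ, fun n x => hnext n (H n) x⟩

end Comparison

/-! ### Double complexes with contractible rows -/

section DoubleComplex

variable {R : Type*} [Ring R] {M : ℕ → ℕ → Type*} [∀ p q, AddCommGroup (M p q)]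
  [∀ p q, Module R (M p q)]

/-- The total differential `d₁ + d₂` on the product of all the terms of a double complex. -/
def totalDifferential (d₁ : ∀ p q, M (p + 1) q →ₗ[R] M p q) (d₂ : ∀ p q, M p (q + 1) →ₗ[R] M p q) :
    (∀ p q, M p q) →ₗ[R] ∀ p q, M p q :=
  LinearMap.pi fun p => LinearMap.pi fun q =>
    d₁ p q ∘ₗ LinearMap.proj q ∘ₗ LinearMap.proj (p + 1) +
      d₂ p q ∘ₗ LinearMap.proj (q + 1) ∘ₗ LinearMap.proj p

@[simp]
theorem totalDifferential_apply (d₁ : ∀ p q, M (p + 1) q →ₗ[R] M p q)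
    (d₂ : ∀ p q, M p (q + 1) →ₗ[R] M p q) (z : ∀ p q, M p q) (p q : ℕ) :
    totalDifferential d₁ d₂ z p q = d₁ p q (z (p + 1) q) + d₂ p q (z p (q + 1)) := rfl

/-- The total complex is acyclic if each row `M • q` is an augmented complex over `N q` with a
contraction `(s, σ)` compatible with the vertical differential, and the complex `N` is acyclic. -/
theorem exists_totalDifferential_eq {N : ℕ → Type*} [∀ q, AddCommGroup (N q)]
    (d₁ : ∀ p q, M (p + 1) q →ₗ[R] M p q) (d₂ : ∀ p q, M p (q + 1) →ₗ[R] M p q)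
    (dN : ∀ q, N (q + 1) →+ N q) (π : ∀ q, M 0 q →+ N q) (σ : ∀ q, N q →+ M 0 q)
    (s : ∀ p q, M p q →+ M (p + 1) q)
    (hπ₁ : ∀ q x, π q (d₁ 0 q x) = 0) (hπ₂ : ∀ q x, π q (d₂ 0 q x) = dN q (π (q + 1) x))
    (hσ : ∀ q x, d₂ 0 q (σ (q + 1) x) = σ q (dN q x))
    (hs₂ : ∀ p q x, d₂ (p + 1) q (s p (q + 1) x) = -s p q (d₂ p q x))
    (hs₀ : ∀ q x, d₁ 0 q (s 0 q x) = x - σ q (π q x))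
    (hs : ∀ p q x, d₁ (p + 1) q (s (p + 1) q x) = x - s p q (d₁ p q x))
    (hN : ∀ q x, dN q x = 0 → ∃ y, dN (q + 1) y = x)
    (z : ∀ p q, M p q) (hz : totalDifferential d₁ d₂ z = 0) (hz₀ : ∃ y, dN 0 y = π 0 (z 0 0)) :
    ∃ y, y 0 0 = 0 ∧ totalDifferential d₁ d₂ y = z := by
  have hz' (p q : ℕ) : d₁ p q (z (p + 1) q) + d₂ p q (z p (q + 1)) = 0 :=
    congrFun (congrFun hz p) q
  have hw (q : ℕ) : ∃ y, dN q y = π q (z 0 q) := by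
    cases q with
    | zero => exact hz₀
    | succ q =>
      refine hN q _ ?_
      have h := congrArg (π q) (hz' 0 q)
      rwa [map_add, map_zero, hπ₁, zero_add, hπ₂] at h
  choose w hw using hw
  -- The preimage is the contraction of `z`, corrected in the first column by means of `N`.
  let y : ∀ p q, M p q
    | 0, 0 => 0
    | 0, q + 1 => σ (q + 1) (w q)
    | p + 1, q => s p q (z p q)
  refine ⟨y, rfl, ?_⟩
  ext p q
  rw [totalDifferential_apply]
  cases p with
  | zero =>
    change d₁ 0 q (s 0 q (z 0 q)) + d₂ 0 q (σ (q + 1) (w q)) = _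
    rw [hs₀, hσ, hw, sub_add_cancel]
  | succ p =>
    change d₁ (p + 1) q (s (p + 1) q (z (p + 1) q)) + d₂ (p + 1) q (s p (q + 1) (z p (q + 1))) = _
    rw [hs, hs₂, sub_add, sub_neg_eq_add, ← map_add, hz', map_zero, sub_zero]

/-- A map from the bottom of a complex of projectives to the corner of a double complex with
contractible rows extends to a chain map to the total complex. The total complex is encoded by the
product of all the terms of the double complex in each degree, so that `φ p q n` is also defined,
without any significance, if `p + q ≠ n`. -/
theorem exists_chainMap_total {N : ℕ → Type*} [∀ q, AddCommGroup (N q)]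
    {P : ℕ → Type*} [∀ n, AddCommGroup (P n)] [∀ n, Module R (P n)]
    [∀ n, Module.Projective R (P n)]
    (dP : ∀ n, P (n + 1) →ₗ[R] P n) (hP : ∀ n x, dP n (dP (n + 1) x) = 0)
    (d₁ : ∀ p q, M (p + 1) q →ₗ[R] M p q) (d₂ : ∀ p q, M p (q + 1) →ₗ[R] M p q)
    (dN : ∀ q, N (q + 1) →+ N q) (π : ∀ q, M 0 q →+ N q) (σ : ∀ q, N q →+ M 0 q)
    (s : ∀ p q, M p q →+ M (p + 1) q)
    (hπ₁ : ∀ q x, π q (d₁ 0 q x) = 0) (hπ₂ : ∀ q x, π q (d₂ 0 q x) = dN q (π (q + 1) x))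
    (hσ : ∀ q x, d₂ 0 q (σ (q + 1) x) = σ q (dN q x))
    (hs₂ : ∀ p q x, d₂ (p + 1) q (s p (q + 1) x) = -s p q (d₂ p q x))
    (hs₀ : ∀ q x, d₁ 0 q (s 0 q x) = x - σ q (π q x))
    (hs : ∀ p q x, d₁ (p + 1) q (s (p + 1) q x) = x - s p q (d₁ p q x))
    (hN : ∀ q x, dN q x = 0 → ∃ y, dN (q + 1) y = x)
    (φ₀ : P 0 →ₗ[R] M 0 0) (hφ₀ : ∀ x, ∃ y, dN 0 y = π 0 (φ₀ (dP 0 x))) :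
    ∃ φ : ∀ p q n, P n →ₗ[R] M p q, φ 0 0 0 = φ₀ ∧
      ∀ p q n x, φ p q n (dP n x) = d₁ p q (φ (p + 1) q (n + 1) x) +
        d₂ p q (φ p (q + 1) (n + 1) x) := by
  have key := exists_totalDifferential_eq d₁ d₂ dN π σ s hπ₁ hπ₂ hσ hs₂ hs₀ hs hN
  let ι : M 0 0 →ₗ[R] ∀ p q, M p q :=
    LinearMap.single R (fun p => ∀ q, M p q) 0 ∘ₗ LinearMap.single R (fun q => M 0 q) 0
  have hι (x : M 0 0) : ι x 0 0 = x := by simp [ι]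
  have hdι (x : M 0 0) : totalDifferential d₁ d₂ (ι x) = 0 := by
    ext p q
    have h1 : ι x (p + 1) q = 0 := by simp [ι]
    have h2 : ι x p (q + 1) = 0 := by rcases p with _ | p <;> simp [ι]
    rw [totalDifferential_apply, h1, h2]
    simp
  -- After the lowest degree, the corner component of the chain map is kept equal to `0`: only then
  -- does acyclicity apply without a condition on the corner.
  obtain ⟨φ, h0, h⟩ := exists_chainMap (T := fun _ => ∀ p q, M p q) dP hP
    (fun _ => totalDifferential d₁ d₂)
    (fun _ => LinearMap.ker (LinearMap.proj (R := R) (φ := fun q => M 0 q) 0 ∘ₗ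
      LinearMap.proj (R := R) (φ := fun p => ∀ q, M p q) 0))
    (fun _ x hx hx' => key x hx' ⟨0, by
      have hx : x 0 0 = 0 := hx
      rw [hx, map_zero, map_zero]⟩)
    (ι ∘ₗ φ₀) (fun x => key _ (hdι _) (by
      rw [LinearMap.comp_apply, hι]
      exact hφ₀ x))
  refine ⟨fun p q n => LinearMap.proj q ∘ₗ LinearMap.proj p ∘ₗ φ n, ?_, ?_⟩
  · ext x
    simp [h0, hι]
  · intro p q n x
    exact (congrFun (congrFun (h n x) p) q).symm

end DoubleComplex

/-! ### Graded vector spaces -/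

section Graded

variable {k : Type*} {G : Type*} [Field k] [DecidableEq G] {V : Type*} [AddCommGroup V] [Module k V]
  {W : Type*} [AddCommGroup W] [Module k W] {gr : G → Submodule k V}

/-- The linear map which is given by `F g` on the component of degree `g`. -/
def gradedLift (hgr : DirectSum.IsInternal gr) (F : G → V →ₗ[k] W) : V →ₗ[k] W :=
  DirectSum.toModule k G W (fun g => F g ∘ₗ (gr g).subtype) ∘ₗ
    (LinearEquiv.ofBijective (DirectSum.coeLinearMap gr) hgr).symm.toLinearMap

theorem gradedLift_apply (hgr : DirectSum.IsInternal gr) (F : G → V →ₗ[k] W) {g : G} {v : V}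
    (hv : v ∈ gr g) : gradedLift hgr F v = F g v := by
  have h : (LinearEquiv.ofBijective (DirectSum.coeLinearMap gr) hgr).symm v =
      DirectSum.lof k G (fun g => gr g) g ⟨v, hv⟩ := by
    rw [LinearEquiv.symm_apply_eq]
    exact (DirectSum.coeLinearMap_lof gr g ⟨v, hv⟩).symm
  simp [gradedLift, h]

theorem graded_induction (hgr : DirectSum.IsInternal gr) {p : V → Prop} (v : V)
    (hom : ∀ g, ∀ v ∈ gr g, p v) (h0 : p 0) (add : ∀ v w, p v → p w → p (v + w)) : p v :=
  Submodule.iSup_induction gr (motive := p)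
    (hgr.submodule_iSup_eq_top ▸ Submodule.mem_top : v ∈ ⨆ g, gr g) hom h0 add

theorem graded_hom_ext (hgr : DirectSum.IsInternal gr) {F F' : V →ₗ[k] W}
    (h : ∀ g, ∀ v ∈ gr g, F v = F' v) : F = F' := by
  ext v
  induction v using graded_induction hgr with
  | hom g v hv => exact h g v hv
  | h0 => simp
  | add v w hv hw => simp [hv, hw]

/-- The projection onto the component of degree `s`. -/
def gradedProj (hgr : DirectSum.IsInternal gr) (s : G) : V →ₗ[k] V :=
  gradedLift hgr fun t => if t = s then LinearMap.id else 0

theorem gradedProj_apply (hgr : DirectSum.IsInternal gr) {s t : G} {v : V} (hv : v ∈ gr t) :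
    gradedProj hgr s v = if t = s then v else 0 := by
  rw [gradedProj, gradedLift_apply hgr _ hv]
  split_ifs <;> rfl

theorem gradedProj_mem (hgr : DirectSum.IsInternal gr) (s : G) (v : V) :
    gradedProj hgr s v ∈ gr s := by
  induction v using graded_induction hgr with
  | hom g v hv =>
    rw [gradedProj_apply hgr hv]
    split_ifs with h
    · exact h ▸ hv
    · exact zero_mem _
  | h0 => rw [map_zero]; exact zero_mem _
  | add v w hv hw => rw [map_add]; exact add_mem hv hw

theorem exists_eq_sum_gradedProj (hgr : DirectSum.IsInternal gr) (v : V) :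
    ∃ F : Finset G, ∀ F', F ⊆ F' → v = ∑ s ∈ F', gradedProj hgr s v := by
  induction v using graded_induction hgr with
  | hom g v hv =>
    refine ⟨{g}, fun F' hF => ?_⟩
    simp only [gradedProj_apply hgr hv, Finset.sum_ite_eq]
    rw [if_pos (hF (Finset.mem_singleton_self g))]
  | h0 => exact ⟨∅, fun F' _ => by simp⟩
  | add v w hv hw =>
    obtain ⟨F₁, h₁⟩ := hv
    obtain ⟨F₂, h₂⟩ := hw
    refine ⟨F₁ ∪ F₂, fun F' hF => ?_⟩
    simp only [map_add, Finset.sum_add_distrib]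
    rw [← h₁ F' (Finset.union_subset_left hF), ← h₂ F' (Finset.union_subset_right hF)]

/-- A family of subspaces that spans the space, and that is separated by a family of projections, is a
grading. -/
theorem isInternal_of_proj (hsup : ⨆ g, gr g = ⊤) (pr : G → V →ₗ[k] V)
    (hpr : ∀ s, ∀ v ∈ gr s, pr s v = v) (hpr' : ∀ s t, t ≠ s → ∀ v ∈ gr t, pr s v = 0) :
    DirectSum.IsInternal gr := by
  have key (x : DirectSum G fun g => gr g) (s : G) :
      pr s (DirectSum.coeLinearMap gr x) = (x s : V) := by
    induction x using DirectSum.induction_on with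
    | zero => simp
    | of t v =>
      have h := DirectSum.coeLinearMap_lof gr t v
      rw [DirectSum.lof_eq_of] at h
      rw [h]
      by_cases hts : t = s
      · subst hts
        rw [hpr t v v.2, DirectSum.of_eq_same]
      · rw [hpr' s t hts v v.2, DirectSum.of_eq_of_ne _ _ _ (Ne.symm hts)]
        rfl
    | add x y hx hy => simp [hx, hy]
  refine ⟨fun x y hxy => ?_, ?_⟩
  · ext s
    rw [← key, ← key]
    exact congrArg (pr s) hxy
  · have : LinearMap.range (DirectSum.coeLinearMap gr) = ⊤ := by
      rw [← hsup, Submodule.iSup_eq_range_dfinsupp_lsum]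
      rfl
    exact LinearMap.range_eq_top.1 this

end Graded

/-! ### Modules over a bimonoid in Yetter-Drinfeld modules -/

section YDModules

variable {k : Type*} [Field k] {G : Type*} [Group G] [DecidableEq G]
  {A : Type*} [Ring A] [Algebra k A] [Coalgebra k A]

/-- A left `A`-module in the category of Yetter-Drinfeld modules. -/
structure YDModule (B : YDBimonoid k G A) (M : Type*) [AddCommGroup M] [Module k M] [Module A M]
    extends YetterDrinfeld k G M where
  smul_mem : ∀ (s t : G) (a : A) (m : M), a ∈ B.gr s → m ∈ gr t → a • m ∈ gr (s * t)
  act_smul : ∀ (g : G) (a : A) (m : M), act g (a • m) = B.act g a • act g m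

variable {B : YDBimonoid k G A} {M : Type*} [AddCommGroup M] [Module k M] [Module A M]
  [IsScalarTower k A M] (X : YDModule B M) (N : Type*) [AddCommGroup N] [Module k N] [Module A N]
  [IsScalarTower k A N]

/-- The endomorphism `m ⊗ n ↦ a m ⊗ n`. -/
def diagLeft (k : Type*) [Field k] {A : Type*} [Ring A] [Algebra k A] (M : Type*) [AddCommGroup M]
    [Module k M] [Module A M] [IsScalarTower k A M] (N : Type*) [AddCommGroup N] [Module k N] :
    A →ₗ[k] Module.End k (M ⊗[k] N) :=
  LinearMap.rTensorHom N ∘ₗ (Algebra.lsmul k k M : A →ₐ[k] Module.End k M).toLinearMap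

theorem diagLeft_apply (a : A) (m : M) (n : N) :
    diagLeft k M N a (m ⊗ₜ[k] n) = (a • m) ⊗ₜ[k] n := rfl

/-- The endomorphism `m ⊗ n ↦ (g • m) ⊗ a n` for `a` of degree `g`: the action of `a` on the
right-hand factor of `M ⊗ N`, moved past the left-hand factor by the braiding. -/
def diagRight : A →ₗ[k] Module.End k (M ⊗[k] N) :=
  gradedLift B.isInternal fun g =>
    TensorProduct.mapBilinear (RingHom.id k) M N M N (X.act g) ∘ₗ
      (Algebra.lsmul k k N : A →ₐ[k] Module.End k N).toLinearMap

theorem diagRight_apply {g : G} {a : A} (ha : a ∈ B.gr g) (m : M) (n : N) :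
    diagRight X N a (m ⊗ₜ[k] n) = X.act g m ⊗ₜ[k] (a • n) := by
  rw [diagRight, gradedLift_apply B.isInternal _ ha]
  rfl

/-- The action of `A ⊗ A` on `M ⊗ N`, defined by means of the braiding. -/
def diagTensor : A ⊗[k] A →ₗ[k] Module.End k (M ⊗[k] N) :=
  TensorProduct.lift ((LinearMap.mul k (Module.End k (M ⊗[k] N))).compl₁₂ (diagLeft k M N)
    (diagRight X N))

theorem diagTensor_tmul (a : A) {g : G} {b : A} (hb : b ∈ B.gr g) (m : M) (n : N) :
    diagTensor X N (a ⊗ₜ[k] b) (m ⊗ₜ[k] n) = (a • X.act g m) ⊗ₜ[k] (b • n) := by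
  change diagLeft k M N a (diagRight X N b (m ⊗ₜ[k] n)) = _
  rw [diagRight_apply X N hb, diagLeft_apply]

theorem tensor_graded_induction {V W : Type*} [AddCommGroup V] [Module k V] [AddCommGroup W]
    [Module k W] {gr : G → Submodule k W} (hgr : DirectSum.IsInternal gr) {p : V ⊗[k] W → Prop}
    (z : V ⊗[k] W) (h0 : p 0) (tmul : ∀ (v : V) (g : G), ∀ y ∈ gr g, p (v ⊗ₜ[k] y))
    (add : ∀ z z', p z → p z' → p (z + z')) : p z := by
  induction z with
  | zero => exact h0
  | tmul v y =>
    induction y using graded_induction hgr with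
    | hom g y hy => exact tmul v g y hy
    | h0 => rw [TensorProduct.tmul_zero]; exact h0
    | add y y' hy hy' => rw [TensorProduct.tmul_add]; exact add _ _ hy hy'
  | add z z' hz hz' => exact add _ _ hz hz'

/-- The action of `A ⊗ A` is multiplicative for the braided product
`(μ ⊗ μ) ∘ (id ⊗ c ⊗ id)`. -/
theorem diagTensor_mul (t t' : A ⊗[k] A) :
    diagTensor X N (TensorProduct.map (LinearMap.mul' k A) (LinearMap.mul' k A)
      (middleMap (B.braiding B.toYetterDrinfeld) (t ⊗ₜ[k] t'))) =
      diagTensor X N t * diagTensor X N t' := by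
  induction t using tensor_graded_induction (V := A) B.isInternal with
  | h0 => simp
  | add t₁ t₂ h₁ h₂ => simp only [TensorProduct.add_tmul, map_add, h₁, h₂, add_mul]
  | tmul a g b hb =>
    induction t' using tensor_graded_induction (V := A) B.isInternal with
    | h0 => simp
    | add t₁ t₂ h₁ h₂ => simp only [TensorProduct.tmul_add, map_add, h₁, h₂, mul_add]
    | tmul a' g' b' hb' =>
      have h : middleMap (B.braiding B.toYetterDrinfeld) ((a ⊗ₜ[k] b) ⊗ₜ[k] (a' ⊗ₜ[k] b')) =
          (a ⊗ₜ[k] B.act g a') ⊗ₜ[k] (b ⊗ₜ[k] b') := by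
        simp [middleMap, B.braiding_tmul B.toYetterDrinfeld g b hb]
      rw [h]
      refine TensorProduct.ext' fun m n => ?_
      have h₁ : X.act g (X.act g' m) = X.act (g * g') m := by rw [map_mul]; rfl
      rw [TensorProduct.map_tmul, LinearMap.mul'_apply, LinearMap.mul'_apply,
        diagTensor_tmul X N _ (B.mul_mem _ _ _ _ hb hb'), Module.End.mul_apply,
        diagTensor_tmul X N _ hb', diagTensor_tmul X N _ hb, X.act_smul, h₁, smul_smul, smul_smul]

/-- The tensor product `M ⊗ N` with the diagonal action of `A`, through the comultiplication and
the braiding. Only the group action on `M` enters into it. -/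
def DiagTensor (_X : YDModule B M) (N : Type*) [AddCommGroup N] [Module k N] : Type _ := M ⊗[k] N

instance : AddCommGroup (DiagTensor X N) := inferInstanceAs (AddCommGroup (M ⊗[k] N))

instance : Module k (DiagTensor X N) := inferInstanceAs (Module k (M ⊗[k] N))

/-- The diagonal action as an algebra map. -/
def diagAction : A →ₐ[k] Module.End k (M ⊗[k] N) :=
  AlgHom.ofLinearMap (diagTensor X N ∘ₗ Coalgebra.comul)
    (by
      refine TensorProduct.ext' fun m n => ?_
      rw [LinearMap.comp_apply, B.comul_one, diagTensor_tmul X N _ B.one_mem]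
      simp)
    (fun a b => by
      simp only [LinearMap.comp_apply]
      rw [B.comul_mul, diagTensor_mul])

instance : Module A (DiagTensor X N) := Module.compHom (M ⊗[k] N) (diagAction X N).toRingHom

theorem diag_smul_def (a : A) (z : DiagTensor X N) :
    a • z = diagTensor X N (Coalgebra.comul a) z := rfl

instance : IsScalarTower k A (DiagTensor X N) :=
  ⟨fun c a z => by
    rw [diag_smul_def, map_smul, map_smul]
    rfl⟩

variable {N}

/-- A linear map out of `M ⊗ N` that factors the action of `a ⊗ b` as `ε(a) b` is `A`-linear. -/
def diagHomRight {N' : Type*} [AddCommGroup N'] [Module k N'] [Module A N'] [IsScalarTower k A N']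
    (Ψ : M ⊗[k] N →ₗ[k] N')
    (h : ∀ (a : A) (g : G), ∀ b ∈ B.gr g, ∀ m n, Ψ ((a • X.act g m) ⊗ₜ[k] (b • n)) =
      Coalgebra.counit (R := k) a • b • Ψ (m ⊗ₜ[k] n)) : DiagTensor X N →ₗ[A] N' where
  toFun := Ψ
  map_add' := Ψ.map_add
  map_smul' a z := by
    have key (t : A ⊗[k] A) (z : M ⊗[k] N) : Ψ (diagTensor X N t z) =
        TensorProduct.lid k A (LinearMap.rTensor A Coalgebra.counit t) • Ψ z := by
      induction t using tensor_graded_induction (V := A) B.isInternal with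
      | h0 => simp
      | add t₁ t₂ h₁ h₂ => simp only [map_add, LinearMap.add_apply, h₁, h₂, add_smul]
      | tmul a g b hb =>
        induction z with
        | zero => simp
        | add z z' hz hz' => simp only [map_add, hz, hz', smul_add]
        | tmul m n =>
          rw [diagTensor_tmul X N a hb, h a g b hb]
          simp
    refine (key _ _).trans ?_
    rw [Coalgebra.rTensor_counit_comul]
    simp

/-- A linear map out of `M ⊗ N` that factors the action of `a ⊗ b` as `a ε(b)` is `A`-linear. -/
def diagHomLeft {M' : Type*} [AddCommGroup M'] [Module k M'] [Module A M'] [IsScalarTower k A M']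
    (Ψ : M ⊗[k] N →ₗ[k] M')
    (h : ∀ (a : A) (g : G), ∀ b ∈ B.gr g, ∀ m n, Ψ ((a • X.act g m) ⊗ₜ[k] (b • n)) =
      Coalgebra.counit (R := k) b • a • Ψ (m ⊗ₜ[k] n)) : DiagTensor X N →ₗ[A] M' where
  toFun := Ψ
  map_add' := Ψ.map_add
  map_smul' a z := by
    have key (t : A ⊗[k] A) (z : M ⊗[k] N) : Ψ (diagTensor X N t z) =
        TensorProduct.rid k A (LinearMap.lTensor A Coalgebra.counit t) • Ψ z := by
      induction t using tensor_graded_induction (V := A) B.isInternal with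
      | h0 => simp
      | add t₁ t₂ h₁ h₂ => simp only [map_add, LinearMap.add_apply, h₁, h₂, add_smul]
      | tmul a g b hb =>
        induction z with
        | zero => simp
        | add z z' hz hz' => simp only [map_add, hz, hz', smul_add]
        | tmul m n =>
          rw [diagTensor_tmul X N a hb, h a g b hb]
          simp
    refine (key _ _).trans ?_
    rw [Coalgebra.lTensor_counit_comul]
    simp

/-- The map `φ ⊗ ψ` of diagonal tensor products, for `φ` compatible with the group actions. -/
def diagMap {M' : Type*} [AddCommGroup M'] [Module k M'] [Module A M'] [IsScalarTower k A M']
    (X' : YDModule B M') {N' : Type*} [AddCommGroup N'] [Module k N'] [Module A N']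
    [IsScalarTower k A N'] (φ : M →ₗ[A] M') (hφ : ∀ g m, φ (X.act g m) = X'.act g (φ m))
    (ψ : N →ₗ[A] N') : DiagTensor X N →ₗ[A] DiagTensor X' N' where
  toFun := TensorProduct.map (φ.restrictScalars k) (ψ.restrictScalars k)
  map_add' := map_add _
  map_smul' a z := by
    have key (t : A ⊗[k] A) (z : M ⊗[k] N) :
        TensorProduct.map (φ.restrictScalars k) (ψ.restrictScalars k) (diagTensor X N t z) =
        diagTensor X' N' t (TensorProduct.map (φ.restrictScalars k) (ψ.restrictScalars k) z) := by
      induction t using tensor_graded_induction (V := A) B.isInternal with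
      | h0 => simp
      | add t₁ t₂ h₁ h₂ => simp only [map_add, LinearMap.add_apply, h₁, h₂]
      | tmul a g b hb =>
        induction z with
        | zero => simp
        | add z z' hz hz' => simp only [map_add, hz, hz']
        | tmul m n => simp [diagTensor_tmul _ _ _ hb, hφ]
    exact key _ _

end YDModules

/-! ### Resolutions of the trivial module and Yoneda products -/

section LeftResolution

variable {k : Type*} [Field k] {G : Type*} [CommGroup G] [DecidableEq G]
  {A : Type*} [Ring A] [Algebra k A] [Coalgebra k A]

/-- The `A`-linear maps from `M` to the trivial module `k`, as linear forms. -/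
def counitHoms (k A : Type*) [Field k] [Ring A] [Algebra k A] [Coalgebra k A] (M : Type*)
    [AddCommGroup M] [Module k M] [Module A M] : Submodule k (M →ₗ[k] k) where
  carrier := {f | ∀ (a : A) (x : M), f (a • x) = Coalgebra.counit (R := k) a * f x}
  add_mem' hf hg a x := by
    rw [LinearMap.add_apply, LinearMap.add_apply, hf a x, hg a x, mul_add]
  zero_mem' a x := by simp
  smul_mem' c f hf a x := by
    rw [LinearMap.smul_apply, LinearMap.smul_apply, hf a x, smul_eq_mul, smul_eq_mul,
      mul_left_comm]

theorem comp_mem_counitHoms {M N : Type*} [AddCommGroup M] [Module k M] [Module A M]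
    [IsScalarTower k A M] [AddCommGroup N] [Module k N] [Module A N] [IsScalarTower k A N]
    {f : N →ₗ[k] k} (hf : f ∈ counitHoms k A N) (φ : M →ₗ[A] N) :
    f ∘ₗ φ.restrictScalars k ∈ counitHoms k A M := fun a x => by
  simp [hf a (φ x)]

/-- Linear forms on a projective module that are `A`-linear with values in the trivial module
lift along surjections of the same kind. -/
theorem exists_lift_counit (B : YDBimonoid k G A) {M N : Type*} [AddCommGroup M] [Module k M]
    [Module A M] [Module.Projective A M] [AddCommGroup N] [Module k N] [Module A N]
    {f : M →ₗ[k] k} (hf : f ∈ counitHoms k A M) {β : N →ₗ[k] k} (hβ : β ∈ counitHoms k A N)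
    (hsurj : Function.Surjective β) : ∃ φ : M →ₗ[A] N, ∀ x, β (φ x) = f x := by
  let _ : Module A k := Module.compHom k B.aug.toRingHom
  let f' : M →ₗ[A] k := { toFun := f, map_add' := f.map_add, map_smul' := hf }
  let β' : N →ₗ[A] k := { toFun := β, map_add' := β.map_add, map_smul' := hβ }
  exact Module.Projective.exists_lift_of_mem_range β' f' fun x => hsurj _

/-- A resolution `Q → k` of the trivial left `A`-module by finitely generated projective modules,
in the category of Yetter-Drinfeld modules. Acyclicity is given by a linear contraction. -/
structure YDLeftResolution (B : YDBimonoid k G A) (Q : ℕ → Type*) [∀ n, AddCommGroup (Q n)]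
    [∀ n, Module k (Q n)] [∀ n, Module A (Q n)] [∀ n, IsScalarTower k A (Q n)] where
  yd : ∀ n, YDModule B (Q n)
  d : ∀ n, Q (n + 1) →ₗ[A] Q n
  d_d : ∀ n x, d n (d (n + 1) x) = 0
  d_mem : ∀ n s, ∀ x ∈ (yd (n + 1)).gr s, d n x ∈ (yd n).gr s
  d_act : ∀ n g x, d n ((yd (n + 1)).act g x) = (yd n).act g (d n x)
  aug : Q 0 →ₗ[k] k
  aug_smul : aug ∈ counitHoms k A (Q 0)
  aug_d : ∀ x, aug (d 0 x) = 0
  aug_mem : ∀ s, s ≠ 1 → ∀ x ∈ (yd 0).gr s, aug x = 0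
  aug_act : ∀ g x, aug ((yd 0).act g x) = aug x
  base : Q 0
  aug_base : aug base = 1
  htpy : ∀ n, Q n →ₗ[k] Q (n + 1)
  d_htpy_zero : ∀ x, d 0 (htpy 0 x) = x - aug x • base
  d_htpy_succ : ∀ n x, d (n + 1) (htpy (n + 1) x) = x - htpy n (d n x)
  projective : ∀ n, Module.Projective A (Q n)
  finite : ∀ n, Module.Finite A (Q n)

namespace YDLeftResolution

variable {B : YDBimonoid k G A} {Q : ℕ → Type*} [∀ n, AddCommGroup (Q n)]
  [∀ n, Module k (Q n)] [∀ n, Module A (Q n)] [∀ n, IsScalarTower k A (Q n)]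
  (L : YDLeftResolution B Q)

theorem exists_d_eq (n : ℕ) (x : Q (n + 1)) (hx : L.d n x = 0) : ∃ y, L.d (n + 1) y = x :=
  ⟨L.htpy (n + 1) x, by rw [L.d_htpy_succ, hx, map_zero, sub_zero]⟩

theorem exists_d_eq_zero (x : Q 0) (hx : L.aug x = 0) : ∃ y, L.d 0 y = x :=
  ⟨L.htpy 0 x, by rw [L.d_htpy_zero, hx, zero_smul, sub_zero]⟩

theorem aug_surjective : Function.Surjective L.aug := fun c =>
  ⟨c • L.base, by rw [map_smul, L.aug_base, smul_eq_mul, mul_one]⟩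

/-- The cocycles of `Hom_A(Q, k)`. -/
def cocycle (n : ℕ) : Submodule k (Q n →ₗ[k] k) :=
  counitHoms k A (Q n) ⊓ LinearMap.ker (LinearMap.lcomp k k ((L.d n).restrictScalars k))

theorem mem_cocycle {n : ℕ} {f : Q n →ₗ[k] k} :
    f ∈ L.cocycle n ↔ f ∈ counitHoms k A (Q n) ∧ ∀ x, f (L.d n x) = 0 :=
  and_congr Iff.rfl (LinearMap.mem_ker.trans LinearMap.ext_iff)

/-- The coboundaries of `Hom_A(Q, k)`. -/
def coboundary : ∀ n : ℕ, Submodule k (Q n →ₗ[k] k)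
  | 0 => ⊥
  | n + 1 => (counitHoms k A (Q n)).map (LinearMap.lcomp k k ((L.d n).restrictScalars k))

theorem comp_d_mem_coboundary {n : ℕ} {f : Q n →ₗ[k] k} (hf : f ∈ counitHoms k A (Q n)) :
    f ∘ₗ (L.d n).restrictScalars k ∈ L.coboundary (n + 1) :=
  ⟨f, hf, rfl⟩

/-- `φ` is a chain map `Q_{p + •} → Q_•` of `A`-modules that lifts the cocycle `f : Q_p → k`. -/
def IsLift {p : ℕ} (f : Q p →ₗ[k] k) (φ : ∀ j n, p + j = n → (Q n →ₗ[A] Q j)) : Prop :=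
  (∀ x, L.aug (φ 0 p rfl x) = f x) ∧
    ∀ (j n : ℕ) (h : p + j = n) (x : Q (n + 1)),
      L.d j (φ (j + 1) (n + 1) (congrArg Nat.succ h) x) = φ j n h (L.d n x)

variable {L}

theorem exists_isLift {p : ℕ} {f : Q p →ₗ[k] k} (hf : f ∈ L.cocycle p) :
    ∃ φ : ∀ j n, p + j = n → (Q n →ₗ[A] Q j), L.IsLift f φ := by
  have := L.projective
  rw [mem_cocycle] at hf
  obtain ⟨φ₀, hφ₀⟩ := exists_lift_counit B hf.1 L.aug_smul L.aug_surjective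
  obtain ⟨φ, h0, h⟩ := exists_chainMap (P := fun j => Q (p + j)) (T := Q)
    (fun j => L.d (p + j)) (fun j x => L.d_d (p + j) x) L.d (fun _ => ⊤)
    (fun n x _ hx => (L.exists_d_eq n x hx).imp fun y hy => ⟨trivial, hy⟩) φ₀
    (fun x => (L.exists_d_eq_zero _ ((hφ₀ _).trans (hf.2 x))).imp fun y hy => ⟨trivial, hy⟩)
  refine ⟨fun j n h => by subst h; exact φ j, fun x => ?_, fun j n hn x => ?_⟩
  · exact (congrArg (fun ψ : Q p →ₗ[A] Q 0 => L.aug (ψ x)) h0).trans (hφ₀ x)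
  · subst hn
    exact h j x

theorem IsLift.sub {p : ℕ} {f f' : Q p →ₗ[k] k} {φ φ' : ∀ j n, p + j = n → (Q n →ₗ[A] Q j)}
    (hφ : L.IsLift f φ) (hφ' : L.IsLift f' φ') :
    L.IsLift (f - f') fun j n h => φ j n h - φ' j n h :=
  ⟨fun x => by simp [hφ.1, hφ'.1], fun j n h x => by simp [hφ.2 j n h, hφ'.2 j n h]⟩

theorem IsLift.add {p : ℕ} {f f' : Q p →ₗ[k] k} {φ φ' : ∀ j n, p + j = n → (Q n →ₗ[A] Q j)}
    (hφ : L.IsLift f φ) (hφ' : L.IsLift f' φ') :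
    L.IsLift (f + f') fun j n h => φ j n h + φ' j n h :=
  ⟨fun x => by simp [hφ.1, hφ'.1], fun j n h x => by simp [hφ.2 j n h, hφ'.2 j n h]⟩

theorem IsLift.smul (c : k) {p : ℕ} {f : Q p →ₗ[k] k} {φ : ∀ j n, p + j = n → (Q n →ₗ[A] Q j)}
    (hφ : L.IsLift f φ) :
    L.IsLift (c • f) fun j n h =>
      { toFun := fun x => c • φ j n h x
        map_add' := fun x y => by rw [map_add, smul_add]
        map_smul' := fun a x => by rw [map_smul, smul_algebra_smul_comm, RingHom.id_apply] } :=
  ⟨fun x => by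
    change L.aug (c • φ 0 p rfl x) = c • f x
    rw [map_smul, hφ.1], fun j n h x => by
    change L.d j (c • _) = c • φ j n h (L.d n x)
    rw [← hφ.2 j n h, LinearMap.map_smul_of_tower]⟩

theorem IsLift.comp_mem_cocycle {p : ℕ} {f : Q p →ₗ[k] k}
    {φ : ∀ j n, p + j = n → (Q n →ₗ[A] Q j)} (hφ : L.IsLift f φ) {j n : ℕ} (h : p + j = n)
    {g : Q j →ₗ[k] k} (hg : g ∈ L.cocycle j) :
    g ∘ₗ (φ j n h).restrictScalars k ∈ L.cocycle n := by
  rw [mem_cocycle] at hg ⊢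
  refine ⟨comp_mem_counitHoms hg.1 _, fun x => ?_⟩
  rw [LinearMap.comp_apply, LinearMap.restrictScalars_apply, ← hφ.2, hg.2]

/-- If `f = aug ∘ δ`, where `δ : Q_p → Q_0` is `A`-linear, vanishes on boundaries and pulls cocycles
back to coboundaries, then every lift of `f` pulls cocycles back to coboundaries: after subtraction
of `δ` in degree `0` it is null-homotopic. -/
theorem comp_mem_coboundary_of_aug_eq {p : ℕ} {f : Q p →ₗ[k] k}
    {φ : ∀ j n, p + j = n → (Q n →ₗ[A] Q j)} (hφ : L.IsLift f φ) (δ : Q p →ₗ[A] Q 0)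
    (hδ : ∀ x, δ (L.d p x) = 0) (hδf : ∀ x, L.aug (δ x) = f x)
    (hδg : ∀ g ∈ L.cocycle 0, g ∘ₗ δ.restrictScalars k ∈ L.coboundary p)
    {j n : ℕ} (h : p + j = n) {g : Q j →ₗ[k] k} (hg : g ∈ L.cocycle j) :
    g ∘ₗ (φ j n h).restrictScalars k ∈ L.coboundary n := by
  have := L.projective
  let φ' (j : ℕ) : Q (p + j) →ₗ[A] Q j :=
    match j with
    | 0 => φ 0 p rfl - δ
    | j + 1 => φ (j + 1) _ rfl
  obtain ⟨H, h0, hH⟩ := exists_nullHomotopy (P := fun j => Q (p + j)) (T := Q)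
    (fun j => L.d (p + j)) (fun j x => L.d_d (p + j) x) L.d L.exists_d_eq φ'
    (fun j x => by
      cases j with
      | zero =>
        change L.d 0 (φ 1 (p + 1) _ x) = φ 0 p _ (L.d p x) - δ (L.d p x)
        rw [hφ.2 0 p rfl, hδ, sub_zero]
      | succ j => exact hφ.2 (j + 1) _ rfl x)
    (fun x => L.exists_d_eq_zero _ (by
      change L.aug (φ 0 p rfl x - δ x) = 0
      rw [map_sub, hφ.1, hδf, sub_self]))
  have hg' := (mem_cocycle _).1 hg
  subst h
  cases j with
  | zero =>
    have h3 : g ∘ₗ (φ 0 _ rfl).restrictScalars k = g ∘ₗ δ.restrictScalars k := by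
      ext x
      have h1 : L.d 0 (H 0 x) = φ 0 p rfl x - δ x := h0 x
      have h2 := hg'.2 (H 0 x)
      rw [h1, map_sub, sub_eq_zero] at h2
      exact h2
    exact h3 ▸ hδg g hg
  | succ j =>
    have h3 : g ∘ₗ (φ (j + 1) _ rfl).restrictScalars k =
        (g ∘ₗ (H j).restrictScalars k) ∘ₗ (L.d (p + j)).restrictScalars k := by
      ext x
      have h1 : L.d (j + 1) (H (j + 1) x) = φ (j + 1) _ rfl x - H j (L.d (p + j) x) := hH j x
      have h2 := hg'.2 (H (j + 1) x)
      rw [h1, map_sub, sub_eq_zero] at h2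
      exact h2
    rw [h3]
    exact L.comp_d_mem_coboundary (comp_mem_counitHoms hg'.1 (H j))

theorem IsLift.comp_mem_coboundary {p : ℕ} {f : Q p →ₗ[k] k}
    {φ : ∀ j n, p + j = n → (Q n →ₗ[A] Q j)} (hφ : L.IsLift f φ) (hf : f ∈ L.coboundary p)
    {j n : ℕ} (h : p + j = n) {g : Q j →ₗ[k] k} (hg : g ∈ L.cocycle j) :
    g ∘ₗ (φ j n h).restrictScalars k ∈ L.coboundary n := by
  cases p with
  | zero =>
    have hf : f = 0 := hf
    exact comp_mem_coboundary_of_aug_eq hφ 0 (fun x => rfl) (fun x => by simp [hf])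
      (fun g _ => by simp) h hg
  | succ p =>
    have := L.projective
    obtain ⟨f', hf', rfl⟩ := hf
    obtain ⟨γ, hγ⟩ := exists_lift_counit B hf' L.aug_smul L.aug_surjective
    refine comp_mem_coboundary_of_aug_eq hφ (γ ∘ₗ L.d p) (fun x => ?_) (fun x => hγ _)
      (fun g hg => ?_) h hg
    · rw [LinearMap.comp_apply, L.d_d, map_zero]
    · exact L.comp_d_mem_coboundary (comp_mem_counitHoms ((mem_cocycle _).1 hg).1 γ)

theorem IsLift.coboundary_comp {p : ℕ} {f : Q p →ₗ[k] k}
    {φ : ∀ j n, p + j = n → (Q n →ₗ[A] Q j)} (hφ : L.IsLift f φ) {j n : ℕ} (h : p + j = n)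
    {g : Q j →ₗ[k] k} (hg : g ∈ L.coboundary j) :
    g ∘ₗ (φ j n h).restrictScalars k ∈ L.coboundary n := by
  cases j with
  | zero =>
    have hg : g = 0 := hg
    simp [hg]
  | succ j =>
    obtain ⟨g', hg', rfl⟩ := hg
    subst h
    have h3 : (LinearMap.lcomp k k ((L.d j).restrictScalars k)) g' ∘ₗ
        (φ (j + 1) _ rfl).restrictScalars k =
        (g' ∘ₗ (φ j _ rfl).restrictScalars k) ∘ₗ (L.d (p + j)).restrictScalars k := by
      ext x
      exact congrArg g' (hφ.2 j (p + j) rfl x)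
    rw [h3]
    exact L.comp_d_mem_coboundary (comp_mem_counitHoms hg' _)

theorem IsLift.trans {p q n : ℕ} (h : p + q = n) {f : Q p →ₗ[k] k} {g : Q q →ₗ[k] k}
    {φ : ∀ j n, p + j = n → (Q n →ₗ[A] Q j)} {ψ : ∀ j n, q + j = n → (Q n →ₗ[A] Q j)}
    (hφ : L.IsLift f φ) (hψ : L.IsLift g ψ) :
    L.IsLift (g ∘ₗ (φ q n h).restrictScalars k)
      fun j m hm => ψ j (q + j) rfl ∘ₗ φ (q + j) m (by omega) :=
  ⟨fun x => hψ.1 _, fun j m hm x => by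
    rw [LinearMap.comp_apply, LinearMap.comp_apply, ← hφ.2 (q + j) m (by omega),
      ← hψ.2 j (q + j) rfl]
    rfl⟩

theorem isLift_aug : L.IsLift L.aug fun j n h => by
    rw [zero_add] at h; subst h; exact LinearMap.id :=
  ⟨fun _ => rfl, fun j n h x => by
    rw [zero_add] at h
    subst h
    rfl⟩

theorem aug_mem_cocycle : L.aug ∈ L.cocycle 0 := (mem_cocycle _).2 ⟨L.aug_smul, L.aug_d⟩

variable (L)

/-- A model `H` of the cohomology of `Hom_A(Q, k)`: each `H n` is a quotient of the cocycles by the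
coboundaries. -/
structure CohomologyModel (H : ℕ → Type*) [∀ n, AddCommGroup (H n)] [∀ n, Module k (H n)] where
  cls : ∀ n, L.cocycle n →ₗ[k] H n
  surjective : ∀ n, Function.Surjective (cls n)
  cls_eq_zero_iff : ∀ n z, cls n z = 0 ↔ (z : Q n →ₗ[k] k) ∈ L.coboundary n

namespace CohomologyModel

variable {L} {H : ℕ → Type*} [∀ n, AddCommGroup (H n)] [∀ n, Module k (H n)]
  (C : L.CohomologyModel H)

theorem cls_eq_iff {n : ℕ} {f g : Q n →ₗ[k] k} (hf : f ∈ L.cocycle n) (hg : g ∈ L.cocycle n) :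
    C.cls n ⟨f, hf⟩ = C.cls n ⟨g, hg⟩ ↔ f - g ∈ L.coboundary n := by
  rw [← sub_eq_zero, ← map_sub, C.cls_eq_zero_iff]
  rfl

theorem exists_rep {n : ℕ} (x : H n) : ∃ f, ∃ hf : f ∈ L.cocycle n, C.cls n ⟨f, hf⟩ = x := by
  obtain ⟨⟨f, hf⟩, rfl⟩ := C.surjective n x
  exact ⟨f, hf, rfl⟩

theorem cls_comp_eq {p q n : ℕ} (h : p + q = n) {f₁ f₂ : Q p →ₗ[k] k} {g₁ g₂ : Q q →ₗ[k] k}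
    (hg₁ : g₁ ∈ L.cocycle q) (hg₂ : g₂ ∈ L.cocycle q)
    {φ₁ φ₂ : ∀ j n, p + j = n → (Q n →ₗ[A] Q j)} (hφ₁ : L.IsLift f₁ φ₁) (hφ₂ : L.IsLift f₂ φ₂)
    (hf : f₁ - f₂ ∈ L.coboundary p) (hg : g₁ - g₂ ∈ L.coboundary q) :
    C.cls n ⟨_, hφ₁.comp_mem_cocycle h hg₁⟩ = C.cls n ⟨_, hφ₂.comp_mem_cocycle h hg₂⟩ := by
  rw [cls_eq_iff]
  convert add_mem (hφ₁.coboundary_comp h hg) ((hφ₁.sub hφ₂).comp_mem_coboundary hf h hg₂) using 1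
  ext x
  simp

theorem exists_mul {p q n : ℕ} (h : p + q = n) (x : H p) (y : H q) :
    ∃ z : H n, ∀ (f : Q p →ₗ[k] k) (hf : f ∈ L.cocycle p) (g : Q q →ₗ[k] k) (hg : g ∈ L.cocycle q)
      (φ : ∀ j n, p + j = n → (Q n →ₗ[A] Q j)) (hφ : L.IsLift f φ), C.cls p ⟨f, hf⟩ = x →
      C.cls q ⟨g, hg⟩ = y → z = C.cls n ⟨_, hφ.comp_mem_cocycle h hg⟩ := by
  obtain ⟨f₁, hf₁, rfl⟩ := C.exists_rep x
  obtain ⟨g₁, hg₁, rfl⟩ := C.exists_rep y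
  obtain ⟨φ₁, hφ₁⟩ := exists_isLift hf₁
  refine ⟨C.cls n ⟨_, hφ₁.comp_mem_cocycle h hg₁⟩, fun f hf g hg φ hφ hx hy => ?_⟩
  exact C.cls_comp_eq h hg₁ hg hφ₁ hφ ((C.cls_eq_iff hf₁ hf).1 hx.symm)
    ((C.cls_eq_iff hg₁ hg).1 hy.symm)

/-- The product `[f] ⌣ [g] = [g ∘ φ]`, where `φ` is a lift of `f`. -/
def mulFun {p q n : ℕ} (h : p + q = n) (x : H p) (y : H q) : H n :=
  Classical.choose (C.exists_mul h x y)

theorem mulFun_cls {p q n : ℕ} (h : p + q = n) {f : Q p →ₗ[k] k} (hf : f ∈ L.cocycle p)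
    {g : Q q →ₗ[k] k} (hg : g ∈ L.cocycle q) {φ : ∀ j n, p + j = n → (Q n →ₗ[A] Q j)}
    (hφ : L.IsLift f φ) : C.mulFun h (C.cls p ⟨f, hf⟩) (C.cls q ⟨g, hg⟩) =
      C.cls n ⟨_, hφ.comp_mem_cocycle h hg⟩ :=
  Classical.choose_spec (C.exists_mul h _ _) f hf g hg φ hφ rfl rfl

/-- The Yoneda product as a bilinear map. -/
def mul (p q n : ℕ) (h : p + q = n) : H p →ₗ[k] H q →ₗ[k] H n :=
  LinearMap.mk₂ k (C.mulFun h)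
    (fun x x' y => by
      obtain ⟨f, hf, rfl⟩ := C.exists_rep x
      obtain ⟨f', hf', rfl⟩ := C.exists_rep x'
      obtain ⟨g, hg, rfl⟩ := C.exists_rep y
      obtain ⟨φ, hφ⟩ := exists_isLift hf
      obtain ⟨φ', hφ'⟩ := exists_isLift hf'
      have e : C.cls p ⟨f, hf⟩ + C.cls p ⟨f', hf'⟩ = C.cls p ⟨f + f', add_mem hf hf'⟩ :=
        (map_add _ _ _).symm
      rw [e, C.mulFun_cls h (add_mem hf hf') hg (hφ.add hφ'), C.mulFun_cls h hf hg hφ,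
        C.mulFun_cls h hf' hg hφ', ← map_add]
      congr 1
      ext x
      simp)
    (fun c x y => by
      obtain ⟨f, hf, rfl⟩ := C.exists_rep x
      obtain ⟨g, hg, rfl⟩ := C.exists_rep y
      obtain ⟨φ, hφ⟩ := exists_isLift hf
      have e : c • C.cls p ⟨f, hf⟩ = C.cls p ⟨c • f, Submodule.smul_mem _ c hf⟩ :=
        (map_smul _ _ _).symm
      rw [e, C.mulFun_cls h (Submodule.smul_mem _ c hf) hg (hφ.smul c), C.mulFun_cls h hf hg hφ,
        ← map_smul]
      congr 1
      ext x
      exact map_smul g c _)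
    (fun x y y' => by
      obtain ⟨f, hf, rfl⟩ := C.exists_rep x
      obtain ⟨g, hg, rfl⟩ := C.exists_rep y
      obtain ⟨g', hg', rfl⟩ := C.exists_rep y'
      obtain ⟨φ, hφ⟩ := exists_isLift hf
      have e : C.cls q ⟨g, hg⟩ + C.cls q ⟨g', hg'⟩ = C.cls q ⟨g + g', add_mem hg hg'⟩ :=
        (map_add _ _ _).symm
      rw [e, C.mulFun_cls h hf (add_mem hg hg') hφ, C.mulFun_cls h hf hg hφ,
        C.mulFun_cls h hf hg' hφ, ← map_add]
      rfl)
    (fun c x y => by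
      obtain ⟨f, hf, rfl⟩ := C.exists_rep x
      obtain ⟨g, hg, rfl⟩ := C.exists_rep y
      obtain ⟨φ, hφ⟩ := exists_isLift hf
      have e : c • C.cls q ⟨g, hg⟩ = C.cls q ⟨c • g, Submodule.smul_mem _ c hg⟩ :=
        (map_smul _ _ _).symm
      rw [e, C.mulFun_cls h hf (Submodule.smul_mem _ c hg) hφ, C.mulFun_cls h hf hg hφ, ← map_smul]
      rfl)

theorem mul_cls {p q n : ℕ} (h : p + q = n) {f : Q p →ₗ[k] k} (hf : f ∈ L.cocycle p)
    {g : Q q →ₗ[k] k} (hg : g ∈ L.cocycle q) {φ : ∀ j n, p + j = n → (Q n →ₗ[A] Q j)}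
    (hφ : L.IsLift f φ) : C.mul p q n h (C.cls p ⟨f, hf⟩) (C.cls q ⟨g, hg⟩) =
      C.cls n ⟨_, hφ.comp_mem_cocycle h hg⟩ :=
  C.mulFun_cls h hf hg hφ

/-- A cochain-level product given by a lift of a cocycle cohomologous to `f` computes the Yoneda
product. -/
theorem mul_cls_of_sub_mem {p q n : ℕ} (h : p + q = n) {f f' : Q p →ₗ[k] k} (hf : f ∈ L.cocycle p)
    (hff' : f' - f ∈ L.coboundary p)
    {g : Q q →ₗ[k] k} (hg : g ∈ L.cocycle q) {φ : ∀ j n, p + j = n → (Q n →ₗ[A] Q j)}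
    (hφ : L.IsLift f' φ) : C.mul p q n h (C.cls p ⟨f, hf⟩) (C.cls q ⟨g, hg⟩) =
      C.cls n ⟨_, hφ.comp_mem_cocycle h hg⟩ := by
  obtain ⟨φ', hφ'⟩ := exists_isLift hf
  rw [C.mul_cls h hf hg hφ']
  exact (C.cls_comp_eq h hg hg hφ hφ' hff' (by rw [sub_self]; exact zero_mem _)).symm

/-- The class of the augmentation. -/
def one : H 0 := C.cls 0 ⟨L.aug, aug_mem_cocycle⟩

theorem one_mul (n : ℕ) (x : H n) : C.mul 0 n n (zero_add n) C.one x = x := by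
  obtain ⟨f, hf, rfl⟩ := C.exists_rep x
  rw [one, C.mul_cls (zero_add n) aug_mem_cocycle hf isLift_aug]
  rfl

theorem mul_one (n : ℕ) (x : H n) : C.mul n 0 n (add_zero n) x C.one = x := by
  obtain ⟨f, hf, rfl⟩ := C.exists_rep x
  obtain ⟨φ, hφ⟩ := exists_isLift hf
  rw [one, C.mul_cls (add_zero n) hf aug_mem_cocycle hφ]
  congr 2
  ext x
  exact hφ.1 x

theorem mul_assoc (p q r s t n : ℕ) (h₁ : p + q = s) (h₂ : s + r = n) (h₃ : q + r = t)
    (h₄ : p + t = n) (x : H p) (y : H q) (z : H r) :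
    C.mul s r n h₂ (C.mul p q s h₁ x y) z = C.mul p t n h₄ x (C.mul q r t h₃ y z) := by
  obtain ⟨f, hf, rfl⟩ := C.exists_rep x
  obtain ⟨g, hg, rfl⟩ := C.exists_rep y
  obtain ⟨e, he, rfl⟩ := C.exists_rep z
  obtain ⟨φ, hφ⟩ := exists_isLift hf
  obtain ⟨ψ, hψ⟩ := exists_isLift hg
  subst h₃
  rw [C.mul_cls h₁ hf hg hφ, C.mul_cls rfl hg he hψ, C.mul_cls h₄ hf _ hφ,
    C.mul_cls h₂ _ he (hφ.trans h₁ hψ)]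
  rfl

end CohomologyModel

end YDLeftResolution

end LeftResolution

/-! ### The Yetter-Drinfeld structure on the cohomology -/

section Descend

variable {k : Type*} [Field k] {Z H W : Type*} [AddCommGroup Z] [Module k Z] [AddCommGroup H]
  [Module k H] [AddCommGroup W] [Module k W]

/-- The map induced on a quotient `p : Z → H` by a map that vanishes on the kernel of `p`. -/
def descend (p : Z →ₗ[k] H) (hp : Function.Surjective p) (F : Z →ₗ[k] W)
    (h : ∀ z, p z = 0 → F z = 0) : H →ₗ[k] W :=
  (LinearMap.ker p).liftQ F (fun z hz => h z hz) ∘ₗ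
    (p.quotKerEquivOfSurjective hp).symm.toLinearMap

theorem descend_apply (p : Z →ₗ[k] H) (hp : Function.Surjective p) (F : Z →ₗ[k] W)
    (h : ∀ z, p z = 0 → F z = 0) (z : Z) : descend p hp F h (p z) = F z := by
  have e : (p.quotKerEquivOfSurjective hp).symm (p z) = Submodule.Quotient.mk z := by
    rw [LinearEquiv.symm_apply_eq]
    rfl
  rw [descend, LinearMap.comp_apply, LinearEquiv.coe_coe, e]
  rfl

end Descend

section CohomologyYD

variable {k : Type*} [Field k] {G : Type*} [CommGroup G] [DecidableEq G]
  {A : Type*} [Ring A] [Algebra k A] [Coalgebra k A]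
  {B : YDBimonoid k G A}

section YDModule

variable {M : Type*} [AddCommGroup M] [Module k M] [Module A M] [IsScalarTower k A M]
  (X : YDModule B M)

theorem YDModule.act_inv_act (g : G) (x : M) : X.act g⁻¹ (X.act g x) = x := by
  rw [← Module.End.mul_apply, ← map_mul, inv_mul_cancel, map_one, Module.End.one_apply]

theorem YetterDrinfeld.act_mem_self {V : Type*} [AddCommGroup V] [Module k V]
    (Y : YetterDrinfeld k G V) (g : G) {s : G} {x : V} (hx : x ∈ Y.gr s) : Y.act g x ∈ Y.gr s := by
  have h := Y.act_mem g s x hx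
  rwa [mul_inv_cancel_comm] at h

theorem YDModule.gradedProj_smul {t : G} {a : A} (ha : a ∈ B.gr t) (s : G) (x : M) :
    gradedProj X.isInternal (t * s) (a • x) = a • gradedProj X.isInternal s x := by
  induction x using graded_induction X.isInternal with
  | hom u x hx =>
    rw [gradedProj_apply _ (X.smul_mem _ _ _ _ ha hx), gradedProj_apply _ hx]
    simp only [mul_right_inj]
    split_ifs <;> simp
  | h0 => simp
  | add x y hx hy => simp only [smul_add, map_add, hx, hy]

/-- The homogeneous linear forms of degree `h`: those that vanish in all degrees but `h⁻¹`. -/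
def homogeneousForms (gr : G → Submodule k M) (h : G) : Submodule k (M →ₗ[k] k) where
  carrier := {f | ∀ s, h * s ≠ 1 → ∀ x ∈ gr s, f x = 0}
  add_mem' hf hg s hs x hx := by rw [LinearMap.add_apply, hf s hs x hx, hg s hs x hx, add_zero]
  zero_mem' _ _ _ _ := rfl
  smul_mem' c f hf s hs x hx := by rw [LinearMap.smul_apply, hf s hs x hx, smul_zero]

/-- The component of degree `h` of a linear form. -/
def formProj (h : G) : (M →ₗ[k] k) →ₗ[k] M →ₗ[k] k :=
  LinearMap.lcomp k k (gradedProj X.isInternal h⁻¹)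

theorem formProj_apply_of_mem (h : G) (f : M →ₗ[k] k) {s : G} {x : M} (hx : x ∈ X.gr s) :
    formProj X h f x = if h * s = 1 then f x else 0 := by
  change f (gradedProj X.isInternal h⁻¹ x) = _
  rw [gradedProj_apply _ hx]
  simp only [mul_eq_one_iff_inv_eq, eq_comm (a := s)]
  split_ifs <;> simp

theorem formProj_mem (h : G) (f : M →ₗ[k] k) : formProj X h f ∈ homogeneousForms X.gr h :=
  fun s hs x hx => by rw [formProj_apply_of_mem X h f hx, if_neg hs]

theorem formProj_of_mem {h : G} {f : M →ₗ[k] k} (hf : f ∈ homogeneousForms X.gr h) :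
    formProj X h f = f :=
  graded_hom_ext X.isInternal fun s x hx => by
    rw [formProj_apply_of_mem X h f hx]
    split_ifs with hs
    · rfl
    · exact (hf s hs x hx).symm

theorem formProj_of_ne {h h' : G} (hne : h' ≠ h) {f : M →ₗ[k] k}
    (hf : f ∈ homogeneousForms X.gr h') : formProj X h f = 0 :=
  graded_hom_ext X.isInternal fun s x hx => by
    rw [formProj_apply_of_mem X h f hx]
    split_ifs with hs
    · exact hf s (fun hs' => hne (mul_right_cancel (hs'.trans hs.symm))) x hx
    · rfl

theorem formProj_mem_counitHoms (h : G) {f : M →ₗ[k] k} (hf : f ∈ counitHoms k A M) :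
    formProj X h f ∈ counitHoms k A M := fun a x => by
  induction a using graded_induction B.isInternal with
  | hom t a ha =>
    by_cases ht : t = 1
    · subst ht
      have := X.gradedProj_smul ha h⁻¹ x
      rw [one_mul] at this
      exact (congrArg f this).trans (hf a _)
    · have := X.gradedProj_smul ha (t⁻¹ * h⁻¹) x
      rw [mul_inv_cancel_left] at this
      refine (congrArg f this).trans ?_
      rw [hf a, B.counit_eq_zero t a ht ha, zero_mul, zero_mul]
  | h0 => simp
  | add a b ha hb => rw [add_smul, map_add, ha, hb, map_add, add_mul]

/-- A form on a finitely generated module which is `A`-linear with values in the trivial module has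
finitely many homogeneous components. -/
theorem exists_eq_sum_formProj [Module.Finite A M] {f : M →ₗ[k] k} (hf : f ∈ counitHoms k A M) :
    ∃ F : Finset G, f = ∑ h ∈ F, formProj X h f := by
  obtain ⟨S, hS⟩ := Module.Finite.fg_top (R := A) (M := M)
  choose F hF using exists_eq_sum_gradedProj X.isInternal
  let F' : Finset G := (S.biUnion F).image fun s => s⁻¹
  refine ⟨F', ?_⟩
  have hmem : ∑ h ∈ F', formProj X h f ∈ counitHoms k A M :=
    sum_mem fun h _ => formProj_mem_counitHoms X h hf
  ext x
  have hx : x ∈ Submodule.span A (S : Set M) := hS ▸ Submodule.mem_top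
  induction hx using Submodule.span_induction with
  | mem x hx =>
    conv_lhs => rw [hF x (S.biUnion F) (Finset.subset_biUnion_of_mem F hx), map_sum]
    rw [LinearMap.sum_apply, Finset.sum_image fun _ _ _ _ h => inv_injective h]
    refine Finset.sum_congr rfl fun s _ => ?_
    change _ = f (gradedProj X.isInternal s⁻¹⁻¹ x)
    rw [inv_inv]
  | zero => simp
  | add x y _ _ hx hy => rw [map_add, map_add, hx, hy]
  | smul a x _ hx => rw [hf, hmem, hx]

/-- The action of `g` on linear forms, `f ↦ f(g⁻¹ • -)`. -/
def formAct (g : G) : (M →ₗ[k] k) →ₗ[k] M →ₗ[k] k := LinearMap.lcomp k k (X.act g⁻¹)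

theorem formAct_apply (g : G) (f : M →ₗ[k] k) (x : M) : formAct X g f x = f (X.act g⁻¹ x) := rfl

theorem formAct_mem_counitHoms (g : G) {f : M →ₗ[k] k} (hf : f ∈ counitHoms k A M) :
    formAct X g f ∈ counitHoms k A M := fun a x => by
  rw [formAct_apply, X.act_smul, hf, B.counit_act, formAct_apply]

theorem formAct_mem_homogeneousForms (g : G) {h : G} {f : M →ₗ[k] k}
    (hf : f ∈ homogeneousForms X.gr h) : formAct X g f ∈ homogeneousForms X.gr h :=
  fun s hs _ hx => hf s hs _ (X.act_mem_self g⁻¹ hx)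

end YDModule

namespace YDLeftResolution

variable {Q : ℕ → Type*} [∀ n, AddCommGroup (Q n)]
  [∀ n, Module k (Q n)] [∀ n, Module A (Q n)] [∀ n, IsScalarTower k A (Q n)]
  {L : YDLeftResolution B Q}

theorem d_gradedProj (n : ℕ) (s : G) (x : Q (n + 1)) :
    L.d n (gradedProj (L.yd (n + 1)).isInternal s x) =
      gradedProj (L.yd n).isInternal s (L.d n x) := by
  induction x using graded_induction (L.yd (n + 1)).isInternal with
  | hom u x hx =>
    rw [gradedProj_apply _ hx, gradedProj_apply _ (L.d_mem n u x hx)]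
    split_ifs <;> simp
  | h0 => simp
  | add x y hx hy => simp only [map_add, hx, hy]

theorem aug_gradedProj (s : G) (x : Q 0) :
    L.aug (gradedProj (L.yd 0).isInternal s x) = if s = 1 then L.aug x else 0 := by
  induction x using graded_induction (L.yd 0).isInternal with
  | hom u x hx =>
    rw [gradedProj_apply _ hx]
    by_cases hu : u = 1
    · subst hu
      simp only [eq_comm (a := s)]
      split_ifs <;> simp
    · rw [L.aug_mem u hu x hx]
      split_ifs <;> simp [L.aug_mem u hu x hx]
  | h0 => simp
  | add x y hx hy =>
    simp only [map_add, hx, hy]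
    split_ifs <;> simp

/-- A homogeneous cocycle has a homogeneous lift: the component of suitable degree of any lift. -/
theorem exists_homogeneous_isLift {p : ℕ} {f : Q p →ₗ[k] k} (hf : f ∈ L.cocycle p) {b : G}
    (hb : f ∈ homogeneousForms (L.yd p).gr b) :
    ∃ φ : ∀ j n, p + j = n → (Q n →ₗ[A] Q j), L.IsLift f φ ∧
      ∀ j n h u, ∀ x ∈ (L.yd n).gr u, φ j n h x ∈ (L.yd j).gr (u * b) := by
  obtain ⟨φ, hφ⟩ := exists_isLift hf
  let ψ (j n : ℕ) (h : p + j = n) : Q n →ₗ[k] Q j :=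
    gradedLift (L.yd n).isInternal fun u =>
      gradedProj (L.yd j).isInternal (u * b) ∘ₗ (φ j n h).restrictScalars k
  have hψ (j n : ℕ) (h : p + j = n) (u : G) (x : Q n) (hx : x ∈ (L.yd n).gr u) :
      ψ j n h x = gradedProj (L.yd j).isInternal (u * b) (φ j n h x) :=
    gradedLift_apply _ _ hx
  let ψ' (j n : ℕ) (h : p + j = n) : Q n →ₗ[A] Q j :=
    { toFun := ψ j n h
      map_add' := map_add _
      map_smul' := fun a x => by
        rw [RingHom.id_apply]
        induction a using graded_induction B.isInternal with
        | hom t a ha =>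
          induction x using graded_induction (L.yd n).isInternal with
          | hom u x hx =>
            rw [hψ j n h _ _ ((L.yd n).smul_mem _ _ _ _ ha hx), hψ j n h _ _ hx, map_smul,
              _root_.mul_assoc, (L.yd j).gradedProj_smul ha]
          | h0 => simp
          | add x y hx hy => simp only [smul_add, map_add, hx, hy]
        | h0 => simp
        | add a c ha hc => simp only [add_smul, map_add, ha, hc] }
  refine ⟨ψ', ⟨fun x => ?_, fun j n h x => ?_⟩, fun j n h u x hx => ?_⟩
  · change L.aug (ψ 0 p rfl x) = f x
    induction x using graded_induction (L.yd p).isInternal with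
    | hom u x hx =>
      rw [hψ _ _ _ u x hx, aug_gradedProj, hφ.1, mul_comm]
      split_ifs with hu
      · rfl
      · exact (hb u hu x hx).symm
    | h0 => simp
    | add x y hx hy => simp only [map_add, hx, hy]
  · change L.d j (ψ (j + 1) (n + 1) _ x) = ψ j n h (L.d n x)
    induction x using graded_induction (L.yd (n + 1)).isInternal with
    | hom u x hx =>
      rw [hψ _ _ _ u x hx, hψ _ _ _ u _ (L.d_mem n u x hx), d_gradedProj, hφ.2 j n h]
    | h0 => simp
    | add x y hx hy => simp only [map_add, hx, hy]
  · change ψ j n h x ∈ _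
    rw [hψ j n h u x hx]
    exact gradedProj_mem _ _ _

/-- The conjugate by `g` of a lift of `f` is a lift of `g • f`. -/
theorem IsLift.act (g : G) {p : ℕ} {f : Q p →ₗ[k] k} {φ : ∀ j n, p + j = n → (Q n →ₗ[A] Q j)}
    (hφ : L.IsLift f φ) : ∃ ψ : ∀ j n, p + j = n → (Q n →ₗ[A] Q j),
      L.IsLift (formAct (L.yd p) g f) ψ ∧
        ∀ j n h x, ψ j n h x = (L.yd j).act g (φ j n h ((L.yd n).act g⁻¹ x)) := by
  refine ⟨fun j n h =>
    { toFun := fun x => (L.yd j).act g (φ j n h ((L.yd n).act g⁻¹ x))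
      map_add' := fun x y => by simp only [map_add]
      map_smul' := fun a x => by
        rw [(L.yd n).act_smul, map_smul, (L.yd j).act_smul, RingHom.id_apply]
        congr 1
        rw [← Module.End.mul_apply, ← map_mul, mul_inv_cancel, map_one, Module.End.one_apply] },
    ⟨fun x => ?_, fun j n h x => ?_⟩, fun _ _ _ _ => rfl⟩
  · exact (L.aug_act g _).trans (hφ.1 _)
  · change L.d j ((L.yd _).act g _) = (L.yd j).act g (φ j n h ((L.yd n).act g⁻¹ (L.d n x)))
    rw [L.d_act, hφ.2 j n h, L.d_act]

theorem formProj_mem_cocycle (h : G) {n : ℕ} {f : Q n →ₗ[k] k} (hf : f ∈ L.cocycle n) :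
    formProj (L.yd n) h f ∈ L.cocycle n := by
  rw [mem_cocycle] at hf ⊢
  refine ⟨formProj_mem_counitHoms _ h hf.1, fun x => ?_⟩
  change f (gradedProj _ _ _) = 0
  rw [← d_gradedProj, hf.2]

theorem formProj_mem_coboundary (h : G) {n : ℕ} {f : Q n →ₗ[k] k} (hf : f ∈ L.coboundary n) :
    formProj (L.yd n) h f ∈ L.coboundary n := by
  cases n with
  | zero =>
    have hf : f = 0 := hf
    simp [hf]
  | succ n =>
    obtain ⟨f', hf', rfl⟩ := hf
    refine ⟨formProj (L.yd n) h f', formProj_mem_counitHoms _ h hf', ?_⟩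
    ext x
    exact congrArg f' (d_gradedProj n h⁻¹ x).symm

theorem formAct_mem_cocycle (g : G) {n : ℕ} {f : Q n →ₗ[k] k} (hf : f ∈ L.cocycle n) :
    formAct (L.yd n) g f ∈ L.cocycle n := by
  rw [mem_cocycle] at hf ⊢
  refine ⟨formAct_mem_counitHoms _ g hf.1, fun x => ?_⟩
  rw [formAct_apply, ← L.d_act, hf.2]

theorem formAct_mem_coboundary (g : G) {n : ℕ} {f : Q n →ₗ[k] k} (hf : f ∈ L.coboundary n) :
    formAct (L.yd n) g f ∈ L.coboundary n := by
  cases n with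
  | zero =>
    have hf : f = 0 := hf
    simp [hf]
  | succ n =>
    obtain ⟨f', hf', rfl⟩ := hf
    refine ⟨formAct (L.yd n) g f', formAct_mem_counitHoms _ g hf', ?_⟩
    ext x
    exact congrArg f' (L.d_act n g⁻¹ x).symm

namespace CohomologyModel

variable {H : ℕ → Type*} [∀ n, AddCommGroup (H n)] [∀ n, Module k (H n)]
  (C : L.CohomologyModel H)

/-- The endomorphism of `H n` induced by an operation on cochains. -/
def induced {n : ℕ} (T : (Q n →ₗ[k] k) →ₗ[k] Q n →ₗ[k] k)
    (hT : ∀ f ∈ L.cocycle n, T f ∈ L.cocycle n) (hT' : ∀ f ∈ L.coboundary n, T f ∈ L.coboundary n) :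
    H n →ₗ[k] H n :=
  descend (k := k) (Z := L.cocycle n) (H := H n) (W := H n) (C.cls n) (C.surjective n)
    (C.cls n ∘ₗ T.restrict hT) fun z hz =>
      (C.cls_eq_zero_iff n _).2 (hT' z ((C.cls_eq_zero_iff n z).1 hz))

theorem induced_cls {n : ℕ} (T : (Q n →ₗ[k] k) →ₗ[k] Q n →ₗ[k] k)
    (hT : ∀ f ∈ L.cocycle n, T f ∈ L.cocycle n) (hT' : ∀ f ∈ L.coboundary n, T f ∈ L.coboundary n)
    {f : Q n →ₗ[k] k} (hf : f ∈ L.cocycle n) :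
    C.induced T hT hT' (C.cls n ⟨f, hf⟩) = C.cls n ⟨T f, hT f hf⟩ := by
  exact descend_apply (k := k) (Z := L.cocycle n) (H := H n) (W := H n) _ _ _ _ _

/-- The action of the group on the cohomology. -/
def act (n : ℕ) : Representation k G (H n) where
  toFun g := C.induced (formAct (L.yd n) g) (fun _ => formAct_mem_cocycle g)
    fun _ => formAct_mem_coboundary g
  map_one' := by
    ext x
    obtain ⟨f, hf, rfl⟩ := C.exists_rep x
    rw [induced_cls, Module.End.one_apply]
    congr 2
    ext x
    rw [formAct_apply, inv_one, map_one, Module.End.one_apply]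
  map_mul' g g' := by
    ext x
    obtain ⟨f, hf, rfl⟩ := C.exists_rep x
    rw [induced_cls, Module.End.mul_apply, induced_cls, induced_cls]
    congr 2
    ext x
    rw [formAct_apply, formAct_apply, formAct_apply, mul_inv_rev, map_mul, Module.End.mul_apply]

theorem act_cls {n : ℕ} (g : G) {f : Q n →ₗ[k] k} (hf : f ∈ L.cocycle n) :
    C.act n g (C.cls n ⟨f, hf⟩) = C.cls n ⟨_, formAct_mem_cocycle g hf⟩ :=
  C.induced_cls _ _ (fun _ => formAct_mem_coboundary g) hf

/-- The grading of the cohomology: classes of homogeneous cocycles. -/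
def gr (n : ℕ) (h : G) : Submodule k (H n) :=
  ((homogeneousForms (L.yd n).gr h).comap (L.cocycle n).subtype).map (C.cls n)

theorem mem_gr {n : ℕ} {h : G} {x : H n} : x ∈ C.gr n h ↔ ∃ f, ∃ hf : f ∈ L.cocycle n,
    f ∈ homogeneousForms (L.yd n).gr h ∧ C.cls n ⟨f, hf⟩ = x :=
  ⟨fun ⟨⟨f, hf⟩, hh, e⟩ => ⟨f, hf, hh, e⟩, fun ⟨f, hf, hh, e⟩ => ⟨⟨f, hf⟩, hh, e⟩⟩

/-- The components span because the homogeneous components of a cocycle are cocycles, finite in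
number; they are independent because taking components preserves coboundaries. -/
theorem gr_isInternal (n : ℕ) : DirectSum.IsInternal (C.gr n) := by
  refine isInternal_of_proj ?_ (fun h => C.induced (formProj (L.yd n) h)
    (fun _ => formProj_mem_cocycle h) fun _ => formProj_mem_coboundary h) ?_ ?_
  · rw [eq_top_iff]
    rintro x -
    obtain ⟨f, hf, rfl⟩ := C.exists_rep x
    have := L.finite
    obtain ⟨F, hF⟩ := exists_eq_sum_formProj (L.yd n) ((mem_cocycle _).1 hf).1
    have e : (⟨f, hf⟩ : L.cocycle n) =
        ∑ h ∈ F, ⟨formProj (L.yd n) h f, formProj_mem_cocycle h hf⟩ := by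
      apply Subtype.ext
      rw [AddSubmonoidClass.coe_finsetSum]
      exact hF
    rw [e, map_sum]
    exact sum_mem fun h _ => Submodule.mem_iSup_of_mem h
      (C.mem_gr.2 ⟨_, _, formProj_mem _ h f, rfl⟩)
  · intro h x hx
    obtain ⟨f, hf, hh, rfl⟩ := C.mem_gr.1 hx
    rw [induced_cls]
    congr 2
    exact formProj_of_mem _ hh
  · intro h h' hne x hx
    obtain ⟨f, hf, hh, rfl⟩ := C.mem_gr.1 hx
    rw [induced_cls, cls_eq_zero_iff]
    change formProj (L.yd n) h f ∈ L.coboundary n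
    exact (formProj_of_ne (L.yd n) hne hh).symm ▸ (L.coboundary n).zero_mem

/-- The Yetter-Drinfeld structure on the cohomology. -/
def yd (n : ℕ) : YetterDrinfeld k G (H n) where
  act := C.act n
  gr := C.gr n
  isInternal := C.gr_isInternal n
  act_mem g h x hx := by
    obtain ⟨f, hf, hh, rfl⟩ := C.mem_gr.1 hx
    rw [act_cls, mul_inv_cancel_comm]
    exact C.mem_gr.2 ⟨_, _, formAct_mem_homogeneousForms _ g hh, rfl⟩

theorem one_mem : C.one ∈ C.gr 0 1 :=
  C.mem_gr.2 ⟨L.aug, aug_mem_cocycle, fun s hs =>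
    L.aug_mem s (by rwa [_root_.one_mul] at hs), rfl⟩

theorem act_one (g : G) : C.act 0 g C.one = C.one := by
  rw [one, act_cls]
  congr 2
  ext x
  exact L.aug_act g⁻¹ x

theorem mul_mem (p q n : ℕ) (h : p + q = n) (s t : G) (x : H p) (y : H q) (hx : x ∈ C.gr p s)
    (hy : y ∈ C.gr q t) : C.mul p q n h x y ∈ C.gr n (s * t) := by
  obtain ⟨f, hf, hs, rfl⟩ := C.mem_gr.1 hx
  obtain ⟨g, hg, ht, rfl⟩ := C.mem_gr.1 hy
  obtain ⟨φ, hφ, hφs⟩ := exists_homogeneous_isLift hf hs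
  rw [C.mul_cls h hf hg hφ]
  refine C.mem_gr.2 ⟨_, _, fun u hu x hx => ht _ ?_ _ (hφs q n h u x hx), rfl⟩
  rwa [mul_comm t, _root_.mul_assoc, mul_comm u]

theorem act_mul (p q n : ℕ) (h : p + q = n) (g : G) (x : H p) (y : H q) :
    C.act n g (C.mul p q n h x y) = C.mul p q n h (C.act p g x) (C.act q g y) := by
  obtain ⟨f, hf, rfl⟩ := C.exists_rep x
  obtain ⟨f', hf', rfl⟩ := C.exists_rep y
  obtain ⟨φ, hφ⟩ := exists_isLift hf
  obtain ⟨ψ, hψ, e⟩ := hφ.act g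
  rw [C.mul_cls h hf hf' hφ, act_cls, act_cls, act_cls,
    C.mul_cls h (formAct_mem_cocycle g hf) (formAct_mem_cocycle g hf') hψ]
  congr 2
  ext x
  rw [LinearMap.comp_apply, formAct_apply, formAct_apply, LinearMap.restrictScalars_apply, e,
    YDModule.act_inv_act]
  rfl

end CohomologyModel

end YDLeftResolution

end CohomologyYD

/-! ### Braided commutativity -/

section BraidedCommutativity

variable {k : Type*} [Field k] {G : Type*} [CommGroup G] [DecidableEq G]
  {A : Type*} [Ring A] [Algebra k A] [Coalgebra k A]
  {B : YDBimonoid k G A}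

theorem diag_induction {M : Type*} [AddCommGroup M] [Module k M] [Module A M]
    {X : YDModule B M} {N : Type*} [AddCommGroup N] [Module k N] {p : DiagTensor X N → Prop}
    (z : DiagTensor X N) (h0 : p 0) (tmul : ∀ (m : M) (n : N), p (m ⊗ₜ[k] n : M ⊗[k] N))
    (add : ∀ z z', p z → p z' → p (z + z')) : p z :=
  TensorProduct.induction_on (motive := p) z h0 tmul add

theorem diag_graded_induction {M : Type*} [AddCommGroup M] [Module k M] [Module A M]
    {X : YDModule B M} {N : Type*} [AddCommGroup N] [Module k N]
    {gr : G → Submodule k N} (hgr : DirectSum.IsInternal gr) {p : DiagTensor X N → Prop}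
    (z : DiagTensor X N) (h0 : p 0)
    (tmul : ∀ (m : M) (s : G), ∀ n ∈ gr s, p (m ⊗ₜ[k] n : M ⊗[k] N))
    (add : ∀ z z', p z → p z' → p (z + z')) : p z :=
  tensor_graded_induction (p := p) hgr z h0 tmul add

section DiagonalForms

variable {M : Type*} [AddCommGroup M] [Module k M] [Module A M] [IsScalarTower k A M]
  (X : YDModule B M) {N : Type*} [AddCommGroup N] [Module k N] [Module A N] [IsScalarTower k A N]
  (Y : YDModule B N)

/-- The `A`-linear map `m ⊗ n ↦ u(n) m`. -/
def diagRightForm (u : N →ₗ[k] k) (hu : u ∈ counitHoms k A N) : DiagTensor X N →ₗ[A] M :=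
  diagHomLeft X ((TensorProduct.rid k M).toLinearMap ∘ₗ LinearMap.lTensor M u) fun a g b hb m n => by
    have h : u (b • n) = Coalgebra.counit (R := k) b * u n := hu b n
    by_cases hg : g = 1
    · subst hg
      change u (b • n) • a • X.act 1 m = Coalgebra.counit (R := k) b • a • u n • m
      rw [h, map_one, Module.End.one_apply, mul_smul, smul_algebra_smul_comm (u n) a m]
    · simp [h, B.counit_eq_zero g b hg hb]

theorem diagRightForm_tmul (u : N →ₗ[k] k) (hu : u ∈ counitHoms k A N) (m : M) (n : N) :
    diagRightForm X u hu (m ⊗ₜ[k] n : M ⊗[k] N) = u n • m := rfl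

/-- The `A`-linear map `m ⊗ n ↦ u(m) n`, for `u` invariant under the group. -/
def diagLeftForm (u : M →ₗ[k] k) (hu : u ∈ counitHoms k A M) (hu' : ∀ g m, u (X.act g m) = u m) :
    DiagTensor X N →ₗ[A] N :=
  diagHomRight X ((TensorProduct.lid k N).toLinearMap ∘ₗ LinearMap.rTensor N u) fun a g b hb m n => by
    have h : u (a • X.act g m) = Coalgebra.counit (R := k) a * u m := (hu a _).trans (by rw [hu'])
    change u (a • X.act g m) • b • n = Coalgebra.counit (R := k) a • b • u m • n
    rw [h, mul_smul, smul_algebra_smul_comm (u m) b n]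

theorem diagLeftForm_tmul (u : M →ₗ[k] k) (hu : u ∈ counitHoms k A M)
    (hu' : ∀ g m, u (X.act g m) = u m) (m : M) (n : N) :
    diagLeftForm X u hu hu' (m ⊗ₜ[k] n : M ⊗[k] N) = u m • n := rfl

/-- The linear map `m ⊗ n ↦ u(s⁻¹ • m) n` for `n` of degree `s`. -/
def twistedFormLinear (u : M →ₗ[k] k) : M ⊗[k] N →ₗ[k] N :=
  TensorProduct.lift (gradedLift Y.isInternal fun s =>
    LinearMap.lcomp k N (formAct X s u) ∘ₗ (LinearMap.lsmul k N).flip).flip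

theorem twistedFormLinear_tmul (u : M →ₗ[k] k) (m : M) {s : G} {n : N} (hn : n ∈ Y.gr s) :
    twistedFormLinear X Y u (m ⊗ₜ[k] n) = u (X.act s⁻¹ m) • n := by
  rw [twistedFormLinear, TensorProduct.lift.tmul, LinearMap.flip_apply, gradedLift_apply _ _ hn]
  rfl

/-- The `A`-linear map `m ⊗ n ↦ u(s⁻¹ • m) n` for `n` of degree `s`. The map `m ⊗ n ↦ u(m) n` is
not `A`-linear in general; the twist by the degree of `n` compensates for the braiding in the
diagonal action. -/
def twistedForm (u : M →ₗ[k] k) (hu : u ∈ counitHoms k A M) : DiagTensor X N →ₗ[A] N :=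
  diagHomRight X (twistedFormLinear X Y u) fun a g b hb m n => by
    induction n using graded_induction Y.isInternal with
    | hom s n hn =>
      have h : u (X.act (g * s)⁻¹ (a • X.act g m)) =
          Coalgebra.counit (R := k) a * u (X.act s⁻¹ m) := by
        rw [X.act_smul, hu, B.counit_act, ← Module.End.mul_apply, ← map_mul, mul_inv_rev,
          inv_mul_cancel_right]
      rw [twistedFormLinear_tmul X Y u _ (Y.smul_mem _ _ _ _ hb hn), twistedFormLinear_tmul X Y u _ hn,
        h, mul_smul, smul_algebra_smul_comm _ b n]
    | h0 => simp
    | add n n' hn hn' => simp only [smul_add, TensorProduct.tmul_add, map_add, hn, hn']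

theorem twistedForm_tmul (u : M →ₗ[k] k) (hu : u ∈ counitHoms k A M) (m : M) {s : G} {n : N}
    (hn : n ∈ Y.gr s) :
    twistedForm X Y u hu (m ⊗ₜ[k] n : M ⊗[k] N) = u (X.act s⁻¹ m) • n :=
  twistedFormLinear_tmul X Y u m hn

theorem diagMap_tmul {M' : Type*} [AddCommGroup M'] [Module k M'] [Module A M']
    [IsScalarTower k A M'] (X' : YDModule B M') {N' : Type*} [AddCommGroup N'] [Module k N']
    [Module A N'] [IsScalarTower k A N'] (φ : M →ₗ[A] M')
    (hφ : ∀ g m, φ (X.act g m) = X'.act g (φ m)) (ψ : N →ₗ[A] N') (m : M) (n : N) :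
    diagMap X X' φ hφ ψ (m ⊗ₜ[k] n : M ⊗[k] N) = (φ m ⊗ₜ[k] ψ n : M' ⊗[k] N') := rfl

end DiagonalForms

namespace YDLeftResolution

variable {Q : ℕ → Type*} [∀ n, AddCommGroup (Q n)]
  [∀ n, Module k (Q n)] [∀ n, Module A (Q n)] [∀ n, IsScalarTower k A (Q n)]
  (L : YDLeftResolution B Q)

/-- The differential `d ⊗ 1` of `Q ⊗ Q`. -/
def dLeft (p q : ℕ) : DiagTensor (L.yd (p + 1)) (Q q) →ₗ[A] DiagTensor (L.yd p) (Q q) :=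
  diagMap _ _ (L.d p) (L.d_act p) LinearMap.id

/-- The differential `1 ⊗ d` of `Q ⊗ Q`, without sign. -/
def dRight (p q : ℕ) : DiagTensor (L.yd p) (Q (q + 1)) →ₗ[A] DiagTensor (L.yd p) (Q q) :=
  diagMap _ _ LinearMap.id (fun _ _ => rfl) (L.d q)

/-- The map `aug ⊗ 1 : Q₀ ⊗ Q_q → Q_q`. -/
def augLeft (q : ℕ) : DiagTensor (L.yd 0) (Q q) →ₗ[A] Q q :=
  diagLeftForm (L.yd 0) L.aug L.aug_smul L.aug_act

/-- A diagonal `Q → Q ⊗ Q` over the identity of `k`, for the diagonal action of `A` on `Q ⊗ Q`. -/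
theorem exists_diagonal : ∃ ω : ∀ p q n : ℕ, Q n →ₗ[A] DiagTensor (L.yd p) (Q q),
    (∀ x, L.aug (L.augLeft 0 (ω 0 0 0 x)) = L.aug x) ∧
    ∀ p q n x, ω p q n (L.d n x) = L.dLeft p q (ω (p + 1) q (n + 1) x) +
      (-1 : k) ^ p • L.dRight p q (ω p (q + 1) (n + 1) x) := by
  have := L.projective
  obtain ⟨φ₀, hφ₀⟩ := exists_lift_counit B L.aug_smul
    (comp_mem_counitHoms L.aug_smul (L.augLeft 0)) (fun c => by
      refine ⟨((c • L.base) ⊗ₜ[k] L.base : Q 0 ⊗[k] Q 0), ?_⟩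
      change L.aug (L.aug (c • L.base) • L.base) = c
      simp [L.aug_base])
  have hφ₀' (x : Q 0) : L.aug (L.augLeft 0 (φ₀ x)) = L.aug x := hφ₀ x
  let σ (q : ℕ) : Q q →+ DiagTensor (L.yd 0) (Q q) :=
    (TensorProduct.mk k (Q 0) (Q q) L.base).toAddMonoidHom
  let s (p q : ℕ) : DiagTensor (L.yd p) (Q q) →+ DiagTensor (L.yd (p + 1)) (Q q) :=
    (LinearMap.rTensor (Q q) (L.htpy p)).toAddMonoidHom
  have hs (p q : ℕ) (m : Q p) (n : Q q) : s p q (m ⊗ₜ[k] n : Q p ⊗[k] Q q) =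
      (L.htpy p m ⊗ₜ[k] n : Q (p + 1) ⊗[k] Q q) := rfl
  have hL (p q : ℕ) (m : Q (p + 1)) (n : Q q) : L.dLeft p q (m ⊗ₜ[k] n : Q (p + 1) ⊗[k] Q q) =
      (L.d p m ⊗ₜ[k] n : Q p ⊗[k] Q q) := rfl
  have hR (p q : ℕ) (m : Q p) (n : Q (q + 1)) : L.dRight p q (m ⊗ₜ[k] n : Q p ⊗[k] Q (q + 1)) =
      (m ⊗ₜ[k] L.d q n : Q p ⊗[k] Q q) := rfl
  have hA (q : ℕ) (m : Q 0) (n : Q q) : L.augLeft q (m ⊗ₜ[k] n : Q 0 ⊗[k] Q q) =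
      L.aug m • n := rfl
  have hs' (p q : ℕ) (c : k) (x : DiagTensor (L.yd p) (Q q)) : s p q (c • x) = c • s p q x :=
    (LinearMap.rTensor (Q q) (L.htpy p)).map_smul c x
  obtain ⟨ω, h0, h⟩ := exists_chainMap_total (R := A)
    (M := fun p q => DiagTensor (L.yd p) (Q q)) (N := Q) L.d L.d_d L.dLeft
    (fun p q => (-1 : k) ^ p • L.dRight p q) (fun q => (L.d q).toAddMonoidHom)
    (fun q => (L.augLeft q).toAddMonoidHom) σ s
    (fun q x => by
      change L.augLeft q (L.dLeft 0 q x) = 0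
      induction x using diag_induction with
      | h0 => simp
      | tmul m n => rw [hL, hA, L.aug_d, zero_smul]
      | add x y hx hy => rw [map_add, map_add, hx, hy, add_zero])
    (fun q x => by
      change L.augLeft q ((-1 : k) ^ 0 • L.dRight 0 q x) = L.d q (L.augLeft (q + 1) x)
      rw [pow_zero, one_smul]
      induction x using diag_induction with
      | h0 => simp
      | tmul m n => rw [hR, hA, hA, LinearMap.map_smul_of_tower]
      | add x y hx hy => simp only [map_add, hx, hy])
    (fun q x => by
      change (-1 : k) ^ 0 • L.dRight 0 q (σ (q + 1) x) = _
      rw [pow_zero, one_smul]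
      rfl)
    (fun p q x => by
      change (-1 : k) ^ (p + 1) • L.dRight (p + 1) q (s p (q + 1) x) =
        -s p q ((-1 : k) ^ p • L.dRight p q x)
      rw [hs', pow_succ, mul_neg_one, neg_smul]
      congr 2
      induction x using diag_induction with
      | h0 => simp
      | tmul m n => rw [hs, hR, hR, hs]
      | add x y hx hy => simp only [map_add, hx, hy])
    (fun q x => by
      change L.dLeft 0 q (s 0 q x) = x - σ q (L.augLeft q x)
      induction x using diag_induction with
      | h0 => simp
      | tmul m n =>
        rw [hs, hL, hA, L.d_htpy_zero]
        change _ = _ - L.base ⊗ₜ[k] (L.aug m • n)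
        rw [TensorProduct.sub_tmul, TensorProduct.smul_tmul]
      | add x y hx hy =>
        simp only [map_add, hx, hy]
        abel)
    (fun p q x => by
      induction x using diag_induction with
      | h0 => simp
      | tmul m n =>
        rw [hs, hL, hL, hs, L.d_htpy_succ]
        exact TensorProduct.sub_tmul _ _ _
      | add x y hx hy =>
        simp only [map_add, hx, hy]
        abel)
    L.exists_d_eq φ₀
    (fun x => L.exists_d_eq_zero _ ((hφ₀' _).trans (L.aug_d x)))
  exact ⟨ω, fun x => by rw [h0]; exact hφ₀' x, h⟩

variable {L}

/-- A chain map over the identity of `k` acts trivially on cohomology. -/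
theorem IsLift.comp_sub_mem_coboundary {ψ : ∀ j n, 0 + j = n → (Q n →ₗ[A] Q j)}
    (hψ : L.IsLift L.aug ψ) {p : ℕ} {u : Q p →ₗ[k] k} (hu : u ∈ L.cocycle p) :
    u ∘ₗ (ψ p p (zero_add p)).restrictScalars k - u ∈ L.coboundary p := by
  have h := (hψ.sub isLift_aug).comp_mem_coboundary (by rw [sub_self]; exact zero_mem _)
    (zero_add p) hu
  convert h using 1
  ext x
  simp

/-- The evaluation of a cocycle `u` on the right-hand factor of `Q ⊗ Q`, applied to a diagonal, is a
lift of a cocycle cohomologous to `u`. -/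
theorem exists_isLift_right {ω : ∀ p q n : ℕ, Q n →ₗ[A] DiagTensor (L.yd p) (Q q)}
    (h₀ : ∀ x, L.aug (L.augLeft 0 (ω 0 0 0 x)) = L.aug x)
    (hω : ∀ p q n x, ω p q n (L.d n x) = L.dLeft p q (ω (p + 1) q (n + 1) x) +
      (-1 : k) ^ p • L.dRight p q (ω p (q + 1) (n + 1) x))
    {p : ℕ} {u : Q p →ₗ[k] k} (hu : u ∈ L.cocycle p) :
    ∃ u', u' - u ∈ L.coboundary p ∧ L.IsLift u' fun j n (_ : p + j = n) =>
      diagRightForm (L.yd j) u ((mem_cocycle _).1 hu).1 ∘ₗ ω j p n := by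
  have hu₁ := ((mem_cocycle _).1 hu).1
  have hu₂ := ((mem_cocycle _).1 hu).2
  have hψ : L.IsLift L.aug fun j n (_ : 0 + j = n) => L.augLeft j ∘ₗ ω 0 j n := by
    refine ⟨h₀, fun j n h x => ?_⟩
    rw [LinearMap.comp_apply, LinearMap.comp_apply, hω, pow_zero, one_smul, map_add]
    have h1 (z : DiagTensor (L.yd 1) (Q j)) : L.augLeft j (L.dLeft 0 j z) = 0 := by
      induction z using diag_induction with
      | h0 => simp
      | tmul m n => rw [dLeft, diagMap_tmul, augLeft, diagLeftForm_tmul, L.aug_d, zero_smul]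
      | add x y hx hy => rw [map_add, map_add, hx, hy, add_zero]
    have h2 (z : DiagTensor (L.yd 0) (Q (j + 1))) :
        L.augLeft j (L.dRight 0 j z) = L.d j (L.augLeft (j + 1) z) := by
      induction z using diag_induction with
      | h0 => simp
      | tmul m n =>
        rw [dRight, diagMap_tmul, augLeft, augLeft, diagLeftForm_tmul, diagLeftForm_tmul,
          LinearMap.map_smul_of_tower]
        rfl
      | add x y hx hy => simp only [map_add, hx, hy]
    rw [h1, h2, zero_add]
  refine ⟨_, hψ.comp_sub_mem_coboundary hu, fun x => ?_, fun j n h x => ?_⟩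
  · change L.aug (diagRightForm (L.yd 0) u hu₁ (ω 0 p p x)) = u (L.augLeft p (ω 0 p p x))
    generalize ω 0 p p x = z
    induction z using diag_induction with
    | h0 => simp
    | tmul m n =>
      rw [diagRightForm_tmul, augLeft, diagLeftForm_tmul, map_smul, map_smul, smul_eq_mul,
        smul_eq_mul, mul_comm]
    | add x y hx hy => simp only [map_add, hx, hy]
  · rw [LinearMap.comp_apply, LinearMap.comp_apply, hω, map_add, LinearMap.map_smul_of_tower]
    have h1 (z : DiagTensor (L.yd (j + 1)) (Q p)) :
        diagRightForm (L.yd j) u hu₁ (L.dLeft j p z) =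
          L.d j (diagRightForm (L.yd (j + 1)) u hu₁ z) := by
      induction z using diag_induction with
      | h0 => simp
      | tmul m n =>
        rw [dLeft, diagMap_tmul, diagRightForm_tmul, diagRightForm_tmul,
          LinearMap.map_smul_of_tower]
        rfl
      | add x y hx hy => simp only [map_add, hx, hy]
    have h2 (z : DiagTensor (L.yd j) (Q (p + 1))) :
        diagRightForm (L.yd j) u hu₁ (L.dRight j p z) = 0 := by
      induction z using diag_induction with
      | h0 => simp
      | tmul m n => rw [dRight, diagMap_tmul, diagRightForm_tmul, hu₂, zero_smul]
      | add x y hx hy => rw [map_add, map_add, hx, hy, add_zero]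
    rw [h1, h2, smul_zero, add_zero]

/-- The twisted evaluation of a cocycle `u` on the left-hand factor of `Q ⊗ Q`, applied to a
diagonal, is up to sign a lift of a cocycle cohomologous to `u`. The sign arises from commuting the
differential past a factor of degree `p`. -/
theorem exists_isLift_left {ω : ∀ p q n : ℕ, Q n →ₗ[A] DiagTensor (L.yd p) (Q q)}
    (h₀ : ∀ x, L.aug (L.augLeft 0 (ω 0 0 0 x)) = L.aug x)
    (hω : ∀ p q n x, ω p q n (L.d n x) = L.dLeft p q (ω (p + 1) q (n + 1) x) +
      (-1 : k) ^ p • L.dRight p q (ω p (q + 1) (n + 1) x))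
    {p : ℕ} {u : Q p →ₗ[k] k} (hu : u ∈ L.cocycle p) :
    ∃ u', u' - u ∈ L.coboundary p ∧ L.IsLift u' fun j n (_ : p + j = n) =>
      (-1 : k) ^ (p * j) • (twistedForm (L.yd p) (L.yd j) u ((mem_cocycle _).1 hu).1 ∘ₗ ω p j n) := by
  have hu₁ := ((mem_cocycle _).1 hu).1
  have hu₂ := ((mem_cocycle _).1 hu).2
  have hψ : L.IsLift L.aug fun j n (_ : 0 + j = n) =>
      diagRightForm (L.yd j) L.aug L.aug_smul ∘ₗ ω j 0 n := by
    refine ⟨fun x => ?_, fun j n h x => ?_⟩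
    · rw [← h₀ x, LinearMap.comp_apply]
      generalize ω 0 0 0 x = z
      induction z using diag_induction with
      | h0 => simp
      | tmul m n =>
        rw [diagRightForm_tmul, augLeft, diagLeftForm_tmul, map_smul, map_smul, smul_eq_mul,
          smul_eq_mul, mul_comm]
      | add x y hx hy => simp only [map_add, hx, hy]
    · rw [LinearMap.comp_apply, LinearMap.comp_apply, hω, map_add, LinearMap.map_smul_of_tower]
      have h1 (z : DiagTensor (L.yd (j + 1)) (Q 0)) :
          diagRightForm (L.yd j) L.aug L.aug_smul (L.dLeft j 0 z) =
            L.d j (diagRightForm (L.yd (j + 1)) L.aug L.aug_smul z) := by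
        induction z using diag_induction with
        | h0 => simp
        | tmul m n =>
          rw [dLeft, diagMap_tmul, diagRightForm_tmul, diagRightForm_tmul,
            LinearMap.map_smul_of_tower]
          rfl
        | add x y hx hy => simp only [map_add, hx, hy]
      have h2 (z : DiagTensor (L.yd j) (Q 1)) :
          diagRightForm (L.yd j) L.aug L.aug_smul (L.dRight j 0 z) = 0 := by
        induction z using diag_induction with
        | h0 => simp
        | tmul m n => rw [dRight, diagMap_tmul, diagRightForm_tmul, L.aug_d, zero_smul]
        | add x y hx hy => rw [map_add, map_add, hx, hy, add_zero]
      rw [h1, h2, smul_zero, add_zero]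
  refine ⟨_, hψ.comp_sub_mem_coboundary hu, fun x => ?_, fun j n h x => ?_⟩
  · change L.aug ((-1 : k) ^ (p * 0) • twistedForm (L.yd p) (L.yd 0) u hu₁ (ω p 0 p x)) =
      u (diagRightForm (L.yd p) L.aug L.aug_smul (ω p 0 p x))
    rw [mul_zero, pow_zero, one_smul]
    generalize ω p 0 p x = z
    induction z using diag_graded_induction (L.yd 0).isInternal with
    | h0 => simp
    | tmul m s n hn =>
      rw [diagRightForm_tmul, twistedForm_tmul _ _ _ _ _ hn, map_smul, map_smul, smul_eq_mul,
        smul_eq_mul, mul_comm]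
      by_cases hs : s = 1
      · rw [hs, inv_one, map_one, Module.End.one_apply]
      · rw [L.aug_mem s hs n hn, zero_mul, zero_mul]
    | add x y hx hy => simp only [map_add, hx, hy]
  · rw [LinearMap.smul_apply, LinearMap.smul_apply, LinearMap.comp_apply, LinearMap.comp_apply, hω,
      map_add, LinearMap.map_smul_of_tower, LinearMap.map_smul_of_tower]
    have h1 (z : DiagTensor (L.yd (p + 1)) (Q j)) :
        twistedForm (L.yd p) (L.yd j) u hu₁ (L.dLeft p j z) = 0 := by
      induction z using diag_graded_induction (L.yd j).isInternal with
      | h0 => simp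
      | tmul m s n hn =>
        rw [dLeft, diagMap_tmul, LinearMap.id_apply, twistedForm_tmul _ _ _ _ _ hn, ← L.d_act, hu₂,
          zero_smul]
      | add x y hx hy => rw [map_add, map_add, hx, hy, add_zero]
    have h2 (z : DiagTensor (L.yd p) (Q (j + 1))) :
        twistedForm (L.yd p) (L.yd j) u hu₁ (L.dRight p j z) =
          L.d j (twistedForm (L.yd p) (L.yd (j + 1)) u hu₁ z) := by
      induction z using diag_graded_induction (L.yd (j + 1)).isInternal with
      | h0 => simp
      | tmul m s n hn =>
        rw [dRight, diagMap_tmul, LinearMap.id_apply, twistedForm_tmul _ _ _ _ _ hn,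
          twistedForm_tmul _ _ _ _ _ (L.d_mem _ _ _ hn), LinearMap.map_smul_of_tower]
      | add x y hx hy => simp only [map_add, hx, hy]
    rw [h1, h2, zero_add, smul_smul, Nat.mul_succ, pow_add]

namespace CohomologyModel

variable {H : ℕ → Type*} [∀ n, AddCommGroup (H n)] [∀ n, Module k (H n)]
  (C : L.CohomologyModel H)

/-- Both products are represented by the same cochain on `Q ⊗ Q`, pulled back along a diagonal: the
left-hand one by the lift of `x` given by twisted evaluation on the left-hand factor, the right-hand
one by the lift of `y` given by evaluation on the right-hand factor. -/
theorem mul_comm_of_mem_gr (p q n : ℕ) (h : p + q = n) (h' : q + p = n) (b : G) (x : H p) (y : H q)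
    (hy : y ∈ C.gr q b) :
    C.mul p q n h x y = (-1 : k) ^ (p * q) • C.mul q p n h' y (C.act p b⁻¹ x) := by
  obtain ⟨u, hu, rfl⟩ := C.exists_rep x
  obtain ⟨v, hv, hvb, rfl⟩ := C.mem_gr.1 hy
  obtain ⟨ω, h₀, hω⟩ := L.exists_diagonal
  obtain ⟨u', hu', hφ⟩ := exists_isLift_left h₀ hω hu
  obtain ⟨v', hv', hψ⟩ := exists_isLift_right h₀ hω hv
  have hu₁ := ((mem_cocycle _).1 hu).1
  have hv₁ := ((mem_cocycle _).1 hv).1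
  rw [act_cls, C.mul_cls_of_sub_mem h hu hu' hv hφ,
    C.mul_cls_of_sub_mem h' hv hv' (formAct_mem_cocycle b⁻¹ hu) hψ, ← map_smul]
  congr 2
  ext x
  change v ((-1 : k) ^ (p * q) • twistedForm (L.yd p) (L.yd q) u hu₁ (ω p q n x)) =
    (-1 : k) ^ (p * q) • formAct (L.yd p) b⁻¹ u (diagRightForm (L.yd p) v hv₁ (ω p q n x))
  rw [map_smul]
  congr 1
  generalize ω p q n x = z
  induction z using diag_graded_induction (L.yd q).isInternal with
  | h0 => simp
  | tmul m s n hn =>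
    rw [twistedForm_tmul _ _ _ _ _ hn, diagRightForm_tmul, map_smul, map_smul, formAct_apply,
      inv_inv, smul_eq_mul, smul_eq_mul, mul_comm]
    -- `v` vanishes on `n` unless `s = b⁻¹`, and then the twist by `s⁻¹` is the action of `b`.
    by_cases hs : b * s = 1
    · rw [eq_inv_of_mul_eq_one_left hs]
    · rw [hvb s hs n hn, zero_mul, zero_mul]
  | add x y hx hy => simp only [map_add, hx, hy]

/-- The cohomology of `Hom_A(Q, k)`, as a graded braided commutative algebra. -/
def algebra : GradedBraidedCommAlgebra k G H where
  yd := C.yd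
  one := C.one
  mul := C.mul
  one_mem := C.one_mem
  act_one := C.act_one
  mul_mem := C.mul_mem
  act_mul := C.act_mul
  one_mul := C.one_mul
  mul_one := C.mul_one
  mul_assoc := C.mul_assoc
  braided_comm p q n h h' x y := by
    induction x using graded_induction (C.yd p).isInternal with
    | hom a x hx =>
      rw [YetterDrinfeld.braiding_tmul _ _ a x hx, TensorProduct.lift.tmul]
      change (-1 : k) ^ (p * q) • C.mul q p n h' (C.act q a y) x = C.mul p q n h x y
      rw [C.mul_comm_of_mem_gr q p n h' h a _ x hx, smul_smul, mul_comm q p, ← mul_pow,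
        ← Module.End.mul_apply, ← map_mul]
      simp
    | h0 => simp
    | add x x' hx hx' =>
      simp only [TensorProduct.add_tmul, map_add, smul_add, LinearMap.add_apply, hx, hx']

end CohomologyModel

end YDLeftResolution

end BraidedCommutativity

/-! ### Coinvariants of the right action -/

/-- Linear maps compatible with the right actions. -/
def IsRightLinear {k : Type u} [Field k] {A : Type u} [Ring A] [Algebra k A]
    {M N : Type u} [AddCommGroup M] [Module k M] [Module (A ⊗[k] Aᵐᵒᵖ) M]
    [AddCommGroup N] [Module k N] [Module (A ⊗[k] Aᵐᵒᵖ) N] (f : M →ₗ[k] N) : Prop :=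
  ∀ (a : A) (m : M), f ((1 ⊗ₜ[k] op a : A ⊗[k] Aᵐᵒᵖ) • m) = (1 ⊗ₜ[k] op a : A ⊗[k] Aᵐᵒᵖ) • f m

section RightCoinvariants

variable {k : Type u} [Field k] {G : Type v} [CommGroup G] [DecidableEq G]
  {A : Type u} [Ring A] [Algebra k A] [Coalgebra k A] (B : YDBimonoid k G A)
  (M : Type u) [AddCommGroup M] [Module k M] [Module (A ⊗[k] Aᵐᵒᵖ) M]
  [IsScalarTower k (A ⊗[k] Aᵐᵒᵖ) M]

theorem env_smul_eq (a b : A) (m : M) : (a ⊗ₜ[k] op b : A ⊗[k] Aᵐᵒᵖ) • m =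
    (a ⊗ₜ[k] 1 : A ⊗[k] Aᵐᵒᵖ) • (1 ⊗ₜ[k] op b : A ⊗[k] Aᵐᵒᵖ) • m := by
  simp [smul_smul]

/-- The relations `m · a = ε(a) m`. -/
def coinvariantsRel : Submodule (A ⊗[k] Aᵐᵒᵖ) M where
  carrier := Submodule.span k {x | ∃ (m : M) (a : A),
    x = (1 ⊗ₜ[k] op a : A ⊗[k] Aᵐᵒᵖ) • m - Coalgebra.counit (R := k) a • m}
  add_mem' hx hy := add_mem hx hy
  zero_mem' := zero_mem _
  smul_mem' e x hx := by
    induction e with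
    | zero =>
      have h : (0 : A ⊗[k] Aᵐᵒᵖ) • x = 0 := zero_smul (A ⊗[k] Aᵐᵒᵖ) x
      exact h ▸ zero_mem _
    | add e e' he he' => rw [add_smul]; exact add_mem he he'
    | tmul a b =>
      induction hx using Submodule.span_induction with
      | zero => rw [smul_zero]; exact zero_mem _
      | add x y _ _ hx hy => rw [smul_add]; exact add_mem hx hy
      | smul c x _ hx => rw [smul_algebra_smul_comm]; exact Submodule.smul_mem _ c hx
      | mem x hx =>
        obtain ⟨m, c, rfl⟩ := hx
        -- `a · (m · c - ε(c) m) · b` is the difference of two relations for `a · m`.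
        have e : (a ⊗ₜ[k] b : A ⊗[k] Aᵐᵒᵖ) • ((1 ⊗ₜ[k] op c : A ⊗[k] Aᵐᵒᵖ) • m -
            Coalgebra.counit (R := k) c • m) =
            ((1 ⊗ₜ[k] op (c * b.unop) : A ⊗[k] Aᵐᵒᵖ) • (a ⊗ₜ[k] 1 : A ⊗[k] Aᵐᵒᵖ) • m -
              Coalgebra.counit (R := k) (c * b.unop) • (a ⊗ₜ[k] 1 : A ⊗[k] Aᵐᵒᵖ) • m) -
            Coalgebra.counit (R := k) c •
              ((1 ⊗ₜ[k] op b.unop : A ⊗[k] Aᵐᵒᵖ) • (a ⊗ₜ[k] 1 : A ⊗[k] Aᵐᵒᵖ) • m -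
                Coalgebra.counit (R := k) b.unop • (a ⊗ₜ[k] 1 : A ⊗[k] Aᵐᵒᵖ) • m) := by
          rw [smul_sub, smul_sub, smul_algebra_smul_comm, smul_smul, smul_smul, smul_smul, smul_smul,
            B.counit_mul]
          simp
        rw [e]
        exact sub_mem (Submodule.subset_span ⟨_, _, rfl⟩)
          (Submodule.smul_mem _ _ (Submodule.subset_span ⟨_, _, rfl⟩))

/-- The quotient `M ⊗_A k` of a bimodule by the relations `m · a = ε(a) m`. -/
def RightCoinvariants : Type u := M ⧸ coinvariantsRel B M

namespace RightCoinvariants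

instance : AddCommGroup (RightCoinvariants B M) :=
  inferInstanceAs (AddCommGroup (M ⧸ coinvariantsRel B M))

instance : Module k (RightCoinvariants B M) :=
  inferInstanceAs (Module k (M ⧸ coinvariantsRel B M))

/-- The left action. -/
instance : Module A (RightCoinvariants B M) :=
  Module.compHom (M ⧸ coinvariantsRel B M)
    (Algebra.TensorProduct.includeLeft : A →ₐ[k] A ⊗[k] Aᵐᵒᵖ).toRingHom

variable {M}

/-- The quotient map. -/
def mk : M →ₗ[k] RightCoinvariants B M := (coinvariantsRel B M).mkQ.restrictScalars k

theorem smul_mk (a : A) (m : M) : a • mk B m = mk B ((a ⊗ₜ[k] 1 : A ⊗[k] Aᵐᵒᵖ) • m) := rfl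

theorem mk_surjective : Function.Surjective (mk B : M →ₗ[k] RightCoinvariants B M) :=
  (coinvariantsRel B M).mkQ_surjective

theorem mk_right_smul (a : A) (m : M) :
    mk B ((1 ⊗ₜ[k] op a : A ⊗[k] Aᵐᵒᵖ) • m) = Coalgebra.counit (R := k) a • mk B m := by
  rw [← map_smul]
  exact (Submodule.Quotient.eq _).2 (Submodule.subset_span ⟨m, a, rfl⟩)

instance : IsScalarTower k A (RightCoinvariants B M) :=
  ⟨fun c a x => by
    obtain ⟨m, rfl⟩ := mk_surjective B x
    rw [smul_mk, smul_mk, ← map_smul, ← TensorProduct.smul_tmul', smul_assoc]⟩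

/-- The linear map out of the coinvariants given by a map that satisfies the relations. -/
def lift {W : Type*} [AddCommGroup W] [Module k W] (f : M →ₗ[k] W)
    (hf : ∀ (a : A) (m : M), f ((1 ⊗ₜ[k] op a : A ⊗[k] Aᵐᵒᵖ) • m) =
      Coalgebra.counit (R := k) a • f m) : RightCoinvariants B M →ₗ[k] W :=
  ((coinvariantsRel B M).restrictScalars k).liftQ f (by
    refine Submodule.span_le.2 ?_
    rintro _ ⟨m, a, rfl⟩
    simp [hf])

theorem lift_mk {W : Type*} [AddCommGroup W] [Module k W] (f : M →ₗ[k] W) (hf) (m : M) :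
    lift B f hf (mk B m) = f m :=
  Submodule.liftQ_apply ((coinvariantsRel B M).restrictScalars k) f m

/-- The map of coinvariants induced by a linear map compatible with the right actions. -/
def map {N : Type u} [AddCommGroup N] [Module k N] [Module (A ⊗[k] Aᵐᵒᵖ) N]
    [IsScalarTower k (A ⊗[k] Aᵐᵒᵖ) N] (f : M →ₗ[k] N)
    (hf : IsRightLinear (A := A) f) : RightCoinvariants B M →ₗ[k] RightCoinvariants B N :=
  lift B (mk B ∘ₗ f) fun a m => by
    rw [LinearMap.comp_apply, hf, mk_right_smul, LinearMap.comp_apply]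

theorem map_mk {N : Type u} [AddCommGroup N] [Module k N] [Module (A ⊗[k] Aᵐᵒᵖ) N]
    [IsScalarTower k (A ⊗[k] Aᵐᵒᵖ) N] (f : M →ₗ[k] N) (hf) (m : M) :
    map B f hf (mk B m) = mk B (f m) :=
  lift_mk _ _ _ _

/-- A bimodule map into a module with trivial right action, as an `A`-linear map on the
coinvariants. -/
def linearLift {N : Type*} [AddCommGroup N] [Module k N] [Module A N]
    (f : M →ₗ[k] N) (hr : ∀ (a : A) (m : M), f ((1 ⊗ₜ[k] op a : A ⊗[k] Aᵐᵒᵖ) • m) =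
      Coalgebra.counit (R := k) a • f m)
    (hl : ∀ (a : A) (m : M), f ((a ⊗ₜ[k] 1 : A ⊗[k] Aᵐᵒᵖ) • m) = a • f m) :
    RightCoinvariants B M →ₗ[A] N where
  toFun := lift B f hr
  map_add' := map_add _
  map_smul' a x := by
    obtain ⟨m, rfl⟩ := mk_surjective B x
    rw [smul_mk, lift_mk, lift_mk, hl, RingHom.id_apply]

theorem linearLift_mk {N : Type*} [AddCommGroup N] [Module k N] [Module A N]
    (f : M →ₗ[k] N) (hr) (hl) (m : M) : linearLift (A := A) B f hr hl (mk B m) = f m :=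
  lift_mk B f hr m

variable {B} in
/-- The action of the group on the coinvariants. -/
def actHom (X : YDBimodule B M) (g : G) : RightCoinvariants B M →ₗ[k] RightCoinvariants B M :=
  lift B (mk B ∘ₗ X.act g) fun a m => by
    rw [LinearMap.comp_apply, X.act_right, mk_right_smul, B.counit_act, LinearMap.comp_apply]

variable {B} in
theorem actHom_mk (X : YDBimodule B M) (g : G) (m : M) :
    actHom X g (mk B m) = mk B (X.act g m) :=
  lift_mk _ _ _ _

variable {B} in
/-- `actHom` as a representation. -/
def actRep (X : YDBimodule B M) : Representation k G (RightCoinvariants B M) where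
  toFun := actHom X
  map_one' := by
    ext x
    obtain ⟨m, rfl⟩ := mk_surjective B x
    rw [actHom_mk]
    simp
  map_mul' g h := by
    ext x
    obtain ⟨m, rfl⟩ := mk_surjective B x
    rw [actHom_mk, Module.End.mul_apply, actHom_mk, actHom_mk]
    simp

variable {B} in
theorem actRep_mk (X : YDBimodule B M) (g : G) (m : M) :
    actRep X g (mk B m) = mk B (X.act g m) :=
  actHom_mk X g m

variable {B} in
/-- The Yetter-Drinfeld structure on the coinvariants. The relations are homogeneous, since the
counit is concentrated in degree `1`. -/
def ydModule (X : YDBimodule B M) : YDModule B (RightCoinvariants B M) where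
  act := actRep X
  gr s := (X.gr s).map (mk B)
  isInternal := by
    refine isInternal_of_proj ?_ (fun s => lift B (mk B ∘ₗ gradedProj X.isInternal s) ?_) ?_ ?_
    · rw [← Submodule.map_iSup, X.isInternal.submodule_iSup_eq_top, Submodule.map_top,
        LinearMap.range_eq_top]
      exact mk_surjective B
    · intro a m
      simp only [LinearMap.comp_apply]
      induction a using graded_induction B.isInternal with
      | h0 =>
        have h (y : M) : (0 : A ⊗[k] Aᵐᵒᵖ) • y = 0 := zero_smul (A ⊗[k] Aᵐᵒᵖ) y
        rw [MulOpposite.op_zero, TensorProduct.tmul_zero, h, map_zero, map_zero, map_zero, zero_smul]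
      | add a b ha hb =>
        simp only [MulOpposite.op_add, TensorProduct.tmul_add, add_smul, map_add, ha, hb]
      | hom t a ha =>
        induction m using graded_induction X.isInternal with
        | h0 => simp
        | add m m' hm hm' => simp only [smul_add, map_add, hm, hm']
        | hom r m hm =>
          rw [gradedProj_apply _ (X.right_mem _ _ _ _ hm ha), gradedProj_apply _ hm]
          by_cases ht : t = 1
          · subst ht
            rw [mul_one]
            split_ifs
            · exact mk_right_smul B a m
            · simp
          · rw [B.counit_eq_zero t a ht ha, zero_smul]
            split_ifs
            · rw [mk_right_smul, B.counit_eq_zero t a ht ha, zero_smul]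
            · simp
    · rintro s _ ⟨m, hm, rfl⟩
      rw [lift_mk, LinearMap.comp_apply, gradedProj_apply _ hm, if_pos rfl]
    · rintro s t hne _ ⟨m, hm, rfl⟩
      rw [lift_mk, LinearMap.comp_apply, gradedProj_apply _ hm, if_neg hne, map_zero]
  act_mem := by
    rintro g h _ ⟨m, hm, rfl⟩
    exact ⟨X.act g m, X.act_mem g h m hm, (actRep_mk X g m).symm⟩
  smul_mem := by
    rintro s t a _ ha ⟨m, hm, rfl⟩
    exact ⟨_, X.left_mem s t a m ha hm, rfl⟩
  act_smul := by
    intro g a x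
    obtain ⟨m, rfl⟩ := mk_surjective B x
    rw [smul_mk, actRep_mk, actRep_mk, X.act_left, smul_mk]

variable {B} in
theorem ydModule_act_mk (X : YDBimodule B M) (g : G) (m : M) :
    (ydModule X).act g (mk B m) = mk B (X.act g m) :=
  actRep_mk X g m

variable {B} in
theorem mk_mem_gr (X : YDBimodule B M) {s : G} {m : M} (hm : m ∈ X.gr s) :
    mk B m ∈ (ydModule X).gr s :=
  ⟨m, hm, rfl⟩

/-- The coinvariants of the free bimodule on `V` are the free left module on `V`. -/
theorem exists_bijective_of_equiv {V : Type*} [AddCommGroup V] [Module k V]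
    (e : M ≃ₗ[k] (A ⊗[k] V) ⊗[k] A)
    (he : ∀ (a b : A) (m : M), e ((a ⊗ₜ[k] op b : A ⊗[k] Aᵐᵒᵖ) • m) =
      TensorProduct.map (LinearMap.rTensor V (LinearMap.mulLeft k a)) (LinearMap.mulRight k b)
        (e m)) :
    ∃ β : A ⊗[k] V →ₗ[A] RightCoinvariants B M, Function.Bijective β := by
  have hl (a : A) (w : A ⊗[k] V) : e.symm ((a • w) ⊗ₜ[k] 1) =
      (a ⊗ₜ[k] 1 : A ⊗[k] Aᵐᵒᵖ) • e.symm (w ⊗ₜ[k] 1) := by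
    rw [LinearEquiv.symm_apply_eq]
    refine Eq.trans ?_ (he a 1 _).symm
    have h : LinearMap.rTensor V (LinearMap.mulLeft k a) w = a • w := by
      induction w with
      | zero => simp
      | tmul b v => rfl
      | add w w' hw hw' => rw [smul_add, map_add, hw, hw']
    rw [LinearEquiv.apply_symm_apply, TensorProduct.map_tmul, h, LinearMap.mulRight_apply, mul_one]
  have hr (w : A ⊗[k] V) (b : A) : e.symm (w ⊗ₜ[k] b) =
      (1 ⊗ₜ[k] op b : A ⊗[k] Aᵐᵒᵖ) • e.symm (w ⊗ₜ[k] 1) := by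
    rw [LinearEquiv.symm_apply_eq, he, LinearEquiv.apply_symm_apply, TensorProduct.map_tmul]
    simp
  let β : A ⊗[k] V →ₗ[A] RightCoinvariants B M :=
    { toFun := fun w => mk B (e.symm (w ⊗ₜ[k] 1))
      map_add' := fun w w' => by rw [TensorProduct.add_tmul, map_add, map_add]
      map_smul' := fun a w => by rw [hl, RingHom.id_apply, smul_mk] }
  let γ : RightCoinvariants B M →ₗ[k] A ⊗[k] V :=
    lift B ((TensorProduct.rid k (A ⊗[k] V)).toLinearMap ∘ₗ
      LinearMap.lTensor (A ⊗[k] V) Coalgebra.counit ∘ₗ e.toLinearMap) (fun a m => by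
      simp only [LinearMap.comp_apply, LinearEquiv.coe_coe, he]
      induction e m with
      | zero => simp
      | tmul w b => simp [B.counit_mul, mul_smul, mul_comm]
      | add z z' hz hz' => simp only [map_add, hz, hz', smul_add])
  refine ⟨β, Function.LeftInverse.injective (g := γ) fun w => ?_, fun x => ?_⟩
  · change lift B _ _ (mk B (e.symm (w ⊗ₜ[k] 1))) = w
    rw [lift_mk]
    simp [B.counit_one]
  · obtain ⟨m, rfl⟩ := mk_surjective B x
    obtain ⟨z, rfl⟩ := e.symm.surjective m
    induction z with
    | zero => exact ⟨0, by simp⟩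
    | tmul w b =>
      refine ⟨Coalgebra.counit (R := k) b • w, ?_⟩
      rw [hr, mk_right_smul, LinearMap.map_smul_of_tower]
      rfl
    | add z z' hz hz' =>
      obtain ⟨w, hw⟩ := hz
      obtain ⟨w', hw'⟩ := hz'
      exact ⟨w + w', by rw [map_add, hw, hw', map_add, map_add]⟩

end RightCoinvariants

end RightCoinvariants

/-! ### Contractions of resolutions of the regular bimodule -/

section RightContraction

variable {k : Type u} [Field k] {A : Type u} [Ring A] [Algebra k A]

/-- A bimodule that is isomorphic to `W ⊗ A` as a right module is projective as a right module. -/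
theorem exists_rightLinear_lift {M N N' : Type u} [AddCommGroup M] [Module k M]
    [Module (A ⊗[k] Aᵐᵒᵖ) M] [AddCommGroup N] [Module k N]
    [Module (A ⊗[k] Aᵐᵒᵖ) N] [IsScalarTower k (A ⊗[k] Aᵐᵒᵖ) N] [AddCommGroup N'] [Module k N']
    [Module (A ⊗[k] Aᵐᵒᵖ) N'] {W : Type*} [AddCommGroup W] [Module k W] (e : M ≃ₗ[k] W ⊗[k] A)
    (he : ∀ (b : A) (m : M), e ((1 ⊗ₜ[k] op b : A ⊗[k] Aᵐᵒᵖ) • m) =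
      LinearMap.lTensor W (LinearMap.mulRight k b) (e m))
    {d : N →ₗ[k] N'} (hd : IsRightLinear (A := A) d) {g : M →ₗ[k] N'}
    (hg : IsRightLinear (A := A) g) (h : ∀ m, ∃ y, d y = g m) :
    ∃ s : M →ₗ[k] N, IsRightLinear (A := A) s ∧ ∀ m, d (s m) = g m := by
  obtain ⟨t, ht⟩ := Module.Projective.exists_lift_of_mem_range d
    (g ∘ₗ e.symm.toLinearMap ∘ₗ (TensorProduct.mk k W A).flip 1) fun w => h _
  have ht' (w : W) : d (t w) = g (e.symm (w ⊗ₜ[k] 1)) := ht w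
  let Φ : W ⊗[k] A →ₗ[k] N := TensorProduct.lift
    (LinearMap.mk₂ k (fun w a => (1 ⊗ₜ[k] op a : A ⊗[k] Aᵐᵒᵖ) • t w)
      (fun w w' a => by rw [map_add, smul_add])
      (fun c w a => by rw [map_smul, smul_algebra_smul_comm])
      (fun w a b => by rw [MulOpposite.op_add, TensorProduct.tmul_add, add_smul])
      (fun c w a => by rw [MulOpposite.op_smul, TensorProduct.tmul_smul, smul_assoc]))
  have hΦ (w : W) (a : A) : Φ (w ⊗ₜ[k] a) = (1 ⊗ₜ[k] op a : A ⊗[k] Aᵐᵒᵖ) • t w := rfl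
  refine ⟨Φ ∘ₗ e.toLinearMap, fun a m => ?_, fun m => ?_⟩
  · rw [LinearMap.comp_apply, LinearEquiv.coe_coe, he, LinearMap.comp_apply, LinearEquiv.coe_coe]
    induction e m with
    | zero => simp
    | tmul w b =>
      rw [LinearMap.lTensor_tmul, hΦ, hΦ, smul_smul]
      simp
    | add z z' hz hz' => simp only [map_add, smul_add, hz, hz']
  · obtain ⟨z, rfl⟩ := e.symm.surjective m
    rw [LinearMap.comp_apply, LinearEquiv.coe_coe, LinearEquiv.apply_symm_apply]
    induction z with
    | zero => simp
    | tmul w b =>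
      have hr : e.symm (w ⊗ₜ[k] b) = (1 ⊗ₜ[k] op b : A ⊗[k] Aᵐᵒᵖ) • e.symm (w ⊗ₜ[k] 1) := by
        rw [LinearEquiv.symm_apply_eq, he, LinearEquiv.apply_symm_apply]
        simp
      rw [hΦ, hd, ht', hr, hg]
    | add z z' hz hz' => simp only [map_add, hz, hz']

/-- A resolution `M → A` of the regular bimodule by bimodules `W ⊗ A` is contractible as a complex
of right modules. -/
theorem exists_rightContraction {M : ℕ → Type u} [∀ n, AddCommGroup (M n)] [∀ n, Module k (M n)]
    [∀ n, Module (A ⊗[k] Aᵐᵒᵖ) (M n)] [∀ n, IsScalarTower k (A ⊗[k] Aᵐᵒᵖ) (M n)]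
    {W : ℕ → Type*} [∀ n, AddCommGroup (W n)] [∀ n, Module k (W n)]
    (e : ∀ n, M n ≃ₗ[k] W n ⊗[k] A)
    (he : ∀ n (b : A) (m : M n), e n ((1 ⊗ₜ[k] op b : A ⊗[k] Aᵐᵒᵖ) • m) =
      LinearMap.lTensor (W n) (LinearMap.mulRight k b) (e n m))
    (d : ∀ n, M (n + 1) →ₗ[A ⊗[k] Aᵐᵒᵖ] M n) (hd : ∀ n x, d n (d (n + 1) x) = 0)
    (hex : ∀ n x, d n x = 0 → ∃ y, d (n + 1) y = x)
    (π : M 0 →ₗ[k] A) (hπ : ∀ (a b : A) x, π ((a ⊗ₜ[k] op b : A ⊗[k] Aᵐᵒᵖ) • x) = a * π x * b)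
    (hπd : ∀ x, π (d 0 x) = 0) (hex₀ : ∀ x, π x = 0 → ∃ y, d 0 y = x)
    (σ : M 0) (hσ : π σ = 1) :
    ∃ s : ∀ n, M n →ₗ[k] M (n + 1), (∀ n, IsRightLinear (A := A) (s n)) ∧
      (∀ x, d 0 (s 0 x) = x - (1 ⊗ₜ[k] op (π x) : A ⊗[k] Aᵐᵒᵖ) • σ) ∧
      ∀ n x, d (n + 1) (s (n + 1) x) = x - s n (d n x) := by
  have hdr (n : ℕ) : IsRightLinear (A := A) ((d n).restrictScalars k) := fun a m => (d n).map_smul _ _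
  let S (n : ℕ) := {s : M n →ₗ[k] M (n + 1) // IsRightLinear (A := A) s ∧
    ∀ x, d n (s (d n x)) = d n x}
  let ρ : M 0 →ₗ[k] M 0 :=
    { toFun := fun x => (1 ⊗ₜ[k] op (π x) : A ⊗[k] Aᵐᵒᵖ) • σ
      map_add' := fun x y => by rw [map_add, MulOpposite.op_add, TensorProduct.tmul_add, add_smul]
      map_smul' := fun c x => by
        rw [map_smul, MulOpposite.op_smul, TensorProduct.tmul_smul, smul_assoc, RingHom.id_apply] }
  have hρ (x : M 0) : ρ x = (1 ⊗ₜ[k] op (π x) : A ⊗[k] Aᵐᵒᵖ) • σ := rfl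
  obtain ⟨s₀, hs₀, h₀⟩ := exists_rightLinear_lift (e 0) (he 0) (hdr 0)
    (g := LinearMap.id - ρ) (fun a m => by
      rw [LinearMap.sub_apply, LinearMap.sub_apply, hρ, hρ, hπ, smul_sub, smul_smul]
      simp) (fun m => hex₀ _ (by
        rw [LinearMap.sub_apply, map_sub, hρ, hπ, hσ]
        simp))
  have h₀' (x : M 0) : d 0 (s₀ x) = x - (1 ⊗ₜ[k] op (π x) : A ⊗[k] Aᵐᵒᵖ) • σ := h₀ x
  have step (n : ℕ) (s : S n) : ∃ s' : S (n + 1), ∀ x, d (n + 1) (s'.1 x) = x - s.1 (d n x) := by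
    obtain ⟨s', hs', h'⟩ := exists_rightLinear_lift (e (n + 1)) (he (n + 1)) (hdr (n + 1))
      (g := LinearMap.id - s.1 ∘ₗ (d n).restrictScalars k) (fun a m => by
        simp only [LinearMap.sub_apply, LinearMap.comp_apply, LinearMap.id_apply]
        rw [hdr n, s.2.1, smul_sub]) (fun m => hex n _ (by
          simp only [LinearMap.sub_apply, LinearMap.comp_apply, LinearMap.id_apply,
            LinearMap.restrictScalars_apply]
          rw [map_sub, s.2.2, sub_self]))
    have h'' (x : M (n + 1)) : d (n + 1) (s' x) = x - s.1 (d n x) := h' x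
    refine ⟨⟨s', hs', fun x => ?_⟩, h''⟩
    rw [h'', hd, map_zero, sub_zero]
  choose next hnext using step
  let Φs (n : ℕ) : S n := Nat.rec ⟨s₀, hs₀, fun x => by
    have h : (0 : A ⊗[k] Aᵐᵒᵖ) • σ = 0 := zero_smul (A ⊗[k] Aᵐᵒᵖ) σ
    rw [h₀', hπd, MulOpposite.op_zero, TensorProduct.tmul_zero, h, sub_zero]⟩ next n
  exact ⟨fun n => (Φs n).1, fun n => (Φs n).2.1, h₀', fun n x => hnext n (Φs n) x⟩

end RightContraction

/-! ### Projective resolutions of the regular bimodule -/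

section Resolution

variable {k : Type u} [Field k] {A : Type u} [Ring A] [Algebra k A]
  (P : ProjectiveResolution (regBimod k A))

/-- The augmentation of a resolution of `A`, as a linear map. -/
def resolutionAug : P.complex.X 0 →ₗ[k] A := homToLinear (AlgHom.id k A) (P.π.f 0)

theorem resolutionAug_smul (a b : A) (x : P.complex.X 0) :
    resolutionAug P ((a ⊗ₜ[k] op b : A ⊗[k] Aᵐᵒᵖ) • x) = a * resolutionAug P x * b :=
  homToLinear_smul (AlgHom.id k A) (P.π.f 0) a b x

theorem resolution_d_d (n : ℕ) (x : P.complex.X (n + 2)) :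
    (P.complex.d (n + 1) n).hom ((P.complex.d (n + 2) (n + 1)).hom x) = 0 := by
  rw [← ModuleCat.comp_apply, HomologicalComplex.d_comp_d]
  rfl

theorem resolution_exact (n : ℕ) (x : P.complex.X (n + 1))
    (hx : (P.complex.d (n + 1) n).hom x = 0) :
    ∃ y, (P.complex.d (n + 2) (n + 1)).hom y = x :=
  (ShortComplex.moduleCat_exact_iff _).1 (P.exact_succ n) x hx

theorem resolution_aug_d (x : P.complex.X 1) :
    resolutionAug P ((P.complex.d 1 0).hom x) = 0 := by
  have h := P.complex_d_comp_π_f_zero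
  have h' := congrArg (fun φ => φ.hom x) h
  exact h'

theorem resolution_exact_zero (x : P.complex.X 0)
    (hx : resolutionAug P x = 0) : ∃ y, (P.complex.d 1 0).hom y = x := by
  have h : (ShortComplex.mk _ _ P.complex_d_comp_π_f_zero).Exact :=
    ShortComplex.exact_of_g_is_cokernel _ P.isColimitCokernelCofork
  exact (ShortComplex.moduleCat_exact_iff _).1 h x hx

theorem resolution_aug_surjective :
    Function.Surjective (resolutionAug P) :=
  (ModuleCat.epi_iff_surjective (P.π.f 0)).1 inferInstance

theorem resolution_projective (n : ℕ) :
    Module.Projective (A ⊗[k] Aᵐᵒᵖ) (P.complex.X n) :=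
  (IsProjective.iff_projective _).2 (P.projective n)

theorem homToLinear_right {M : ModuleCat.{u} (A ⊗[k] Aᵐᵒᵖ)} {R : Type u} [Ring R] [Algebra k R]
    (ρ : A →ₐ[k] R) (f : M ⟶ algBimod ρ) (a : A) (m : M) :
    homToLinear ρ f ((1 ⊗ₜ[k] op a : A ⊗[k] Aᵐᵒᵖ) • m) = homToLinear ρ f m * ρ a := by
  rw [homToLinear_smul, map_one, one_mul]

theorem homToLinear_left {M : ModuleCat.{u} (A ⊗[k] Aᵐᵒᵖ)} {R : Type u} [Ring R] [Algebra k R]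
    (ρ : A →ₐ[k] R) (f : M ⟶ algBimod ρ) (a : A) (m : M) :
    homToLinear ρ f ((a ⊗ₜ[k] 1 : A ⊗[k] Aᵐᵒᵖ) • m) = ρ a * homToLinear ρ f m := by
  refine (homToLinear_smul ρ f a 1 m).trans ?_
  rw [map_one, mul_one]

end Resolution

/-! ### The resolution of the trivial module by coinvariants -/

section LeftResolution

variable {k : Type u} [Field k] {G : Type v} [CommGroup G] [DecidableEq G]
  {A : Type u} [Ring A] [Algebra k A] [Coalgebra k A] {B : YDBimonoid k G A}
  {P : ProjectiveResolution (regBimod k A)}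

/-- A resolution by graded free bimodules is contractible as a complex of right modules. -/
theorem YDResolution.exists_rightContraction (X : YDResolution B P)
    (hX : ∀ n, (X.yd n).IsFiniteGradedFree) (σ : P.complex.X 0) (hσ : resolutionAug P σ = 1) :
    ∃ s : ∀ n, P.complex.X n →ₗ[k] P.complex.X (n + 1), (∀ n, IsRightLinear (A := A) (s n)) ∧
      (∀ x, (P.complex.d 1 0).hom (s 0 x) = x -
        (1 ⊗ₜ[k] op (resolutionAug P x) : A ⊗[k] Aᵐᵒᵖ) • σ) ∧
      ∀ n x, (P.complex.d (n + 2) (n + 1)).hom (s (n + 1) x) =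
        x - s n ((P.complex.d (n + 1) n).hom x) := by
  choose V hV₁ hV₂ grV e _ _ he _ using hX
  refine _root_.exists_rightContraction (W := fun n => A ⊗[k] V n) e (fun n b m => ?_)
    (fun n => (P.complex.d (n + 1) n).hom) (resolution_d_d P) (resolution_exact P)
    (resolutionAug P) (resolutionAug_smul P) (resolution_aug_d P) (resolution_exact_zero P) σ hσ
  rw [he]
  have h : LinearMap.rTensor (V n) (LinearMap.mulLeft k (1 : A)) = LinearMap.id :=
    TensorProduct.ext' fun a v => by simp
  rw [h]
  rfl

/-- An element of `P_0` over the unit of `A`. -/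
def resolutionBase (P : ProjectiveResolution (regBimod k A)) : P.complex.X 0 :=
  (resolution_aug_surjective P 1).choose

theorem resolutionAug_base (P : ProjectiveResolution (regBimod k A)) :
    resolutionAug P (resolutionBase P) = 1 :=
  (resolution_aug_surjective P 1).choose_spec

/-- A contraction of a resolution by graded free bimodules, as a complex of right modules. -/
def YDResolution.contraction (X : YDResolution B P) (hX : ∀ n, (X.yd n).IsFiniteGradedFree)
    (n : ℕ) : P.complex.X n →ₗ[k] P.complex.X (n + 1) :=
  (X.exists_rightContraction hX _ (resolutionAug_base P)).choose n

theorem YDResolution.contraction_right (X : YDResolution B P)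
    (hX : ∀ n, (X.yd n).IsFiniteGradedFree) (n : ℕ) :
    IsRightLinear (A := A) (X.contraction hX n) :=
  (X.exists_rightContraction hX _ (resolutionAug_base P)).choose_spec.1 n

theorem YDResolution.d_contraction_zero (X : YDResolution B P)
    (hX : ∀ n, (X.yd n).IsFiniteGradedFree) (x : P.complex.X 0) :
    (P.complex.d 1 0).hom (X.contraction hX 0 x) = x -
      (1 ⊗ₜ[k] op (resolutionAug P x) : A ⊗[k] Aᵐᵒᵖ) • resolutionBase P :=
  (X.exists_rightContraction hX _ (resolutionAug_base P)).choose_spec.2.1 x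

theorem YDResolution.d_contraction_succ (X : YDResolution B P)
    (hX : ∀ n, (X.yd n).IsFiniteGradedFree) (n : ℕ) (x : P.complex.X (n + 1)) :
    (P.complex.d (n + 2) (n + 1)).hom (X.contraction hX (n + 1) x) =
      x - X.contraction hX n ((P.complex.d (n + 1) n).hom x) :=
  (X.exists_rightContraction hX _ (resolutionAug_base P)).choose_spec.2.2 n x

namespace RightCoinvariants

variable (B) in
/-- The map of coinvariants induced by a bimodule map. -/
def mapLinear {M N : Type u} [AddCommGroup M] [Module k M] [Module (A ⊗[k] Aᵐᵒᵖ) M]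
    [IsScalarTower k (A ⊗[k] Aᵐᵒᵖ) M] [AddCommGroup N] [Module k N] [Module (A ⊗[k] Aᵐᵒᵖ) N]
    [IsScalarTower k (A ⊗[k] Aᵐᵒᵖ) N] (f : M →ₗ[A ⊗[k] Aᵐᵒᵖ] N) :
    RightCoinvariants B M →ₗ[A] RightCoinvariants B N :=
  linearLift B (mk B ∘ₗ f.restrictScalars k)
    (fun a m => by
      have h := f.map_smul (1 ⊗ₜ[k] op a : A ⊗[k] Aᵐᵒᵖ) m
      rw [LinearMap.comp_apply, LinearMap.restrictScalars_apply, h, mk_right_smul]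
      rfl)
    (fun a m => by
      have h := f.map_smul (a ⊗ₜ[k] 1 : A ⊗[k] Aᵐᵒᵖ) m
      rw [LinearMap.comp_apply, LinearMap.restrictScalars_apply, h, ← smul_mk]
      rfl)

variable (B) in
theorem mapLinear_mk {M N : Type u} [AddCommGroup M] [Module k M] [Module (A ⊗[k] Aᵐᵒᵖ) M]
    [IsScalarTower k (A ⊗[k] Aᵐᵒᵖ) M] [AddCommGroup N] [Module k N] [Module (A ⊗[k] Aᵐᵒᵖ) N]
    [IsScalarTower k (A ⊗[k] Aᵐᵒᵖ) N] (f : M →ₗ[A ⊗[k] Aᵐᵒᵖ] N) (m : M) :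
    mapLinear B f (mk B m) = mk B (f m) :=
  linearLift_mk _ _ _ _ _

variable (B) in
/-- The linear form on the coinvariants given by a bimodule map to the trivial bimodule. Its inverse
is `ofForm`. -/
def form {M : ModuleCat.{u} (A ⊗[k] Aᵐᵒᵖ)} (f : M ⟶ algBimod B.aug) :
    RightCoinvariants B M →ₗ[k] k :=
  lift B (homToLinear B.aug f) fun a m => by
    rw [homToLinear_right, smul_eq_mul, mul_comm]
    rfl

theorem form_mk {M : ModuleCat.{u} (A ⊗[k] Aᵐᵒᵖ)} (f : M ⟶ algBimod B.aug) (m : M) :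
    form B f (mk B m) = homToLinear B.aug f m :=
  lift_mk _ _ _ _

theorem form_mem_counitHoms {M : ModuleCat.{u} (A ⊗[k] Aᵐᵒᵖ)} (f : M ⟶ algBimod B.aug) :
    form B f ∈ counitHoms k A (RightCoinvariants B M) := by
  intro a x
  obtain ⟨m, rfl⟩ := mk_surjective B x
  rw [smul_mk, form_mk, form_mk, homToLinear_left]
  rfl

/-- The bimodule map to the trivial bimodule given by a linear form on the coinvariants. -/
def ofForm {M : ModuleCat.{u} (A ⊗[k] Aᵐᵒᵖ)} (f : RightCoinvariants B M →ₗ[k] k)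
    (hf : f ∈ counitHoms k A (RightCoinvariants B M)) : M ⟶ algBimod B.aug :=
  ModuleCat.ofHom
    { toFun := fun x => (AlgBimodule.toAlg B.aug).symm (f (mk B x))
      map_add' := fun x y => by simp only [map_add]
      map_smul' := fun e x => by
        apply (AlgBimodule.toAlg B.aug).injective
        induction e with
        | zero =>
          have h₁ : (0 : A ⊗[k] Aᵐᵒᵖ) • x = 0 := zero_smul (A ⊗[k] Aᵐᵒᵖ) x
          have h₂ : (0 : A ⊗[k] Aᵐᵒᵖ) • (AlgBimodule.toAlg B.aug).symm (f (mk B x)) = 0 :=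
            zero_smul (A ⊗[k] Aᵐᵒᵖ)
              ((AlgBimodule.toAlg B.aug).symm (f (mk B x)))
          rw [h₁, map_zero, map_zero, map_zero, RingHom.id_apply, h₂]
        | tmul a b =>
          have h := AlgBimodule.toAlg_smul B.aug a b.unop
            ((AlgBimodule.toAlg B.aug).symm (f (mk B x)))
          rw [op_unop] at h
          rw [RingHom.id_apply, h, AddEquiv.apply_symm_apply, AddEquiv.apply_symm_apply,
            ← op_unop b, env_smul_eq, ← smul_mk, hf, mk_right_smul, map_smul, smul_eq_mul, mul_assoc, mul_comm (f _)]
          rfl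
        | add e e' h h' =>
          simp only [add_smul, map_add, RingHom.id_apply] at h h' ⊢
          rw [h, h'] }

theorem homToLinear_ofForm {M : ModuleCat.{u} (A ⊗[k] Aᵐᵒᵖ)} (f : RightCoinvariants B M →ₗ[k] k)
    (hf) (x : M) : homToLinear B.aug (ofForm f hf) x = f (mk B x) :=
  rfl

end RightCoinvariants

open RightCoinvariants

variable (B P) in
/-- The augmentation `ε ⊗_A k : P_0 ⊗_A k → k`. -/
def coinvariantsAug : RightCoinvariants B (P.complex.X 0) →ₗ[k] k :=
  form B (P.π.f 0 ≫ algBimodUnit B.aug)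

theorem coinvariantsAug_mk (x : P.complex.X 0) :
    coinvariantsAug B P (mk B x) = Coalgebra.counit (R := k) (resolutionAug P x) :=
  form_mk (P.π.f 0 ≫ algBimodUnit B.aug) x

/-- The resolution `P ⊗_A k` of the trivial module. -/
def YDResolution.leftResolution (X : YDResolution B P) (hX : ∀ n, (X.yd n).IsFiniteGradedFree) :
    YDLeftResolution B fun n => RightCoinvariants B (P.complex.X n) where
  yd n := ydModule (X.yd n)
  d n := mapLinear B (P.complex.d (n + 1) n).hom
  d_d n x := by
    obtain ⟨m, rfl⟩ := mk_surjective B x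
    rw [mapLinear_mk, mapLinear_mk, resolution_d_d, map_zero]
  d_mem := by
    rintro n s _ ⟨m, hm, rfl⟩
    rw [mapLinear_mk]
    exact mk_mem_gr _ (X.d_mem n s m hm)
  d_act n g x := by
    obtain ⟨m, rfl⟩ := mk_surjective B x
    rw [ydModule_act_mk, mapLinear_mk, mapLinear_mk, ydModule_act_mk, X.d_act]
  aug := coinvariantsAug B P
  aug_smul := form_mem_counitHoms _
  aug_d x := by
    obtain ⟨m, rfl⟩ := mk_surjective B x
    rw [mapLinear_mk, coinvariantsAug_mk, resolution_aug_d, map_zero]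
  aug_mem := by
    rintro s hs _ ⟨m, hm, rfl⟩
    rw [coinvariantsAug_mk]
    exact B.counit_eq_zero s _ hs (X.aug_mem s m hm)
  aug_act g x := by
    obtain ⟨m, rfl⟩ := mk_surjective B x
    rw [ydModule_act_mk, coinvariantsAug_mk, coinvariantsAug_mk]
    exact (congrArg _ (X.aug_act g m)).trans (B.counit_act g _)
  base := RightCoinvariants.mk B (resolutionBase P)
  aug_base := by rw [coinvariantsAug_mk, resolutionAug_base, B.counit_one]
  htpy n := RightCoinvariants.map B (X.contraction hX n) (X.contraction_right hX n)
  d_htpy_zero x := by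
    obtain ⟨m, rfl⟩ := mk_surjective B x
    rw [map_mk, mapLinear_mk, X.d_contraction_zero, map_sub, mk_right_smul, coinvariantsAug_mk]
  d_htpy_succ n x := by
    obtain ⟨m, rfl⟩ := mk_surjective B x
    rw [map_mk, mapLinear_mk, X.d_contraction_succ, map_sub, mapLinear_mk, map_mk]
  projective n := by
    obtain ⟨V, _, _, grV, e, _, _, he, _⟩ := hX n
    obtain ⟨β, hβ⟩ := exists_bijective_of_equiv B e he
    exact Module.Projective.of_equiv (LinearEquiv.ofBijective β hβ)
  finite n := by
    obtain ⟨V, _, _, grV, e, _, _, he, _⟩ := hX n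
    obtain ⟨β, hβ⟩ := exists_bijective_of_equiv B e he
    exact Module.Finite.of_surjective β hβ.2

end LeftResolution

/-! ### Hochschild cohomology as the cohomology of the left resolution -/

section Hochschild

/-- Cochains of degree `0` have no coboundaries. -/
theorem CategoryTheory.ProjectiveResolution.extMk_zero_eq_zero_iff {C : Type*} [Category C]
    [Abelian C] [HasExt C] {X Y : C} (R : ProjectiveResolution X) (f : R.complex.X 0 ⟶ Y)
    (hf : R.complex.d 1 0 ≫ f = 0) : R.extMk f 1 rfl hf = 0 ↔ f = 0 := by
  simp only [← R.extEquivCohomologyClass.apply_eq_iff_eq,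
    ProjectiveResolution.extEquivCohomologyClass_extMk,
    ProjectiveResolution.extEquivCohomologyClass_zero,
    CochainComplex.HomComplex.CohomologyClass.mk_eq_zero_iff]
  rw [CochainComplex.HomComplex.Cocycle.toSingleMk_mem_coboundaries_iff _ _ _ _ _ 1 (by lia)]
  have h : CategoryTheory.Limits.IsZero (R.cochainComplex.X 1) :=
    R.cochainComplex.isZero_of_isStrictlyLE 0 1 (by lia)
  refine ⟨fun ⟨g, hg⟩ => ?_, fun hf => ⟨0, ?_⟩⟩
  · rw [← cancel_epi (R.cochainComplexXIso (-(0 : ℕ)) 0 rfl).hom]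
    rw [h.eq_of_src g 0] at hg
    simpa using hg.symm
  · simp [hf]

variable {k : Type u} [Field k] {G : Type v} [CommGroup G] [DecidableEq G]
  {A : Type u} [Ring A] [Algebra k A] [Coalgebra k A] {B : YDBimonoid k G A}
  {P : ProjectiveResolution (regBimod k A)}

open RightCoinvariants

theorem homToLinear_injective {M : ModuleCat.{u} (A ⊗[k] Aᵐᵒᵖ)} {R : Type u} [Ring R] [Algebra k R]
    (ρ : A →ₐ[k] R) : Function.Injective (homToLinear ρ : (M ⟶ algBimod ρ) → (M →ₗ[k] R)) :=
  fun f g h => by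
    ext x
    exact (AlgBimodule.toAlg ρ).injective (LinearMap.congr_fun h x)

theorem homToLinear_smul_hom {M : ModuleCat.{u} (A ⊗[k] Aᵐᵒᵖ)} {R : Type u} [Ring R] [Algebra k R]
    (ρ : A →ₐ[k] R) (c : k) (f : M ⟶ algBimod ρ) :
    homToLinear ρ (c • f) = c • homToLinear ρ f := by
  ext x
  have h : homToLinear ρ (c • f) x = homToLinear ρ f (c • x) :=
    congrArg (AlgBimodule.toAlg ρ) (f.hom.map_smul (algebraMap k (A ⊗[k] Aᵐᵒᵖ) c) x).symm
  rw [h, map_smul]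
  rfl

theorem form_ofForm {M : ModuleCat.{u} (A ⊗[k] Aᵐᵒᵖ)} (f : RightCoinvariants B M →ₗ[k] k)
    (hf) : form B (ofForm f hf) = f := by
  ext x
  obtain ⟨m, rfl⟩ := mk_surjective B x
  rw [form_mk, homToLinear_ofForm]

theorem ofForm_form {M : ModuleCat.{u} (A ⊗[k] Aᵐᵒᵖ)} (f : M ⟶ algBimod B.aug) :
    ofForm (form B f) (form_mem_counitHoms f) = f :=
  homToLinear_injective B.aug (LinearMap.ext fun x => by rw [homToLinear_ofForm, form_mk])

variable (X : YDResolution B P) (hX : ∀ n, (X.yd n).IsFiniteGradedFree)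

theorem form_mem_cocycle {n : ℕ} {f : P.complex.X n ⟶ algBimod B.aug}
    (hf : P.complex.d (n + 1) n ≫ f = 0) : form B f ∈ (X.leftResolution hX).cocycle n := by
  refine (YDLeftResolution.mem_cocycle _).2 ⟨form_mem_counitHoms f, fun x => ?_⟩
  obtain ⟨m, rfl⟩ := mk_surjective B x
  change form B f (mapLinear B _ (mk B m)) = 0
  rw [mapLinear_mk, form_mk]
  exact congrArg (fun φ => homToLinear B.aug φ m) hf

theorem d_comp_ofForm {n : ℕ} {f : RightCoinvariants B (P.complex.X n) →ₗ[k] k}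
    (hf : f ∈ (X.leftResolution hX).cocycle n) :
    P.complex.d (n + 1) n ≫
      ofForm f ((YDLeftResolution.mem_cocycle (X.leftResolution hX)).1 hf).1 = 0 :=
  homToLinear_injective B.aug (LinearMap.ext fun x =>
    (congrArg f (mapLinear_mk B (P.complex.d (n + 1) n).hom x)).symm.trans
      (((YDLeftResolution.mem_cocycle (X.leftResolution hX)).1 hf).2 (mk B x)))

theorem extMk_congr {Y : ModuleCat.{u} (A ⊗[k] Aᵐᵒᵖ)} {n : ℕ} {f f' : P.complex.X n ⟶ Y}
    (h : f = f') (hf : P.complex.d (n + 1) n ≫ f = 0) (hf' : P.complex.d (n + 1) n ≫ f' = 0) :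
    P.extMk f (n + 1) rfl hf = P.extMk f' (n + 1) rfl hf' := by
  subst h
  rfl

theorem smul_extMk {Y : ModuleCat.{u} (A ⊗[k] Aᵐᵒᵖ)} {n : ℕ} (c : k) (f : P.complex.X n ⟶ Y)
    (hf : P.complex.d (n + 1) n ≫ f = 0) (hf' : P.complex.d (n + 1) n ≫ (c • f) = 0) :
    P.extMk (c • f) (n + 1) rfl hf' = c • P.extMk f (n + 1) rfl hf := by
  rw [Abelian.Ext.smul_eq_comp_mk₀, P.extMk_comp_mk₀]
  exact extMk_congr (by rw [Linear.comp_smul, Category.comp_id]) _ _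

/-- The class in `Ext` of a cocycle of the left resolution. -/
def extClassFun (n : ℕ) (z : (X.leftResolution hX).cocycle n) : HochschildCohomology B.aug n :=
  P.extMk (ofForm z.1 ((YDLeftResolution.mem_cocycle (X.leftResolution hX)).1 z.2).1) (n + 1) rfl
    (d_comp_ofForm X hX z.2)

theorem extClassFun_add (n : ℕ) (z z' : (X.leftResolution hX).cocycle n) :
    extClassFun X hX n (z + z') = extClassFun X hX n z + extClassFun X hX n z' := by
  refine Eq.trans ?_ (P.add_extMk _ _ (n + 1) rfl (d_comp_ofForm X hX z.2)
    (d_comp_ofForm X hX z'.2)).symm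
  exact extMk_congr (homToLinear_injective B.aug rfl) _ _

theorem extClassFun_smul (n : ℕ) (c : k) (z : (X.leftResolution hX).cocycle n) :
    extClassFun X hX n (c • z) = c • extClassFun X hX n z := by
  refine Eq.trans ?_ (smul_extMk c _ (d_comp_ofForm X hX z.2) (by
    rw [Linear.comp_smul, d_comp_ofForm X hX z.2, smul_zero]))
  refine extMk_congr (homToLinear_injective B.aug ?_) _ _
  rw [homToLinear_smul_hom]
  rfl

/-- `extClassFun` as a linear map. -/
def extClass (n : ℕ) : (X.leftResolution hX).cocycle n →ₗ[k] HochschildCohomology B.aug n where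
  toFun := extClassFun X hX n
  map_add' := extClassFun_add X hX n
  map_smul' := extClassFun_smul X hX n

theorem extClass_form {n : ℕ} {f : P.complex.X n ⟶ algBimod B.aug}
    (hf : P.complex.d (n + 1) n ≫ f = 0) :
    extClass X hX n ⟨form B f, form_mem_cocycle X hX hf⟩ = P.extMk f (n + 1) rfl hf := by
  exact extMk_congr (ofForm_form f) (d_comp_ofForm X hX (form_mem_cocycle X hX hf)) hf

theorem extClass_eq_zero_iff (n : ℕ) (z : (X.leftResolution hX).cocycle n) :
    extClass X hX n z = 0 ↔ (z : _ →ₗ[k] k) ∈ (X.leftResolution hX).coboundary n := by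
  change extClassFun X hX n z = 0 ↔ _
  unfold extClassFun
  cases n with
  | zero =>
    refine (P.extMk_zero_eq_zero_iff _ _).trans ⟨fun h => ?_, fun h => ?_⟩
    · refine (Submodule.mem_bot k).2 ?_
      rw [← form_ofForm z.1 ((YDLeftResolution.mem_cocycle _).1 z.2).1, h]
      ext x
      obtain ⟨m, rfl⟩ := mk_surjective B x
      exact form_mk 0 m
    · have h' : (z : _ →ₗ[k] k) ∈ (⊥ : Submodule k (RightCoinvariants B (P.complex.X 0) →ₗ[k] k)) := h
      rw [Submodule.mem_bot] at h'
      refine homToLinear_injective B.aug (LinearMap.ext fun x => ?_)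
      exact LinearMap.congr_fun h' (mk B x)
  | succ n =>
    refine (P.extMk_eq_zero_iff _ _ _ _ n rfl).trans ⟨fun ⟨g, hg⟩ => ?_, fun ⟨g, hg, h⟩ => ?_⟩
    · refine ⟨form B g, form_mem_counitHoms g, ?_⟩
      ext x
      obtain ⟨m, rfl⟩ := mk_surjective B x
      change form B g (mapLinear B _ (mk B m)) = _
      rw [mapLinear_mk, form_mk]
      exact congrArg (fun φ => homToLinear B.aug φ m) hg
    · refine ⟨ofForm g hg, homToLinear_injective B.aug (LinearMap.ext fun x => ?_)⟩
      rw [homToLinear_ofForm, ← h]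
      exact (congrArg g (mapLinear_mk B (P.complex.d (n + 1) n).hom x)).symm

/-- Hochschild cohomology with trivial coefficients is the cohomology of the complex of linear
forms on the left resolution. -/
def hochschildModel : (X.leftResolution hX).CohomologyModel (HochschildCohomology B.aug) where
  cls := extClass X hX
  surjective n α := by
    obtain ⟨f, hf, rfl⟩ := P.extMk_surjective α (n + 1) rfl
    exact ⟨_, extClass_form X hX hf⟩
  cls_eq_zero_iff := extClass_eq_zero_iff X hX

end Hochschild

/-! ### Bimodule maps out of a tensor product over `A` -/

section TensorOverMaps

variable {k : Type u} [Field k] {A : Type u} [Ring A] [Algebra k A]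
  {M : Type u} [AddCommGroup M] [Module k M] [Module (A ⊗[k] Aᵐᵒᵖ) M]
  [IsScalarTower k (A ⊗[k] Aᵐᵒᵖ) M]
  {N : Type u} [AddCommGroup N] [Module k N] [Module (A ⊗[k] Aᵐᵒᵖ) N]
  [IsScalarTower k (A ⊗[k] Aᵐᵒᵖ) N]

namespace TensorOver

instance : IsScalarTower k (A ⊗[k] Aᵐᵒᵖ) (TensorOver k A M N) :=
  ⟨fun c e x => by
    change TensorOver.actionHom k A M N (c • e) x = c • TensorOver.actionHom k A M N e x
    rw [map_smul]
    rfl⟩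

/-- A linear map out of `M ⊗_A N` that is compatible with the bimodule structures on pure
tensors, as a bimodule map. -/
def envLinear {L : Type u} [AddCommGroup L] [Module k L] [Module (A ⊗[k] Aᵐᵒᵖ) L]
    (F : TensorOver k A M N →ₗ[k] L)
    (hF : ∀ (a b : A) m n, F ((a ⊗ₜ[k] op b : A ⊗[k] Aᵐᵒᵖ) • tmul k A m n) =
      (a ⊗ₜ[k] op b : A ⊗[k] Aᵐᵒᵖ) • F (tmul k A m n)) :
    TensorOver k A M N →ₗ[A ⊗[k] Aᵐᵒᵖ] L where
  toFun := F
  map_add' := map_add F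
  map_smul' e x := by
    rw [RingHom.id_apply]
    induction x using TensorOver.induction with
    | h0 => rw [smul_zero, map_zero, smul_zero]
    | ha x y hx hy => rw [smul_add, map_add, hx, hy, map_add, smul_add]
    | ht m n =>
      induction e with
      | zero =>
        have h₁ : (0 : A ⊗[k] Aᵐᵒᵖ) • tmul k A m n = 0 := zero_smul (A ⊗[k] Aᵐᵒᵖ) (tmul k A m n)
        have h₂ : (0 : A ⊗[k] Aᵐᵒᵖ) • F (tmul k A m n) = 0 :=
          zero_smul (A ⊗[k] Aᵐᵒᵖ) (F (tmul k A m n))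
        rw [h₁, h₂, map_zero]
      | tmul a b => exact hF a b.unop m n
      | add e e' he he' => rw [add_smul, map_add, he, he', add_smul]

/-- `TensorOver.map` as a bimodule map. -/
def envMap {M' : Type u} [AddCommGroup M'] [Module k M'] [Module (A ⊗[k] Aᵐᵒᵖ) M']
    [IsScalarTower k (A ⊗[k] Aᵐᵒᵖ) M'] {N' : Type u} [AddCommGroup N'] [Module k N']
    [Module (A ⊗[k] Aᵐᵒᵖ) N'] [IsScalarTower k (A ⊗[k] Aᵐᵒᵖ) N']
    (φ : M →ₗ[A ⊗[k] Aᵐᵒᵖ] M') (ψ : N →ₗ[A ⊗[k] Aᵐᵒᵖ] N') :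
    TensorOver k A M N →ₗ[A ⊗[k] Aᵐᵒᵖ] TensorOver k A M' N' :=
  envLinear (TensorOver.map φ ψ) fun a b m n => by
    rw [env_smul_tmul, map_tmul, map_tmul, env_smul_tmul, φ.map_smul, ψ.map_smul]

/-- The map `f ⊗ 1 : M ⊗_A N → M' ⊗_A N` for `f` compatible with the right actions. -/
def mapRight {M' : Type u} [AddCommGroup M'] [Module k M'] [Module (A ⊗[k] Aᵐᵒᵖ) M']
    [IsScalarTower k (A ⊗[k] Aᵐᵒᵖ) M'] (f : M →ₗ[k] M') (hf : IsRightLinear (A := A) f)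
    (N : Type u) [AddCommGroup N] [Module k N] [Module (A ⊗[k] Aᵐᵒᵖ) N]
    [IsScalarTower k (A ⊗[k] Aᵐᵒᵖ) N] :
    TensorOver k A M N →ₗ[k] TensorOver k A M' N :=
  TensorOver.lift (M := M) (N := N) ((tensorOverRel k A M' N).mkQ ∘ₗ LinearMap.rTensor N f) (by
    intro m a n
    have := TensorOver.tmul_balanced (k := k) (f m) a n
    rw [← hf] at this
    exact this)

theorem mapRight_tmul {M' : Type u} [AddCommGroup M'] [Module k M'] [Module (A ⊗[k] Aᵐᵒᵖ) M']
    [IsScalarTower k (A ⊗[k] Aᵐᵒᵖ) M'] (f : M →ₗ[k] M') (hf : IsRightLinear (A := A) f)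
    (m : M) (n : N) : mapRight f hf N (tmul k A m n) = tmul k A (f m) n :=
  TensorOver.lift_tmul _ _ m n

/-- The linear map underlying `TensorOver.contractLeft`. -/
def contractLinear (π : M →ₗ[k] A)
    (hπ : ∀ (a b : A) m, π ((a ⊗ₜ[k] op b : A ⊗[k] Aᵐᵒᵖ) • m) = a * π m * b)
    (N : Type u) [AddCommGroup N] [Module k N] [Module (A ⊗[k] Aᵐᵒᵖ) N]
    [IsScalarTower k (A ⊗[k] Aᵐᵒᵖ) N] : TensorOver k A M N →ₗ[k] N :=
  TensorOver.lift (M := M) (N := N) (TensorProduct.lift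
    ((Algebra.lsmul k k N : A ⊗[k] Aᵐᵒᵖ →ₐ[k] Module.End k N).toLinearMap ∘ₗ
      (Algebra.TensorProduct.includeLeft : A →ₐ[k] A ⊗[k] Aᵐᵒᵖ).toLinearMap ∘ₗ π)) (by
    intro m a n
    change (π ((1 ⊗ₜ[k] op a : A ⊗[k] Aᵐᵒᵖ) • m) ⊗ₜ[k] 1 : A ⊗[k] Aᵐᵒᵖ) • n =
      (π m ⊗ₜ[k] 1 : A ⊗[k] Aᵐᵒᵖ) • (a ⊗ₜ[k] 1 : A ⊗[k] Aᵐᵒᵖ) • n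
    rw [hπ, smul_smul]
    simp)

theorem contractLinear_tmul (π : M →ₗ[k] A) (hπ) (m : M) (n : N) :
    contractLinear π hπ N (tmul k A m n) = (π m ⊗ₜ[k] 1 : A ⊗[k] Aᵐᵒᵖ) • n :=
  TensorOver.lift_tmul _ _ m n

/-- For a bimodule map `π : M → A`, the bimodule map `M ⊗_A N → N`, `m ⊗ n ↦ π(m) n`. -/
def contractLeft (π : M →ₗ[k] A)
    (hπ : ∀ (a b : A) m, π ((a ⊗ₜ[k] op b : A ⊗[k] Aᵐᵒᵖ) • m) = a * π m * b)
    (N : Type u) [AddCommGroup N] [Module k N] [Module (A ⊗[k] Aᵐᵒᵖ) N]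
    [IsScalarTower k (A ⊗[k] Aᵐᵒᵖ) N] : TensorOver k A M N →ₗ[A ⊗[k] Aᵐᵒᵖ] N :=
  envLinear (contractLinear π hπ N) fun a b m n => by
    have h : π ((a ⊗ₜ[k] 1 : A ⊗[k] Aᵐᵒᵖ) • m) = a * π m * 1 := hπ a 1 m
    rw [env_smul_tmul, contractLinear_tmul, contractLinear_tmul, h, smul_smul, smul_smul]
    simp

theorem contractLeft_tmul (π : M →ₗ[k] A) (hπ) (m : M) (n : N) :
    contractLeft π hπ N (tmul k A m n) = (π m ⊗ₜ[k] 1 : A ⊗[k] Aᵐᵒᵖ) • n :=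
  contractLinear_tmul π hπ m n

theorem sub_tmul (m m' : M) (n : N) :
    tmul k A (m - m') n = tmul k A m n - tmul k A m' n := by
  rw [eq_sub_iff_add_eq, ← add_tmul, sub_add_cancel]

theorem tmul_zero (m : M) : tmul k A m (0 : N) = 0 := by
  rw [← zero_smul k (0 : N), tmul_smul, zero_smul]

end TensorOver

end TensorOverMaps

/-! ### Existence of diagonals -/

section DiagonalExistence

variable {k : Type u} [Field k] {A : Type u} [Ring A] [Algebra k A]

section Rows

variable {M : ℕ → Type u} [∀ n, AddCommGroup (M n)] [∀ n, Module k (M n)]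
  [∀ n, Module (A ⊗[k] Aᵐᵒᵖ) (M n)] [∀ n, IsScalarTower k (A ⊗[k] Aᵐᵒᵖ) (M n)]
  (d : ∀ n, M (n + 1) →ₗ[A ⊗[k] Aᵐᵒᵖ] M n)

/-- The differential `d ⊗ 1` of the double complex `M ⊗_A M`. -/
def rowDifferential (p q : ℕ) :
    TensorOver k A (M (p + 1)) (M q) →ₗ[A ⊗[k] Aᵐᵒᵖ] TensorOver k A (M p) (M q) :=
  TensorOver.envMap (d p) LinearMap.id

/-- The differential `(-1)^p (1 ⊗ d)` of the double complex `M ⊗_A M`. -/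
def columnDifferential (p q : ℕ) :
    TensorOver k A (M p) (M (q + 1)) →ₗ[A ⊗[k] Aᵐᵒᵖ] TensorOver k A (M p) (M q) :=
  (-1 : k) ^ p • TensorOver.envMap LinearMap.id (d q)

theorem rowDifferential_tmul (p q : ℕ) (m : M (p + 1)) (n : M q) :
    rowDifferential d p q (TensorOver.tmul k A m n) = TensorOver.tmul k A (d p m) n :=
  TensorOver.map_tmul (d p) LinearMap.id m n

theorem columnDifferential_tmul (p q : ℕ) (m : M p) (n : M (q + 1)) :
    columnDifferential d p q (TensorOver.tmul k A m n) =
      (-1 : k) ^ p • TensorOver.tmul k A m (d q n) :=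
  congrArg ((-1 : k) ^ p • ·) (TensorOver.map_tmul LinearMap.id (d q) m n)

variable {π : M 0 →ₗ[k] A} (hπ : ∀ (a b : A) x, π ((a ⊗ₜ[k] op b : A ⊗[k] Aᵐᵒᵖ) • x) = a * π x * b)

theorem contractLeft_rowDifferential (hπd : ∀ x, π (d 0 x) = 0) (q : ℕ)
    (x : TensorOver k A (M 1) (M q)) :
    TensorOver.contractLeft π hπ (M q) (rowDifferential d 0 q x) = 0 := by
  induction x using TensorOver.induction with
  | h0 => rw [map_zero, map_zero]
  | ha x y hx hy => rw [map_add, map_add, hx, hy, add_zero]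
  | ht m n =>
    rw [rowDifferential_tmul, TensorOver.contractLeft_tmul, hπd, TensorProduct.zero_tmul]
    exact zero_smul (A ⊗[k] Aᵐᵒᵖ) n

theorem contractLeft_columnDifferential (q : ℕ) (x : TensorOver k A (M 0) (M (q + 1))) :
    TensorOver.contractLeft π hπ (M q) (columnDifferential d 0 q x) =
      d q (TensorOver.contractLeft π hπ (M (q + 1)) x) := by
  induction x using TensorOver.induction with
  | h0 => simp only [map_zero]
  | ha x y hx hy => simp only [map_add, hx, hy]
  | ht m n =>
    rw [columnDifferential_tmul, pow_zero, one_smul, TensorOver.contractLeft_tmul,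
      TensorOver.contractLeft_tmul]
    exact ((d q).map_smul _ _).symm

variable {s : ∀ n, M n →ₗ[k] M (n + 1)} (hsr : ∀ n, IsRightLinear (A := A) (s n))

theorem columnDifferential_mapRight (p q : ℕ) (x : TensorOver k A (M p) (M (q + 1))) :
    columnDifferential d (p + 1) q (TensorOver.mapRight (s p) (hsr p) (M (q + 1)) x) =
      -TensorOver.mapRight (s p) (hsr p) (M q) (columnDifferential d p q x) := by
  induction x using TensorOver.induction with
  | h0 => simp only [map_zero, neg_zero]
  | ha x y hx hy => simp only [map_add, hx, hy, neg_add]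
  | ht m n =>
    rw [TensorOver.mapRight_tmul, columnDifferential_tmul, columnDifferential_tmul, map_smul,
      TensorOver.mapRight_tmul, pow_succ, mul_neg_one, neg_smul]

theorem rowDifferential_mapRight_zero {σ : M 0}
    (hs₀ : ∀ x, d 0 (s 0 x) = x - (1 ⊗ₜ[k] op (π x) : A ⊗[k] Aᵐᵒᵖ) • σ) (q : ℕ)
    (x : TensorOver k A (M 0) (M q)) :
    rowDifferential d 0 q (TensorOver.mapRight (s 0) (hsr 0) (M q) x) =
      x - TensorOver.tmul k A σ (TensorOver.contractLeft π hπ (M q) x) := by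
  induction x using TensorOver.induction with
  | h0 => simp only [map_zero, TensorOver.tmul_zero, sub_zero]
  | ha x y hx hy => rw [map_add, map_add, hx, hy, map_add, TensorOver.tmul_add]; abel
  | ht m n =>
    rw [TensorOver.mapRight_tmul, rowDifferential_tmul, hs₀, TensorOver.contractLeft_tmul,
      ← TensorOver.tmul_balanced, TensorOver.sub_tmul]

theorem rowDifferential_mapRight_succ
    (hs : ∀ n x, d (n + 1) (s (n + 1) x) = x - s n (d n x)) (p q : ℕ)
    (x : TensorOver k A (M (p + 1)) (M q)) :
    rowDifferential d (p + 1) q (TensorOver.mapRight (s (p + 1)) (hsr (p + 1)) (M q) x) =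
      x - TensorOver.mapRight (s p) (hsr p) (M q) (rowDifferential d p q x) := by
  induction x using TensorOver.induction with
  | h0 => simp only [map_zero, sub_zero]
  | ha x y hx hy => simp only [map_add, hx, hy]; abel
  | ht m n =>
    rw [TensorOver.mapRight_tmul, rowDifferential_tmul, rowDifferential_tmul, hs,
      TensorOver.mapRight_tmul, TensorOver.sub_tmul]

/-- A resolution `M → A` that is contractible as a complex of right modules has a chain map
`M → M ⊗_A M` with a prescribed lowest term. -/
theorem exists_chainMap_tensorOver [∀ n, Module.Projective (A ⊗[k] Aᵐᵒᵖ) (M n)]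
    (hd : ∀ n x, d n (d (n + 1) x) = 0) (hex : ∀ n x, d n x = 0 → ∃ y, d (n + 1) y = x)
    (hπd : ∀ x, π (d 0 x) = 0) (hex₀ : ∀ x, π x = 0 → ∃ y, d 0 y = x) {σ : M 0}
    (hsr : ∀ n, IsRightLinear (A := A) (s n))
    (hs₀ : ∀ x, d 0 (s 0 x) = x - (1 ⊗ₜ[k] op (π x) : A ⊗[k] Aᵐᵒᵖ) • σ)
    (hs : ∀ n x, d (n + 1) (s (n + 1) x) = x - s n (d n x))
    (φ₀ : M 0 →ₗ[A ⊗[k] Aᵐᵒᵖ] TensorOver k A (M 0) (M 0))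
    (hφ₀ : ∀ x, π (TensorOver.contractLeft π hπ (M 0) (φ₀ x)) = π x) :
    ∃ φ : ∀ p q n, M n →ₗ[A ⊗[k] Aᵐᵒᵖ] TensorOver k A (M p) (M q), φ 0 0 0 = φ₀ ∧
      ∀ p q n x, φ p q n (d n x) = rowDifferential d p q (φ (p + 1) q (n + 1) x) +
        columnDifferential d p q (φ p (q + 1) (n + 1) x) :=
  exists_chainMap_total (M := fun p q => TensorOver k A (M p) (M q)) (N := M) (P := M) d hd
    (rowDifferential d) (columnDifferential d) (fun q => (d q).toAddMonoidHom)
    (fun q => (TensorOver.contractLeft π hπ (M q)).toAddMonoidHom)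
    (fun q => AddMonoidHom.mk' (TensorOver.tmul k A σ) (TensorOver.tmul_add σ))
    (fun p q => (TensorOver.mapRight (s p) (hsr p) (M q)).toAddMonoidHom)
    (contractLeft_rowDifferential d hπ hπd) (contractLeft_columnDifferential d hπ)
    (fun q y => (columnDifferential_tmul d 0 q σ y).trans (by rw [pow_zero, one_smul]; rfl))
    (columnDifferential_mapRight d hsr) (rowDifferential_mapRight_zero d hπ hsr hs₀)
    (rowDifferential_mapRight_succ d hsr hs) hex φ₀
    (fun x => hex₀ _ ((hφ₀ _).trans (hπd x)))

end Rows

variable {P : ProjectiveResolution (regBimod k A)}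

/-- The contraction `P_0 ⊗_A P_0 → P_0` followed by the augmentation is the product of
augmentations. -/
theorem resolutionAug_contractLeft (x : TensorOver k A (P.complex.X 0) (P.complex.X 0)) :
    resolutionAug P (TensorOver.contractLeft (resolutionAug P) (resolutionAug_smul P) _ x) =
      tensorMul (AlgHom.id k A) (P.π.f 0) (P.π.f 0) x := by
  induction x using TensorOver.induction with
  | h0 => simp
  | ha x y hx hy => rw [map_add, map_add, hx, hy, map_add]
  | ht m n =>
    rw [TensorOver.contractLeft_tmul]
    exact (homToLinear_left _ (P.π.f 0) _ _).trans
      (tensorMul_tmul (AlgHom.id k A) (P.π.f 0) (P.π.f 0) m n).symm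

/-- A diagonal exists as soon as the resolution is contractible as a complex of right modules. -/
theorem nonempty_diagonal_of_contraction (σ : P.complex.X 0) (hσ : resolutionAug P σ = 1)
    (s : ∀ n, P.complex.X n →ₗ[k] P.complex.X (n + 1)) (hsr : ∀ n, IsRightLinear (A := A) (s n))
    (hs₀ : ∀ x, (P.complex.d 1 0).hom (s 0 x) = x -
      (1 ⊗ₜ[k] op (resolutionAug P x) : A ⊗[k] Aᵐᵒᵖ) • σ)
    (hs : ∀ n x, (P.complex.d (n + 2) (n + 1)).hom (s (n + 1) x) =
      x - s n ((P.complex.d (n + 1) n).hom x)) : Nonempty (Diagonal P) := by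
  have := resolution_projective P
  obtain ⟨φ₀, hφ₀⟩ := Module.Projective.exists_lift_of_mem_range
    (tensorMulHom (AlgHom.id k A) (P.π.f 0) (P.π.f 0)) (P.π.f 0).hom
    (fun x => ⟨TensorOver.tmul k A σ x, by
      apply (AlgBimodule.toAlg (AlgHom.id k A)).injective
      refine (tensorMul_tmul (AlgHom.id k A) (P.π.f 0) (P.π.f 0) σ x).trans ?_
      change resolutionAug P σ * resolutionAug P x = _
      rw [hσ, one_mul]
      rfl⟩)
  have hφ₀' (x : P.complex.X 0) :
      tensorMul (AlgHom.id k A) (P.π.f 0) (P.π.f 0) (φ₀ x) = resolutionAug P x :=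
    congrArg (AlgBimodule.toAlg (AlgHom.id k A)) (hφ₀ x)
  obtain ⟨φ, h₀, h⟩ := exists_chainMap_tensorOver (M := fun n => P.complex.X n)
    (fun n => (P.complex.d (n + 1) n).hom) (resolutionAug_smul P) (resolution_d_d P)
    (resolution_exact P) (resolution_aug_d P) (resolution_exact_zero P) hsr hs₀ hs φ₀
    (fun x => (resolutionAug_contractLeft _).trans (hφ₀' x))
  exact ⟨{ map := fun p q n _ => φ p q n
           comm := fun p q n _ x => h p q n x
           aug := fun x => by rw [h₀]; exact hφ₀' x }⟩

end DiagonalExistence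

/-! ### The cup product as a Yoneda product -/

section ContractRight

variable {k : Type u} [Field k] {G : Type v} [CommGroup G] [DecidableEq G]
  {A : Type u} [Ring A] [Algebra k A] [Coalgebra k A] (B : YDBimonoid k G A)
  {M : Type u} [AddCommGroup M] [Module k M] [Module (A ⊗[k] Aᵐᵒᵖ) M]
  [IsScalarTower k (A ⊗[k] Aᵐᵒᵖ) M]

open RightCoinvariants

/-- For a bimodule map `f : N → k`, the map `M ⊗_A N → M ⊗_A k`, `m ⊗ n ↦ f(n) [m]`. -/
def TensorOver.contractRight {N : ModuleCat.{u} (A ⊗[k] Aᵐᵒᵖ)} (f : N ⟶ algBimod B.aug)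
    (M : Type u) [AddCommGroup M] [Module k M] [Module (A ⊗[k] Aᵐᵒᵖ) M]
    [IsScalarTower k (A ⊗[k] Aᵐᵒᵖ) M] : TensorOver k A M N →ₗ[k] RightCoinvariants B M :=
  TensorOver.lift (M := M) (N := N)
    ((TensorProduct.rid k _).toLinearMap ∘ₗ TensorProduct.map (mk B) (homToLinear B.aug f)) (by
    intro m a n
    have h : homToLinear B.aug f ((a ⊗ₜ[k] 1 : A ⊗[k] Aᵐᵒᵖ) • n) =
        Coalgebra.counit (R := k) a * homToLinear B.aug f n := homToLinear_left B.aug f a n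
    simp only [LinearMap.comp_apply, TensorProduct.map_tmul, LinearEquiv.coe_coe,
      TensorProduct.rid_tmul]
    rw [h, mk_right_smul, smul_smul, mul_comm])

theorem TensorOver.contractRight_tmul {N : ModuleCat.{u} (A ⊗[k] Aᵐᵒᵖ)} (f : N ⟶ algBimod B.aug)
    (m : M) (n : N) :
    TensorOver.contractRight B f M (TensorOver.tmul k A m n) = homToLinear B.aug f n • mk B m :=
  TensorOver.lift_tmul _ _ m n

theorem TensorOver.contractRight_right_smul {N : ModuleCat.{u} (A ⊗[k] Aᵐᵒᵖ)}
    (f : N ⟶ algBimod B.aug) (a : A) (x : TensorOver k A M N) :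
    TensorOver.contractRight B f M ((1 ⊗ₜ[k] op a : A ⊗[k] Aᵐᵒᵖ) • x) =
      Coalgebra.counit (R := k) a • TensorOver.contractRight B f M x := by
  induction x using TensorOver.induction with
  | h0 => simp
  | ha x y hx hy => rw [smul_add, map_add, hx, hy, map_add, smul_add]
  | ht m n =>
    rw [TensorOver.env_smul_tmul, contractRight_tmul, contractRight_tmul, homToLinear_right,
      ← Algebra.TensorProduct.one_def, one_smul, mul_comm, mul_smul]
    rfl

theorem TensorOver.contractRight_left_smul {N : ModuleCat.{u} (A ⊗[k] Aᵐᵒᵖ)}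
    (f : N ⟶ algBimod B.aug) (a : A) (x : TensorOver k A M N) :
    TensorOver.contractRight B f M ((a ⊗ₜ[k] 1 : A ⊗[k] Aᵐᵒᵖ) • x) =
      a • TensorOver.contractRight B f M x := by
  induction x using TensorOver.induction with
  | h0 => simp
  | ha x y hx hy => rw [smul_add, map_add, hx, hy, map_add, smul_add]
  | ht m n =>
    have h := TensorOver.env_smul_tmul (k := k) a 1 m n
    rw [MulOpposite.op_one, ← Algebra.TensorProduct.one_def, one_smul] at h
    rw [h, contractRight_tmul, contractRight_tmul, ← smul_mk, smul_algebra_smul_comm]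

theorem TensorOver.contractRight_map_left {M' : Type u} [AddCommGroup M'] [Module k M']
    [Module (A ⊗[k] Aᵐᵒᵖ) M'] [IsScalarTower k (A ⊗[k] Aᵐᵒᵖ) M']
    {N : ModuleCat.{u} (A ⊗[k] Aᵐᵒᵖ)} (f : N ⟶ algBimod B.aug) (φ : M →ₗ[A ⊗[k] Aᵐᵒᵖ] M')
    (x : TensorOver k A M N) :
    TensorOver.contractRight B f M' (TensorOver.map φ LinearMap.id x) =
      mapLinear B φ (TensorOver.contractRight B f M x) := by
  induction x using TensorOver.induction with
  | h0 => simp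
  | ha x y hx hy => rw [map_add, map_add, hx, hy, map_add, map_add]
  | ht m n =>
    rw [TensorOver.map_tmul, contractRight_tmul, contractRight_tmul, LinearMap.map_smul_of_tower,
      mapLinear_mk]
    rfl

theorem TensorOver.contractRight_map_right {N N' : ModuleCat.{u} (A ⊗[k] Aᵐᵒᵖ)}
    (f : N ⟶ algBimod B.aug) (φ : N' ⟶ N) (h : φ ≫ f = 0) (x : TensorOver k A M N') :
    TensorOver.contractRight B f M (TensorOver.map LinearMap.id φ.hom x) = 0 := by
  induction x using TensorOver.induction with
  | h0 => simp
  | ha x y hx hy => rw [map_add, map_add, hx, hy, add_zero]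
  | ht m n =>
    have h' : homToLinear B.aug f (φ.hom n) = 0 := congrArg (fun ψ => homToLinear B.aug ψ n) h
    rw [TensorOver.map_tmul, contractRight_tmul, h', zero_smul]

end ContractRight

section Cup

variable {k : Type u} [Field k] {A : Type u} [Ring A] [Algebra k A]
  {P : ProjectiveResolution (regBimod k A)}

/-- The chain map `(π ⊗ 1) ∘ ω : P → P` attached to a diagonal `ω`. It lifts the identity of `A`,
but need not be the identity. -/
def Diagonal.leftCounit (ω : Diagonal P) (n : ℕ) :
    P.complex.X n →ₗ[A ⊗[k] Aᵐᵒᵖ] P.complex.X n :=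
  TensorOver.contractLeft (resolutionAug P) (resolutionAug_smul P) (P.complex.X n) ∘ₗ
    ω.map 0 n n (zero_add n)

theorem Diagonal.leftCounit_d (ω : Diagonal P) (n : ℕ) (x : P.complex.X (n + 1)) :
    ω.leftCounit n ((P.complex.d (n + 1) n).hom x) =
      (P.complex.d (n + 1) n).hom (ω.leftCounit (n + 1) x) := by
  have h₁ := contractLeft_rowDifferential (M := fun n => P.complex.X n)
    (fun n => (P.complex.d (n + 1) n).hom) (resolutionAug_smul P) (resolution_aug_d P) n
    (ω.map 1 n (n + 1) (by omega) x)
  have h₂ := contractLeft_columnDifferential (M := fun n => P.complex.X n)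
    (fun n => (P.complex.d (n + 1) n).hom) (resolutionAug_smul P) n
    (ω.map 0 (n + 1) (n + 1) (by omega) x)
  change TensorOver.contractLeft (resolutionAug P) (resolutionAug_smul P) (P.complex.X n)
    (ω.map 0 n n _ _) = _
  rw [ω.comm, map_add]
  exact (congrArg₂ (· + ·) h₁ h₂).trans (zero_add _)

/-- The chain map `(π ⊗ 1) ∘ ω` is homotopic to the identity. -/
theorem Diagonal.exists_leftCounit_homotopy (ω : Diagonal P) :
    ∃ H : ∀ n, P.complex.X n →ₗ[A ⊗[k] Aᵐᵒᵖ] P.complex.X (n + 1),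
      (∀ x, (P.complex.d 1 0).hom (H 0 x) = ω.leftCounit 0 x - x) ∧
      ∀ n x, (P.complex.d (n + 2) (n + 1)).hom (H (n + 1) x) =
        ω.leftCounit (n + 1) x - x - H n ((P.complex.d (n + 1) n).hom x) := by
  have := resolution_projective P
  exact exists_nullHomotopy (P := fun n => P.complex.X n) (T := fun n => P.complex.X n)
    (fun n => (P.complex.d (n + 1) n).hom) (resolution_d_d P)
    (fun n => (P.complex.d (n + 1) n).hom) (resolution_exact P)
    (fun n => ω.leftCounit n - LinearMap.id)
    (fun n x => by
      rw [LinearMap.sub_apply, LinearMap.sub_apply, map_sub, ω.leftCounit_d]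
      rfl)
    (fun x => resolution_exact_zero P _ (by
      rw [LinearMap.sub_apply, map_sub]
      exact sub_eq_zero.2 ((resolutionAug_contractLeft _).trans (ω.aug x))))

end Cup

section CupLift

variable {k : Type u} [Field k] {G : Type v} [CommGroup G] [DecidableEq G]
  {A : Type u} [Ring A] [Algebra k A] [Coalgebra k A] {B : YDBimonoid k G A}
  {P : ProjectiveResolution (regBimod k A)}

open RightCoinvariants

/-- Composition with `(π ⊗ 1) ∘ ω` does not change the class of a cocycle. -/
theorem form_leftCounit_sub_mem_coboundary (X : YDResolution B P)
    (hX : ∀ n, (X.yd n).IsFiniteGradedFree) (ω : Diagonal P) {p : ℕ}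
    {f : P.complex.X p ⟶ algBimod B.aug} (hf : P.complex.d (p + 1) p ≫ f = 0) :
    form B (ModuleCat.ofHom (ω.leftCounit p) ≫ f) - form B f ∈
      (X.leftResolution hX).coboundary p := by
  obtain ⟨H, h₀, h⟩ := ω.exists_leftCounit_homotopy
  have hfd (x : P.complex.X (p + 1)) : homToLinear B.aug f ((P.complex.d (p + 1) p).hom x) = 0 :=
    congrArg (fun φ => homToLinear B.aug φ x) hf
  cases p with
  | zero =>
    refine (Submodule.mem_bot k).2 (LinearMap.ext fun x => ?_)
    obtain ⟨m, rfl⟩ := mk_surjective B x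
    rw [LinearMap.sub_apply, form_mk, form_mk]
    change homToLinear B.aug f (ω.leftCounit 0 m) - homToLinear B.aug f m = 0
    rw [← map_sub, ← h₀, hfd]
  | succ p =>
    refine ⟨form B (ModuleCat.ofHom (H p) ≫ f), form_mem_counitHoms _, LinearMap.ext fun x => ?_⟩
    obtain ⟨m, rfl⟩ := mk_surjective B x
    rw [LinearMap.sub_apply, form_mk, form_mk]
    change form B (ModuleCat.ofHom (H p) ≫ f)
      (mapLinear B (P.complex.d (p + 1) p).hom (mk B m)) = _
    rw [mapLinear_mk, form_mk]
    change homToLinear B.aug f (H p ((P.complex.d (p + 1) p).hom m)) =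
      homToLinear B.aug f (ω.leftCounit (p + 1) m) - homToLinear B.aug f m
    rw [← map_sub, ← sub_eq_zero, ← map_sub, ← neg_eq_zero, ← map_neg, neg_sub, ← h, hfd]

/-- The chain map `P_{p + •} ⊗_A k → P_• ⊗_A k` given by a diagonal and a cochain `f` of degree
`p`, which is `1 ⊗_A f` applied to the diagonal. -/
def cupLift (ω : Diagonal P) {p : ℕ} (f : P.complex.X p ⟶ algBimod B.aug) (j n : ℕ)
    (h : p + j = n) :
    RightCoinvariants B (P.complex.X n) →ₗ[A] RightCoinvariants B (P.complex.X j) :=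
  linearLift B (TensorOver.contractRight B f (P.complex.X j) ∘ₗ
      (ω.map j p n (by omega)).restrictScalars k)
    (fun a m => by
      rw [LinearMap.comp_apply, LinearMap.restrictScalars_apply, LinearMap.map_smul,
        TensorOver.contractRight_right_smul]
      rfl)
    (fun a m => by
      rw [LinearMap.comp_apply, LinearMap.restrictScalars_apply, LinearMap.map_smul,
        TensorOver.contractRight_left_smul]
      rfl)

theorem cupLift_mk (ω : Diagonal P) {p : ℕ} (f : P.complex.X p ⟶ algBimod B.aug) (j n : ℕ)
    (h : p + j = n) (x : P.complex.X n) : cupLift ω f j n h (mk B x) =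
      TensorOver.contractRight B f (P.complex.X j) (ω.map j p n (by omega) x) :=
  linearLift_mk _ _ _ _ _

theorem coinvariantsAug_contractRight {p : ℕ} (f : P.complex.X p ⟶ algBimod B.aug)
    (x : TensorOver k A (P.complex.X 0) (P.complex.X p)) :
    coinvariantsAug B P (TensorOver.contractRight B f (P.complex.X 0) x) =
      homToLinear B.aug f (TensorOver.contractLeft (resolutionAug P) (resolutionAug_smul P)
        (P.complex.X p) x) := by
  induction x using TensorOver.induction with
  | h0 => simp
  | ha x y hx hy => rw [map_add, map_add, hx, hy, map_add, map_add]
  | ht m n =>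
    rw [TensorOver.contractRight_tmul, TensorOver.contractLeft_tmul, map_smul, coinvariantsAug_mk,
      homToLinear_left, smul_eq_mul, mul_comm]
    rfl

/-- The lifted cocycle is `f ∘ (π ⊗ 1) ∘ ω` and not `f` itself, as a diagonal need not be
counital. -/
theorem isLift_cupLift (X : YDResolution B P)
    (hX : ∀ n, (X.yd n).IsFiniteGradedFree) (ω : Diagonal P) {p : ℕ} {f : P.complex.X p ⟶ algBimod B.aug}
    (hf : P.complex.d (p + 1) p ≫ f = 0) :
    (X.leftResolution hX).IsLift (form B (ModuleCat.ofHom (ω.leftCounit p) ≫ f))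
      (cupLift ω f) := by
  refine ⟨fun x => ?_, fun j n h x => ?_⟩
  · obtain ⟨m, rfl⟩ := mk_surjective B x
    rw [cupLift_mk, form_mk]
    exact coinvariantsAug_contractRight f _
  · obtain ⟨m, rfl⟩ := mk_surjective B x
    change mapLinear B _ (cupLift ω f (j + 1) (n + 1) _ (mk B m)) =
      cupLift ω f j n h (mapLinear B _ (mk B m))
    rw [cupLift_mk, mapLinear_mk, cupLift_mk, ω.comm, map_add, map_smul,
      TensorOver.contractRight_map_right B f _ hf, smul_zero, add_zero,
      TensorOver.contractRight_map_left]

theorem form_comp_cupLift (ω : Diagonal P) {p q n : ℕ} (h : p + q = n) (h' : q + p = n)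
    (f : P.complex.X p ⟶ algBimod B.aug) (g : P.complex.X q ⟶ algBimod B.aug) :
    form B g ∘ₗ (cupLift ω f q n h).restrictScalars k = form B (ω.cup B.aug n h' g f) := by
  have key (x : TensorOver k A (P.complex.X q) (P.complex.X p)) :
      form B g (TensorOver.contractRight B f (P.complex.X q) x) = tensorMul B.aug g f x := by
    induction x using TensorOver.induction with
    | h0 => simp
    | ha x y hx hy => rw [map_add, map_add, hx, hy, map_add]
    | ht m n =>
      rw [TensorOver.contractRight_tmul, map_smul, form_mk, tensorMul_tmul, smul_eq_mul, mul_comm]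
  refine LinearMap.ext fun x => ?_
  obtain ⟨m, rfl⟩ := mk_surjective B x
  rw [form_mk, LinearMap.comp_apply, LinearMap.restrictScalars_apply, cupLift_mk, key]
  rfl

theorem d_comp_cup (X : YDResolution B P)
    (hX : ∀ n, (X.yd n).IsFiniteGradedFree) (ω : Diagonal P) {p q n : ℕ} (h : p + q = n) (h' : q + p = n)
    {f : P.complex.X p ⟶ algBimod B.aug} (hf : P.complex.d (p + 1) p ≫ f = 0)
    {g : P.complex.X q ⟶ algBimod B.aug} (hg : P.complex.d (q + 1) q ≫ g = 0) :
    P.complex.d (n + 1) n ≫ ω.cup B.aug n h' g f = 0 := by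
  have hc := (isLift_cupLift X hX ω hf).comp_mem_cocycle h (form_mem_cocycle X hX hg)
  rw [form_comp_cupLift ω h h'] at hc
  have := d_comp_ofForm X hX hc
  rwa [ofForm_form] at this

/-- The Yoneda product is the opposite cup product. -/
theorem hochschildModel_mul (X : YDResolution B P)
    (hX : ∀ n, (X.yd n).IsFiniteGradedFree) (ω : Diagonal P) {p q n : ℕ} (h : p + q = n) (h' : q + p = n)
    {f : P.complex.X p ⟶ algBimod B.aug} (hf : P.complex.d (p + 1) p ≫ f = 0)
    {g : P.complex.X q ⟶ algBimod B.aug} (hg : P.complex.d (q + 1) q ≫ g = 0) :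
    (hochschildModel X hX).mul p q n h (P.extMk f (p + 1) rfl hf) (P.extMk g (q + 1) rfl hg) =
      P.extMk (ω.cup B.aug n h' g f) (n + 1) rfl (d_comp_cup X hX ω h h' hf hg) := by
  rw [← extClass_form X hX hf, ← extClass_form X hX hg, ← extClass_form X hX]
  refine ((hochschildModel X hX).mul_cls_of_sub_mem h (form_mem_cocycle X hX hf)
    (form_leftCounit_sub_mem_coboundary X hX ω hf) (form_mem_cocycle X hX hg)
    (isLift_cupLift X hX ω hf)).trans ?_
  exact congrArg (extClass X hX n) (Subtype.ext (form_comp_cupLift ω h h' f g))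

theorem hochschildModel_mem_gr (X : YDResolution B P)
    (hX : ∀ n, (X.yd n).IsFiniteGradedFree) (n : ℕ) (h : G) (α : HochschildCohomology B.aug n) :
    α ∈ (hochschildModel X hX).gr n h ↔
      ∃ (f : P.complex.X n ⟶ algBimod B.aug) (hf : P.complex.d (n + 1) n ≫ f = 0),
        (X.yd n).IsHomogeneous h f ∧ P.extMk f (n + 1) rfl hf = α := by
  refine (hochschildModel X hX).mem_gr.trans ⟨?_, ?_⟩
  · rintro ⟨f, hf, hfh, rfl⟩
    exact ⟨_, d_comp_ofForm X hX hf, fun s hs x hx => hfh s hs _ (mk_mem_gr (X.yd n) hx), rfl⟩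
  · rintro ⟨f, hf, hfh, rfl⟩
    refine ⟨_, form_mem_cocycle X hX hf, ?_, extClass_form X hX hf⟩
    rintro s hs _ ⟨x, hx, rfl⟩
    rw [form_mk]
    exact hfh s hs x hx

theorem hochschildModel_act (X : YDResolution B P) (hX : ∀ n, (X.yd n).IsFiniteGradedFree) (n : ℕ)
    (g : G) (f : P.complex.X n ⟶ algBimod B.aug) (hf : P.complex.d (n + 1) n ≫ f = 0) :
    ∃ (f' : P.complex.X n ⟶ algBimod B.aug) (hf' : P.complex.d (n + 1) n ≫ f' = 0),
      (∀ x, homToLinear B.aug f' x = homToLinear B.aug f ((X.yd n).act g⁻¹ x)) ∧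
      (hochschildModel X hX).act n g (P.extMk f (n + 1) rfl hf) =
        P.extMk f' (n + 1) rfl hf' := by
  have hc := YDLeftResolution.formAct_mem_cocycle (L := X.leftResolution hX) g
    (form_mem_cocycle X hX hf)
  refine ⟨_, d_comp_ofForm X hX hc, fun x => ?_, ?_⟩
  · rw [homToLinear_ofForm, formAct_apply]
    change form B f ((ydModule (X.yd n)).act g⁻¹ (mk B x)) = _
    rw [ydModule_act_mk, form_mk]
  · refine (congrArg _ (extClass_form X hX hf).symm).trans ?_
    exact (hochschildModel X hX).act_cls g (form_mem_cocycle X hX hf)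

end CupLift

end

theorem mainTheorem2 {k : Type u} [Field k] {G : Type v} [CommGroup G] [DecidableEq G]
    {A : Type u} [Ring A] [Algebra k A] [Coalgebra k A] (B : YDBimonoid k G A)
    (P : ProjectiveResolution (regBimod k A)) (X : YDResolution B P)
    (hX : ∀ n, (X.yd n).IsFiniteGradedFree) :
    Nonempty (Diagonal P) ∧
    ∃ S : GradedBraidedCommAlgebra k G (HochschildCohomology B.aug),
      (∀ (n : ℕ) (h : G) (α : HochschildCohomology B.aug n), α ∈ (S.yd n).gr h ↔
        ∃ (f : P.complex.X n ⟶ algBimod B.aug) (hf : P.complex.d (n + 1) n ≫ f = 0),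
          (X.yd n).IsHomogeneous h f ∧ P.extMk f (n + 1) rfl hf = α) ∧
      (∀ (n : ℕ) (g : G) (f : P.complex.X n ⟶ algBimod B.aug)
        (hf : P.complex.d (n + 1) n ≫ f = 0),
        ∃ (f' : P.complex.X n ⟶ algBimod B.aug) (hf' : P.complex.d (n + 1) n ≫ f' = 0),
          (∀ x, homToLinear B.aug f' x = homToLinear B.aug f ((X.yd n).act g⁻¹ x)) ∧
          (S.yd n).act g (P.extMk f (n + 1) rfl hf) = P.extMk f' (n + 1) rfl hf') ∧
      (∃ h₁ : P.complex.d 1 0 ≫ P.π.f 0 ≫ algBimodUnit B.aug = 0,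
        S.one = P.extMk (P.π.f 0 ≫ algBimodUnit B.aug) 1 rfl h₁) ∧
      ∀ (ω : Diagonal P) (p q n : ℕ) (h : p + q = n) (h' : q + p = n)
        (f : P.complex.X p ⟶ algBimod B.aug) (hf : P.complex.d (p + 1) p ≫ f = 0)
        (f' : P.complex.X q ⟶ algBimod B.aug) (hf' : P.complex.d (q + 1) q ≫ f' = 0),
        ∃ hc : P.complex.d (n + 1) n ≫ ω.cup B.aug n h' f' f = 0,
          S.mul p q n h (P.extMk f (p + 1) rfl hf) (P.extMk f' (q + 1) rfl hf') =
            P.extMk (ω.cup B.aug n h' f' f) (n + 1) rfl hc := by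
  have h₁ : P.complex.d 1 0 ≫ P.π.f 0 ≫ algBimodUnit B.aug = 0 :=
    homToLinear_injective B.aug (LinearMap.ext fun x =>
      (congrArg B.aug (resolution_aug_d P x)).trans (map_zero _))
  exact ⟨nonempty_diagonal_of_contraction _ (resolutionAug_base P) (X.contraction hX)
    (X.contraction_right hX) (X.d_contraction_zero hX) (X.d_contraction_succ hX),
    (hochschildModel X hX).algebra, hochschildModel_mem_gr X hX, hochschildModel_act X hX,
    ⟨h₁, extClass_form X hX h₁⟩, fun ω p q n h h' f hf f' hf' =>
      ⟨d_comp_cup X hX ω h h' hf hf', hochschildModel_mul X hX ω h h' hf hf'⟩⟩
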